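/- Let $(M,\omega)$ be a closed symplectic manifold of dimension $2n$ which is integral, i.e. $[\omega]$ lies in the image of $H^2(M;\mathbb{Z})\to H^2(M;\mathbb{R})$, and let $i:L\hookrightarrow M$ be the inclusion of a closed Lagrangian submanifold such that $i_*:H_1(L;\mathbb{R})\to H_1(M;\mathbb{R})$ is injective. For a smooth complex line bundle $E\to M$, a connection $1$-form on $E$ is a smooth real $1$-form $\alpha$ on $E\setminus M$ (the complement of the zero section) which is invariant under multiplication by nonzero complex numbers and takes the value $1$ on the generator of the circle action $e^{2\pi i t}$ and $0$ on the radial vector field, i.e. a Hermitian connection. Its curvature $F_\alpha\in\Omega^2(M)$ is given by $d\alpha=p^*F_\alpha$, where $p:E\to M$ is the projection; in this normalization $c_1(E)=-[F_\alpha]\in H^2(M;\mathbb{R})$. Its holonomy along a loop $\gamma$ is $\mathrm{hol}_\alpha(\gamma)=-\int_{S^1}\eta^*\alpha\in S^1=\mathbb{R}/\mathbb{Z}$ for any loop $\eta$ in $E\setminus M$ lifting $\gamma$. The pair $(E,\alpha)$ is a Bohr–Sommerfeld pair of power $N\in\mathbb{N}_{>0}$ for $(M,\omega,L)$ if $F_\alpha=N\omega$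 and $\mathrm{hol}_\alpha(\gamma)\in\{0,\tfrac12\}\subset\mathbb{R}/\mathbb{Z}$ for every loop $\gamma$ in $L$. Then there exists a smooth complex line bundle $E\to M$ with $c_1(E)=-[\omega]$ in $H^2(M;\mathbb{R})$, and for every such $E$ the following holds. (a) There exist an integer $N>0$ and a connection $1$-form $\alpha$ on $E^{\otimes N}$ such that $(E^{\otimes N},\alpha)$ is a Bohr–Sommerfeld pair of power $N$ for $(M,\omega,L)$. (b) If $H^2(L;\mathbb{Z})$ is a free abelian group, one can choose $N=1$ in (a). -/

import Mathlib

open Set Bundle MeasureTheory CategoryTheory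
open scoped Manifold ContDiff Topology

universe u v w

noncomputable section

/-! ### Differential forms on manifolds without boundary -/

section Forms

variable {E : Type*} [NormedAddCommGroup E] [NormedSpace ℝ E]
  {H : Type*} [TopologicalSpace H] (I : ModelWithCorners ℝ E H)
  {M : Type*} [TopologicalSpace M] [ChartedSpace H M]
  {E' : Type*} [NormedAddCommGroup E'] [NormedSpace ℝ E']
  {H' : Type*} [TopologicalSpace H'] (I' : ModelWithCorners ℝ E' H')
  {M' : Type*} [TopologicalSpace M'] [ChartedSpace H' M']

/-- A (not necessarily smooth) real differential `k`-form on the manifold `M`. -/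
abbrev DiffForm (M : Type*) [TopologicalSpace M] [ChartedSpace H M] (k : ℕ) : Type _ :=
  ∀ x : M, TangentSpace I x [⋀^Fin k]→L[ℝ] ℝ

variable {I I'} {k : ℕ}

/-- The pullback `f^* η` of a differential form along a smooth map `f`. -/
def DiffForm.pullback (f : M → M') (η : DiffForm I' M' k) : DiffForm I M k :=
  fun x => (η (f x)).compContinuousLinearMap (mfderiv I I' f x)

/-- The coordinate expression of `η` in the preferred chart at `x₀`, a `k`-form on the part
`(extChartAt I x₀).target` of the model space. -/
def DiffForm.inChart (η : DiffForm I M k) (x₀ : M) : E → E [⋀^Fin k]→L[ℝ] ℝ :=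
  DiffForm.pullback (I := 𝓘(ℝ, E)) (extChartAt I x₀).symm η

/-- The form `η` is of class `C^∞` on the open set `s`: all its coordinate expressions are. -/
def DiffForm.SmoothOn (η : DiffForm I M k) (s : Set M) : Prop :=
  ∀ x₀ : M, ContDiffOn ℝ ∞ (η.inChart x₀)
    ((extChartAt I x₀).target ∩ (extChartAt I x₀).symm ⁻¹' s)

/-- The form `η` is of class `C^∞`. -/
def DiffForm.Smooth (η : DiffForm I M k) : Prop := η.SmoothOn univ

/-- The exterior derivative: at `x` it is the exterior derivative of the coordinate expression in
a chart around `x` (the manifolds below have no boundary). -/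
def DiffForm.d (η : DiffForm I M k) : DiffForm I M (k + 1) :=
  fun x => (extDeriv (η.inChart x) (extChartAt I x x)).compContinuousLinearMap
    (mfderiv I 𝓘(ℝ, E) (extChartAt I x) x)

/-- A symplectic form: a smooth, closed, nondegenerate 2-form. -/
structure IsSymplectic (Ω : DiffForm I M 2) : Prop where
  smooth : Ω.Smooth
  closed : Ω.d = 0
  nondegenerate : ∀ (x : M) (a : TangentSpace I x),
    (∀ b : TangentSpace I x, Ω x ![a, b] = 0) → a = 0

end Forms

/-! ### Singular cohomology with coefficients in an abelian group -/

section Singular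

variable (X : Type u) [TopologicalSpace X] (A : Type v) [AddCommGroup A]

/-- Singular `k`-simplices of `X`. -/
abbrev SingularSimplex (k : ℕ) : Type u := C(stdSimplex ℝ (Fin (k + 1)), X)

/-- Singular `k`-cochains of `X` with values in `A`. -/
abbrev SingularCochain (k : ℕ) : Type (max u v) := SingularSimplex X k → A

variable {X A}

/-- The `i`-th face of a singular simplex. -/
def SingularSimplex.face {k : ℕ} (σ : SingularSimplex X (k + 1)) (i : Fin (k + 2)) :
    SingularSimplex X k :=
  σ.comp ⟨stdSimplex.map i.succAbove, stdSimplex.continuous_map _⟩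

variable (X A) in
/-- The singular coboundary operator `δ`. -/
def singularCoboundary (k : ℕ) : SingularCochain X A k →+ SingularCochain X A (k + 1) where
  toFun c σ := ∑ i : Fin (k + 2), (-1 : ℤ) ^ (i : ℕ) • c (SingularSimplex.face σ i)
  map_zero' := by ext; simp
  map_add' c c' := by ext; simp [Finset.sum_add_distrib]

variable (X A) in
/-- The second singular cohomology group `H²(X; A)`, cocycles modulo coboundaries. -/
abbrev SingularH2 : Type (max u v) :=
  (singularCoboundary X A 2).ker ⧸
    (singularCoboundary X A 1).range.addSubgroupOf (singularCoboundary X A 2).ker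

end Singular

/-- The map `H_1(X; ℝ) → H_1(Y; ℝ)` induced by a continuous map on singular homology. -/
def singularH1Map {X Y : Type u} [TopologicalSpace X] [TopologicalSpace Y] (f : C(X, Y)) :
    (((AlgebraicTopology.singularHomologyFunctor (ModuleCat.{u} ℝ) 1).obj
        (ModuleCat.of ℝ (ULift.{u} ℝ))).obj (TopCat.of X)) ⟶
      (((AlgebraicTopology.singularHomologyFunctor (ModuleCat.{u} ℝ) 1).obj
        (ModuleCat.of ℝ (ULift.{u} ℝ))).obj (TopCat.of Y)) :=
  ((AlgebraicTopology.singularHomologyFunctor (ModuleCat.{u} ℝ) 1).obj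
    (ModuleCat.of ℝ (ULift.{u} ℝ))).map (TopCat.ofHom f)

/-! ### Integral 2-forms and Lagrangian submanifolds -/

section Integral

variable {E : Type*} [NormedAddCommGroup E] [NormedSpace ℝ E]
  {H : Type*} [TopologicalSpace H] {I : ModelWithCorners ℝ E H}
  {M : Type u} [TopologicalSpace M] [ChartedSpace H M]

/-- The triangle `{(s, t) | 0 ≤ s, 0 ≤ t, s + t ≤ 1}`. -/
def unitTriangle : Set (ℝ × ℝ) := {q | 0 ≤ q.1 ∧ 0 ≤ q.2 ∧ q.1 + q.2 ≤ 1}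

/-- The integral of the pullback of the 2-form `Ω` along `f : ℝ² ⊇ Δ → M`, where `Δ` is the
unit triangle. -/
def integralOverTriangle (Ω : DiffForm I M 2) (f : ℝ × ℝ → M) : ℝ :=
  ∫ q in unitTriangle, DiffForm.pullback (I := 𝓘(ℝ, ℝ × ℝ)) f Ω q ![((1 : ℝ), (0 : ℝ)), (0, 1)]

/-- `f` is a smooth parametrization (defined and smooth near the unit triangle) of the singular
2-simplex `σ`, where the triangle is identified with the standard 2-simplex through the last two
barycentric coordinates. -/
def IsSmoothParam (I : ModelWithCorners ℝ E H) (σ : SingularSimplex M 2) (f : ℝ × ℝ → M) : Prop :=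
  (∃ U : Set (ℝ × ℝ), IsOpen U ∧ unitTriangle ⊆ U ∧ ContMDiffOn 𝓘(ℝ, ℝ × ℝ) I ∞ f U) ∧
    ∀ p : stdSimplex ℝ (Fin 3), σ p = f (p 1, p 2)

/-- The de Rham class of the closed 2-form `Ω` is integral, `[Ω] ∈ H²(M; ℤ)`, i.e. it lies in the
image of `H²(M; ℤ) → H²(M; ℝ)`: there is an integral singular 2-cocycle `c` which, on smooth
singular simplices, is cohomologous to the cocycle `σ ↦ ∫_σ Ω` given by the de Rham map. -/
def IsIntegralForm (Ω : DiffForm I M 2) : Prop :=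
  ∃ c : SingularCochain M ℤ 2, singularCoboundary M ℤ 2 c = 0 ∧
    ∃ b : SingularCochain M ℝ 1, ∀ (σ : SingularSimplex M 2) (f : ℝ × ℝ → M),
      IsSmoothParam I σ f →
        integralOverTriangle Ω f = (c σ : ℝ) + singularCoboundary M ℝ 1 b σ

end Integral

/-- `i : L → M` is the inclusion of a Lagrangian submanifold of the `2n`-dimensional manifold
`(M, Ω)`: a smooth embedding of an `n`-dimensional manifold with `i^* Ω = 0`. -/
structure IsLagrangianEmbedding {n : ℕ}
    {M : Type u} [TopologicalSpace M] [ChartedSpace (EuclideanSpace ℝ (Fin (2 * n))) M]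
    {L : Type v} [TopologicalSpace L] [ChartedSpace (EuclideanSpace ℝ (Fin n)) L]
    (Ω : DiffForm (𝓡 (2 * n)) M 2) (i : C(L, M)) : Prop where
  embedding : Manifold.IsSmoothEmbedding (𝓡 n) (𝓡 (2 * n)) ∞ i
  isotropic : DiffForm.pullback (I := 𝓡 n) i Ω = 0

/-! ### Smooth complex line bundles -/

section LineBundle

variable {m : ℕ}

/-- A smooth complex line bundle over `M`, given by an open cover of `M` and smooth transition
functions `g i j : U i ∩ U j → ℂ` satisfying the cocycle condition: a vector with coordinate
`z` over `U i` has coordinate `g i j x * z` over `U j`. Every smooth complex line bundle is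
isomorphic to one of these; as for Mathlib's bundle cores, a preferred set of the cover is chosen
around each point. -/
structure LineBundle (m : ℕ) (M : Type u) [TopologicalSpace M]
    [ChartedSpace (EuclideanSpace ℝ (Fin m)) M] where
  ι : Type w
  baseSet : ι → Set M
  isOpen_baseSet : ∀ i, IsOpen (baseSet i)
  indexAt : M → ι
  mem_baseSet_at : ∀ x, x ∈ baseSet (indexAt x)
  g : ι → ι → M → ℂ
  contMDiffOn_g : ∀ i j, ContMDiffOn (𝓡 m) 𝓘(ℝ, ℂ) ∞ (g i j) (baseSet i ∩ baseSet j)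
  g_self : ∀ i, ∀ x ∈ baseSet i, g i i x = 1
  g_comp : ∀ i j k, ∀ x ∈ baseSet i ∩ baseSet j ∩ baseSet k, g j k x * g i j x = g i k x

namespace LineBundle

variable {M : Type u} [TopologicalSpace M] [ChartedSpace (EuclideanSpace ℝ (Fin m)) M]

/-- The underlying real vector bundle of rank 2. -/
def core (E : LineBundle.{u, w} m M) : VectorBundleCore ℝ M ℂ E.ι where
  baseSet := E.baseSet
  isOpen_baseSet := E.isOpen_baseSet
  indexAt := E.indexAt
  mem_baseSet_at := E.mem_baseSet_at
  coordChange i j x := ContinuousLinearMap.mul ℝ ℂ (E.g i j x)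
  coordChange_self i x hx v := by simp [E.g_self i x hx]
  continuousOn_coordChange i j :=
    (ContinuousLinearMap.mul ℝ ℂ).continuous.comp_continuousOn (E.contMDiffOn_g i j).continuousOn
  coordChange_comp i j k x hx v := by
    simp [← E.g_comp i j k x hx, mul_assoc]

instance (E : LineBundle.{u, w} m M) : E.core.IsContMDiff (𝓡 m) ∞ where
  contMDiffOn_coordChange i j :=
    (ContinuousLinearMap.mul ℝ ℂ).contMDiff.comp_contMDiffOn (E.contMDiffOn_g i j)

/-- The total space of a line bundle. -/
abbrev Total (E : LineBundle.{u, w} m M) : Type u := TotalSpace ℂ E.core.Fiber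

/-- The model with corners of the total space of a line bundle over an `m`-manifold. -/
abbrev totalModel (m : ℕ) :
    ModelWithCorners ℝ (EuclideanSpace ℝ (Fin m) × ℂ)
      (ModelProd (EuclideanSpace ℝ (Fin m)) ℂ) :=
  (𝓡 m).prod 𝓘(ℝ, ℂ)

/-- The fibre coordinate of a vector in the preferred trivialization around its base point. -/
def coord (E : LineBundle.{u, w} m M) (p : E.Total) : ℂ := p.2

/-- The complement of the zero section. -/
def nonzero (E : LineBundle.{u, w} m M) : Set E.Total := {p | E.coord p ≠ 0}

/-- Fibrewise multiplication by the complex number `z`. -/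
def smul (E : LineBundle.{u, w} m M) (z : ℂ) (p : E.Total) : E.Total :=
  ⟨p.1, (z * E.coord p : ℂ)⟩

/-- The `N`-th tensor power `E^{⊗N}`: its transition functions are the `N`-th powers. -/
def tensorPower (E : LineBundle.{u, w} m M) (N : ℕ) : LineBundle.{u, w} m M where
  ι := E.ι
  baseSet := E.baseSet
  isOpen_baseSet := E.isOpen_baseSet
  indexAt := E.indexAt
  mem_baseSet_at := E.mem_baseSet_at
  g i j x := E.g i j x ^ N
  contMDiffOn_g i j := by
    have h : ContDiff ℝ ∞ (fun z : ℂ => z ^ N) := by fun_prop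
    exact h.contMDiff.comp_contMDiffOn (E.contMDiffOn_g i j)
  g_self i x hx := by simp [E.g_self i x hx]
  g_comp i j k x hx := by rw [← mul_pow, E.g_comp i j k x hx]

theorem tensorPower_one (E : LineBundle.{u, w} m M) : E.tensorPower 1 = E := by
  simp [tensorPower]

/-- A connection 1-form on the complex line bundle `E` (with respect to `S¹ = ℝ/ℤ` acting through
`e^{2πit}`): a smooth real 1-form `α` on the complement of the zero section which is invariant
under multiplication by nonzero complex numbers, and takes the value `1` on the generator of the
circle action and `0` on the radial vector field. Equivalently, `α` is the pullback of a principal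
connection on the unit circle bundle `(E ∖ 0)/ℝ_{>0}`, i.e. a Hermitian connection. The values of
`form` on the zero section are irrelevant. -/
structure Connection (E : LineBundle.{u, w} m M) where
  form : DiffForm (totalModel m) E.Total 1
  smoothOn : form.SmoothOn E.nonzero
  invariant : ∀ z : ℂ, z ≠ 0 → ∀ p ∈ E.nonzero,
    DiffForm.pullback (I := totalModel m) (E.smul z) form p = form p
  vertical : ∀ p ∈ E.nonzero, ∀ z : ℂ,
    DiffForm.pullback (I := 𝓘(ℝ, ℝ)) (fun t : ℝ => E.smul (Complex.exp (t * z)) p) form 0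
      ![(1 : ℝ)] = z.im / (2 * Real.pi)

namespace Connection

variable {E : LineBundle.{u, w} m M}

/-- The curvature `F_α` of `α` is the 2-form `F` on `M`, i.e. `dα = p^* F`. -/
def HasCurvature (α : E.Connection) (F : DiffForm (𝓡 m) M 2) : Prop :=
  ∀ p ∈ E.nonzero,
    α.form.d p = DiffForm.pullback (I := totalModel m) (TotalSpace.proj : E.Total → M) F p

/-- `η` is a smooth loop (parametrized by `ℝ/ℤ`) of nonzero vectors of `E` over the loop `γ`. -/
def IsLoopLift (E : LineBundle.{u, w} m M) (γ : ℝ → M) (η : ℝ → E.Total) : Prop :=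
  ContMDiff 𝓘(ℝ, ℝ) (totalModel m) ∞ η ∧ Function.Periodic η 1 ∧
    (∀ t, η t ∈ E.nonzero) ∧ ∀ t, (η t).proj = γ t

/-- The holonomy of `α` along the loop `γ : ℝ/ℤ → M` is `h ∈ S¹ = ℝ/ℤ`: one has
`h = - ∫_{S¹} η^* α` for every loop `η` of nonzero vectors of `E` over `γ`, and there is such
a loop. -/
def HasHolonomy (α : E.Connection) (γ : ℝ → M) (h : AddCircle (1 : ℝ)) : Prop :=
  (∃ η, IsLoopLift E γ η) ∧ ∀ η, IsLoopLift E γ η →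
    ((-∫ t in (0 : ℝ)..1, DiffForm.pullback (I := 𝓘(ℝ, ℝ)) η α.form t ![(1 : ℝ)] : ℝ) :
      AddCircle (1 : ℝ)) = h

end Connection

/-- The real first Chern class of `E` is the de Rham class of the 2-form `σ`. By Chern-Weil theory,
in the present normalization, `c₁(E) = -[F_α] ∈ H²(M; ℝ)` for any connection `α` on `E`; so this
says that `σ = -F_α + dτ` for some connection `α` on `E` and smooth 1-form `τ` on `M`. -/
def HasRealChernClass (E : LineBundle.{u, w} m M) (σ : DiffForm (𝓡 m) M 2) : Prop :=
  ∃ (α : E.Connection) (F : DiffForm (𝓡 m) M 2) (τ : DiffForm (𝓡 m) M 1),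
    F.Smooth ∧ α.HasCurvature F ∧ τ.Smooth ∧ σ = -F + τ.d

end LineBundle

end LineBundle

/-- `(E, α)` is a Bohr-Sommerfeld pair of power `N` for `(M, Ω, L)`, `i : L → M` being the
inclusion: the curvature of `α` is `N Ω` and the holonomy of `α` along all loops in `L` takes
values in `{0, 1/2} ⊂ ℝ/ℤ`. (On `L` the connection is flat, so that the holonomy depends only on
the class of the loop in `π₁(L)`, and every class contains smooth loops.) -/
structure IsBohrSommerfeldPair {n : ℕ}
    {M : Type u} [TopologicalSpace M] [ChartedSpace (EuclideanSpace ℝ (Fin (2 * n))) M]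
    {L : Type v} [TopologicalSpace L] [ChartedSpace (EuclideanSpace ℝ (Fin n)) L]
    (Ω : DiffForm (𝓡 (2 * n)) M 2) (i : C(L, M))
    (E : LineBundle.{u, w} (2 * n) M) (α : E.Connection) (N : ℕ) : Prop where
  pos : 0 < N
  curvature : α.HasCurvature ((N : ℝ) • Ω)
  holonomy : ∀ γ : ℝ → L, ContMDiff 𝓘(ℝ, ℝ) (𝓡 n) ∞ γ → Function.Periodic γ 1 →
    ∃ h ∈ ({0, ((1 / 2 : ℝ) : AddCircle (1 : ℝ))} : Set (AddCircle (1 : ℝ))),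
      α.HasHolonomy (i ∘ γ) h

end

set_option linter.unusedSectionVars false

noncomputable section

/-! ### Extending real 1-cocycles along a chain map injective on `H_1`. -/

section Homology

open Limits HomologicalComplex

/-! Over `L` a connection of curvature `Ω` is flat, and its holonomy is a class in `H¹(L; ℝ/ℤ)`.
Adding a closed 1-form `β` on `M` to a connection leaves the curvature alone and changes the
holonomy by the periods of `β`. The question is thus how much of the holonomy comes from a real
class of `M`; the proof makes it vanish altogether, so the value `1/2` is never taken.

Let `θ i` be local connection forms of `E` with `dθ i = Ω`, obtained by correcting any connection by
the form `τ` in the Chern class condition. As `L` is isotropic, the pulled back `θ i` have local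
primitives, and the phases of the resulting local parallel sections differ by locally constant
functions with values in `ℝ/ℤ`. Compactness of `L` turns these data into a singular 1-cocycle `c`
with values in a finitely generated subgroup `G` of `ℝ/ℤ` (`exists_fg_cocycle_of_flat`). The torsion
of `G` has an exponent `N`, so multiplication by `N` on `G` lifts to a homomorphism to `ℝ` and `N •
c` is the reduction of a real cocycle `a`. In particular the Bockstein of `c` is an `N`-torsion
class in `H²(L; ℤ)`; if that group is free the class is zero, and `c` itself lifts
(`exists_real_cocycle_lift`).

Injectivity on `H_1` and exactness of real duality make `a` the restriction of a real cocycle of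
`M`, up to a coboundary (`exists_singularCocycle_extension`). A partition of unity represents the
latter by a closed 1-form `β` (`exists_closed_form_of_cocycle`). The connection on the `N`-th tensor
power with local forms `N θ i + β` has curvature `N Ω` and a parallel section over `L`
(`exists_parallel_section_tensorPower`), whence trivial holonomy.

The existence of `E` is Weil's construction. On a chart ball, `Ω` is the differential of its radial
primitive, and the integral of `Ω` over a cone equals the integral of this primitive over the base
(`integral_coneMap`). Integrality expresses the integral over the cone, modulo `ℤ`, as a coboundary
`δb`. The values of `-b` on straight segments are therefore `ℝ/ℤ`-valued potentials `f i` such that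
`f i - f j` is locally a primitive of the difference of the radial primitives
(`exists_integral_potentials`), and the transition functions are `exp (2πi (f i - f j))`.

Cochains and forms are compared only locally: the value of a cochain on a short path is matched with
the increment of a local function. The auxiliary functions on points (`w`, `κ`, `f`) may be
discontinuous; only suitable combinations of them are smooth or locally constant. -/

theorem injective_moduleCat_real (A : ModuleCat.{u} ℝ) : Injective A where
  factors {X Y} g f hf := by
    obtain ⟨r, hr⟩ := LinearMap.exists_leftInverse_of_injective f.hom
      (LinearMap.ker_eq_bot.2 ((ModuleCat.mono_iff_injective f).1 hf))
    refine ⟨ModuleCat.ofHom (g.hom ∘ₗ r), ?_⟩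
    ext x
    simpa using congrArg g.hom (LinearMap.congr_fun hr x)

/-- If a chain map is injective on `H_1`, then every 1-cocycle of the source is, up to a
coboundary, the restriction of a 1-cocycle of the target. -/
theorem exists_cocycle_extension {K K' : ChainComplex (ModuleCat.{u} ℝ) ℕ} (φ : K ⟶ K')
    [Mono (homologyMap φ 1)] {R : ModuleCat.{u} ℝ} (a : K.X 1 ⟶ R) (ha : K.d 2 1 ≫ a = 0) :
    ∃ (a' : K'.X 1 ⟶ R) (w : K.X 0 ⟶ R), K'.d 2 1 ≫ a' = 0 ∧ φ.f 1 ≫ a' = a + K.d 1 0 ≫ w := by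
  have := injective_moduleCat_real R
  have h2 : (ComplexShape.down ℕ).prev 1 = 2 := by simp
  have h0 : (ComplexShape.down ℕ).next 1 = 0 := by simp
  -- Since `a` kills boundaries it lives on the opcycles `K_1 / im d`. Its restriction to `H_1(K)`
  -- extends first to `H_1(K')` and then to the opcycles of `K'`, because `R` is injective and both
  -- maps are monomorphisms.
  let g := Injective.factorThru (K.homologyι 1 ≫ K.descOpcycles a 2 h2 ha) (homologyMap φ 1)
  let g' := Injective.factorThru g (K'.homologyι 1)
  have hg : homologyMap φ 1 ≫ g = K.homologyι 1 ≫ K.descOpcycles a 2 h2 ha :=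
    Injective.comp_factorThru _ _
  have hg' : K'.homologyι 1 ≫ g' = g := Injective.comp_factorThru _ _
  let e := opcyclesMap φ 1 ≫ g' - K.descOpcycles a 2 h2 ha
  have he : K.homologyι 1 ≫ e = 0 := by
    rw [Preadditive.comp_sub, ← homologyι_naturality_assoc, hg', hg, sub_self]
  -- The error `e` vanishes on `H_1(K)`, the kernel of the map from opcycles to `K_0`, so it factors
  -- through that map; the factor is the 0-cochain `w`.
  have hex : (ShortComplex.mk (K.homologyι 1) (K.fromOpcycles 1 0) (by simp)).Exact :=
    ShortComplex.exact_of_f_is_kernel _ (K.homologyIsKernel 1 0 h0)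
  refine ⟨K'.pOpcycles 1 ≫ g', hex.descToInjective e he, by simp, ?_⟩
  have hw : K.fromOpcycles 1 0 ≫ hex.descToInjective e he = e := hex.comp_descToInjective e he
  rw [← K.p_fromOpcycles 1 0, Category.assoc, hw, Preadditive.comp_sub, p_descOpcycles,
    p_opcyclesMap_assoc]
  abel

end Homology

/-! ### Dictionary between functions on simplices and linear maps on singular chains. -/

section SingularExtension

open Limits HomologicalComplex AlgebraicTopology Simplicial Opposite

variable {X Y : Type u} [TopologicalSpace X] [TopologicalSpace Y]

/-- The point of a topological space given by a singular 0-simplex, and conversely. -/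
def pointSimplex (x : X) : SingularSimplex X 0 := .const _ x

theorem singularSimplex_zero_eq (σ : SingularSimplex X 0) :
    σ = pointSimplex (σ (stdSimplex.vertex 0)) := by
  ext p
  have : p = stdSimplex.vertex 0 := Subsingleton.elim _ _
  rw [this]; rfl

/-- The initial point of a path, parametrized by the standard 1-simplex. -/
def SingularSimplex.source (s : SingularSimplex X 1) : X := s (stdSimplex.vertex 0)

/-- The final point of a path, parametrized by the standard 1-simplex. -/
def SingularSimplex.target (s : SingularSimplex X 1) : X := s (stdSimplex.vertex 1)

theorem SingularSimplex.face_zero_one (s : SingularSimplex X 1) :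
    s.face 0 = pointSimplex s.target := by
  rw [singularSimplex_zero_eq (s.face 0)]
  congr 1
  simp [SingularSimplex.face, SingularSimplex.target]

theorem SingularSimplex.face_one_one (s : SingularSimplex X 1) :
    s.face 1 = pointSimplex s.source := by
  rw [singularSimplex_zero_eq (s.face 1)]
  congr 1
  simp [SingularSimplex.face, SingularSimplex.source]

/-- The morphism from singular chains to `R` given by a cochain. -/
def cochainHom {k : ℕ} (a : SingularCochain X ℝ k) :
    ((TopCat.toSSet.obj (TopCat.of X)).chainComplex (ModuleCat.of ℝ (ULift.{u} ℝ))).X k ⟶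
      ModuleCat.of ℝ (ULift.{u} ℝ) :=
  Sigma.desc fun σ => ModuleCat.ofHom
    (a ((TopCat.toSSetObjEquiv (TopCat.of X) (op ⦋k⦌)) σ) • LinearMap.id)

/-- The value of a morphism from singular chains to `ℝ` on a simplex. -/
def homCochain {k : ℕ}
    (f : ((TopCat.toSSet.obj (TopCat.of X)).chainComplex (ModuleCat.of ℝ (ULift.{u} ℝ))).X k ⟶
      ModuleCat.of ℝ (ULift.{u} ℝ)) : SingularCochain X ℝ k := fun σ =>
  (((TopCat.toSSet.obj (TopCat.of X)).ιChainComplex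
    ((TopCat.toSSetObjEquiv (TopCat.of X) (op ⦋k⦌)).symm σ) ≫ f).hom (ULift.up 1)).down

theorem ι_cochainHom {k : ℕ} (a : SingularCochain X ℝ k) (σ) :
    (TopCat.toSSet.obj (TopCat.of X)).ιChainComplex σ ≫ cochainHom a =
      ModuleCat.ofHom (a ((TopCat.toSSetObjEquiv (TopCat.of X) (op ⦋k⦌)) σ) • LinearMap.id) := by
  unfold cochainHom SSet.ιChainComplex
  exact Sigma.ι_desc _ _

theorem homCochain_cochainHom {k : ℕ} (a : SingularCochain X ℝ k) :
    homCochain (cochainHom a) = a := by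
  ext σ
  rw [homCochain, ι_cochainHom]
  simp

/-- The boundary of a generator is the alternating sum of its faces, so precomposing with it is the
explicit coboundary. -/
theorem homCochain_d {k : ℕ}
    (f : ((TopCat.toSSet.obj (TopCat.of X)).chainComplex (ModuleCat.of ℝ (ULift.{u} ℝ))).X k ⟶
      ModuleCat.of ℝ (ULift.{u} ℝ)) :
    homCochain (((TopCat.toSSet.obj (TopCat.of X)).chainComplex _).d (k + 1) k ≫ f) =
      singularCoboundary X ℝ k (homCochain f) := by
  ext σ
  rw [homCochain, SSet.ιChainComplex_d_assoc, Preadditive.sum_comp]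
  have key : ∀ (t : Finset (Fin (k + 2))) (F : Fin (k + 2) → ((ModuleCat.of ℝ (ULift.{u} ℝ)) ⟶
      ModuleCat.of ℝ (ULift.{u} ℝ))), ((∑ i ∈ t, F i).hom (ULift.up 1)).down =
        ∑ i ∈ t, ((F i).hom (ULift.up 1)).down := fun t F => by
    classical
    induction t using Finset.induction_on with
    | empty => simp
    | insert i t hi ih => rw [Finset.sum_insert hi, Finset.sum_insert hi, ← ih]; rfl
  rw [key]
  refine Finset.sum_congr rfl fun i _ => ?_
  rw [Preadditive.zsmul_comp]
  rfl

theorem homCochain_map {k : ℕ} (i : C(X, Y))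
    (f : ((TopCat.toSSet.obj (TopCat.of Y)).chainComplex (ModuleCat.of ℝ (ULift.{u} ℝ))).X k ⟶
      ModuleCat.of ℝ (ULift.{u} ℝ)) (σ : SingularSimplex X k) :
    homCochain ((SSet.chainComplexMap (TopCat.toSSet.map (TopCat.ofHom i)) _).f k ≫ f) σ =
      homCochain f (i.comp σ) := by
  rw [homCochain, SSet.ι_chainComplexMap_f_assoc]
  rfl

/-- Chains are free on simplices, so a linear map is determined by its values on generators with
coefficient `1`. This lets cochain identities be transferred back to morphisms. -/
theorem hom_ext_cochain {k : ℕ}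
    {f g : ((TopCat.toSSet.obj (TopCat.of X)).chainComplex (ModuleCat.of ℝ (ULift.{u} ℝ))).X k ⟶
      ModuleCat.of ℝ (ULift.{u} ℝ)} (h : homCochain f = homCochain g) : f = g := by
  refine SSet.chainComplex_hom_ext fun σ => ?_
  have h1 := congrFun h (TopCat.toSSetObjEquiv (TopCat.of X) (op ⦋k⦌) σ)
  rw [homCochain, homCochain] at h1
  simp only [Equiv.symm_apply_apply] at h1
  ext r
  obtain ⟨r⟩ := r
  have hr : (ULift.up r : ULift.{u} ℝ) = r • ULift.up 1 := by ext; simp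
  have h2 := congrArg (fun x : ULift.{u} ℝ => r • x) (ULift.down_injective h1)
  simp only [← map_smul] at h2
  rw [hr]
  exact congrArg ULift.down h2

/-- Extension of real 1-cocycles along a map that is injective on `H_1`. -/
theorem exists_singularCocycle_extension (i : C(X, Y))
    (hinj : Function.Injective (singularH1Map i)) (a : SingularCochain X ℝ 1)
    (ha : singularCoboundary X ℝ 1 a = 0) :
    ∃ (a' : SingularCochain Y ℝ 1) (w : X → ℝ), singularCoboundary Y ℝ 1 a' = 0 ∧
      ∀ s : SingularSimplex X 1, a' (i.comp s) = a s + (w s.target - w s.source) := by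
  -- This homology map is `singularH1Map i` up to unfolding.
  have : Mono (homologyMap (SSet.chainComplexMap (TopCat.toSSet.map (TopCat.ofHom i))
      (ModuleCat.of ℝ (ULift.{u} ℝ))) 1) := (ModuleCat.mono_iff_injective _).2 hinj
  obtain ⟨a', w, h1, h2⟩ := exists_cocycle_extension
    (SSet.chainComplexMap (TopCat.toSSet.map (TopCat.ofHom i)) (ModuleCat.of ℝ (ULift.{u} ℝ)))
    (cochainHom a) (by
      apply hom_ext_cochain
      rw [homCochain_d, homCochain_cochainHom, ha]
      rfl)
  refine ⟨homCochain a', fun x => homCochain w (pointSimplex x), ?_, fun s => ?_⟩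
  · rw [← homCochain_d, h1]; rfl
  · have h3 := congrFun (congrArg homCochain h2) s
    rw [homCochain_map] at h3
    rw [h3]
    have h4 : ∀ f g : ((TopCat.toSSet.obj (TopCat.of X)).chainComplex
        (ModuleCat.of ℝ (ULift.{u} ℝ))).X 1 ⟶ ModuleCat.of ℝ (ULift.{u} ℝ),
        homCochain (f + g) s = homCochain f s + homCochain g s := fun f g => by
      rw [homCochain, Preadditive.comp_add]; rfl
    rw [h4, homCochain_cochainHom, homCochain_d]
    simp [singularCoboundary, Fin.sum_univ_two, SingularSimplex.face_zero_one,
      SingularSimplex.face_one_one, sub_eq_add_neg]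

end SingularExtension

/-! ### Primitives of locally additive two-point functions on convex sets. -/

section LocalCocycle

variable {V : Type*} [NormedAddCommGroup V] [NormedSpace ℝ V] {K : Set V}
  {A : Type*} [AddCommGroup A]

/-- The point of the segment from `p` to `x` with parameter `t`, truncated to `[0, 1]`. -/
def Convex.pointOn (hK : Convex ℝ K) (p x : K) (t : ℝ) : K :=
  ⟨AffineMap.lineMap (p : V) (x : V) (max 0 (min 1 t)), hK.lineMap_mem p.2 x.2 (by simp)⟩

theorem Convex.pointOn_zero (hK : Convex ℝ K) (p x : K) : hK.pointOn p x 0 = p := by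
  ext; simp [Convex.pointOn]

theorem Convex.pointOn_one (hK : Convex ℝ K) (p x : K) : hK.pointOn p x 1 = x := by
  ext; simp [Convex.pointOn]

theorem Convex.dist_pointOn_left (hK : Convex ℝ K) (p x y : K) (t : ℝ) :
    dist (hK.pointOn p x t) (hK.pointOn p y t) ≤ dist x y := by
  have h0 : (0 : ℝ) ≤ max 0 (min 1 t) := le_max_left _ _
  have h1 : max 0 (min 1 t) ≤ (1 : ℝ) := by simp
  rw [Subtype.dist_eq, Subtype.dist_eq, Convex.pointOn, Convex.pointOn]
  simp only [AffineMap.lineMap_apply_module, dist_add_left, dist_smul₀, Real.norm_eq_abs,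
    abs_of_nonneg h0]
  exact mul_le_of_le_one_left dist_nonneg h1

theorem Convex.dist_pointOn_right (hK : Convex ℝ K) (p x : K) (s t : ℝ) :
    dist (hK.pointOn p x s) (hK.pointOn p x t) ≤ |s - t| * dist p x := by
  rw [Subtype.dist_eq, Convex.pointOn, Convex.pointOn, dist_lineMap_lineMap, Subtype.dist_eq]
  refine mul_le_mul_of_nonneg_right ?_ dist_nonneg
  rw [Real.dist_eq]
  grind

/-- Boundedness of `K` makes `n` uniform in the endpoints. For `k ≥ n` the two points coincide, by
the truncation in `pointOn`. -/
theorem Convex.exists_subdivision (hK : Convex ℝ K) (hb : Bornology.IsBounded K) {ε : ℝ}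
    (hε : 0 < ε) : ∃ n : ℕ, 0 < n ∧ ∀ (p x : K) (k : ℕ),
      dist (hK.pointOn p x (k / n)) (hK.pointOn p x ((k + 1 : ℕ) / n)) < ε := by
  obtain ⟨C, hC⟩ := Metric.isBounded_iff.1 hb
  obtain ⟨n, hn⟩ := exists_nat_gt (C / ε)
  refine ⟨n + 1, n.succ_pos, fun p x k => (hK.dist_pointOn_right _ _ _ _).trans_lt ?_⟩
  have hn1 : (0 : ℝ) < (n + 1 : ℕ) := by positivity
  have h1 : |(k : ℝ) / (n + 1 : ℕ) - (k + 1 : ℕ) / (n + 1 : ℕ)| = 1 / (n + 1 : ℕ) := by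
    rw [← sub_div, abs_div, abs_of_pos hn1]
    simp
  have h2 : dist p x ≤ C := hC p.2 x.2
  rw [h1, one_div, inv_mul_lt_iff₀ hn1, mul_comm]
  rw [div_lt_iff₀ hε] at hn
  push_cast
  nlinarith

/-- Walk from `x` to `y` along the segment in steps shorter than `δ`. -/
theorem Convex.eq_of_locally_eq (hK : Convex ℝ K) (hb : Bornology.IsBounded K) {α : Type*}
    (D : K → α) {δ : ℝ} (hδ : 0 < δ) (h : ∀ x y : K, dist x y < δ → D x = D y) (x y : K) :
    D x = D y := by
  obtain ⟨n, hn, hn'⟩ := hK.exists_subdivision hb hδ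
  have key : ∀ k : ℕ, D x = D (hK.pointOn x y (k / n)) := fun k => by
    induction k with
    | zero => simp [hK.pointOn_zero]
    | succ k ih => exact ih.trans (h _ _ (hn' x y k))
  have := key n
  rwa [div_self (by positivity), hK.pointOn_one] at this

/-- A locally additive two-point function on a bounded convex set has a primitive. -/
theorem Convex.exists_primitive (hK : Convex ℝ K) (hb : Bornology.IsBounded K) [Nonempty K]
    (κ : K → K → A) {ε : ℝ} (hε : 0 < ε)
    (h : ∀ x y z : K, dist x y < ε → dist y z < ε → dist x z < ε → κ x y + κ y z = κ x z)
    (G : AddSubgroup A) (hG : ∀ x y : K, dist x y < ε → κ x y ∈ G) :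
    ∃ F : K → A, (∀ x, F x ∈ G) ∧ ∃ δ > 0, ∀ x y, dist x y < δ → F y - F x = κ x y := by
  -- Steps shorter than `ε / 2` keep the diagonals of the quadrilaterals below shorter than `ε`.
  obtain ⟨n, hn, hn'⟩ := hK.exists_subdivision hb (half_pos hε)
  let p : K := Classical.arbitrary K
  let c : K → ℕ → K := fun x k => hK.pointOn p x (k / n)
  have hc0 : ∀ x, c x 0 = p := fun x => by simp [c, hK.pointOn_zero]
  have hcn : ∀ x, c x n = x := fun x => by
    simp only [c]; rw [div_self (by positivity), hK.pointOn_one]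
  have hpp : κ p p = 0 := by
    have := h p p p (by simpa) (by simpa) (by simpa)
    simpa using this
  -- The primitive at `x` is the sum of `κ` over the subdivided segment from the base point `p` to
  -- `x`.
  refine ⟨fun x => ∑ k ∈ Finset.range n, κ (c x k) (c x (k + 1)),
    fun x => _root_.sum_mem fun k _ => hG _ _ ((hn' p x k).trans (half_lt_self hε)),
    ε / 2, half_pos hε, fun x y hxy => ?_⟩
  have hd : ∀ k, dist (c x k) (c y k) < ε / 2 := fun k =>
    (hK.dist_pointOn_left _ _ _ _).trans_lt hxy
  -- The quadrilateral between two neighbouring segments is cut by a diagonal and additivity is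
  -- applied to both triangles. The sum over `k` then telescopes, and its initial term is `κ p p =
  -- 0`.
  have hstep : ∀ k, κ (c y k) (c y (k + 1)) - κ (c x k) (c x (k + 1)) =
      κ (c x (k + 1)) (c y (k + 1)) - κ (c x k) (c y k) := fun k => by
    have hx := hn' p x k
    have hy := hn' p y k
    have hdiag : dist (c x k) (c y (k + 1)) < ε :=
      (dist_triangle _ (c y k) _).trans_lt (by linarith [hd k])
    have h1 := h (c x k) (c x (k + 1)) (c y (k + 1)) (hx.trans (half_lt_self hε))
      ((hd _).trans (half_lt_self hε)) hdiag
    have h2 := h (c x k) (c y k) (c y (k + 1)) ((hd _).trans (half_lt_self hε))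
      (hy.trans (half_lt_self hε)) hdiag
    rw [sub_eq_sub_iff_add_eq_add]
    exact (add_comm _ _).trans ((h1.trans h2.symm).symm.trans (add_comm _ _))
  rw [← Finset.sum_sub_distrib, Finset.sum_congr rfl fun k _ => hstep k,
    Finset.sum_range_sub (fun k => κ (c x k) (c y k)), hc0, hc0, hpp, hcn, hcn, sub_zero]

end LocalCocycle

/-! ### Singular 1-cocycles from local data. -/

section PathCocycle

variable {X : Type u} [TopologicalSpace X] {A : Type v} [AddCommGroup A]

/-- `F` is a primitive of the locally additive two-point function `κ` along `σ`. -/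
def IsPrimitiveAlong (κ : X → X → A) {k : ℕ} (σ : SingularSimplex X k)
    (F : stdSimplex ℝ (Fin (k + 1)) → A) : Prop :=
  ∃ δ > 0, ∀ x y, dist x y < δ → F y - F x = κ (σ x) (σ y)

/-- The difference of two primitives is constant at a uniform scale, hence constant. Increments thus
do not depend on the chosen primitive. -/
theorem IsPrimitiveAlong.sub_eq {κ : X → X → A} {k : ℕ} {σ : SingularSimplex X k}
    {F F' : stdSimplex ℝ (Fin (k + 1)) → A} (hF : IsPrimitiveAlong κ σ F)
    (hF' : IsPrimitiveAlong κ σ F') (x y) : F y - F x = F' y - F' x := by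
  obtain ⟨δ, hδ, h⟩ := hF
  obtain ⟨δ', hδ', h'⟩ := hF'
  have := (convex_stdSimplex ℝ (Fin (k + 1))).eq_of_locally_eq (bounded_stdSimplex _)
    (fun z => F z - F' z) (lt_min hδ hδ') (fun x y hxy => by
      have h1 := h x y (hxy.trans_le (min_le_left _ _))
      rw [← h' x y (hxy.trans_le (min_le_right _ _))] at h1
      exact (sub_eq_sub_iff_sub_eq_sub.1 h1).symm) x y
  exact (sub_eq_sub_iff_sub_eq_sub.1 this.symm)

/-- The face inclusion is uniformly continuous, so the scale `δ` can be pulled back. -/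
theorem IsPrimitiveAlong.face {κ : X → X → A} {k : ℕ} {σ : SingularSimplex X (k + 1)}
    {F : stdSimplex ℝ (Fin (k + 2)) → A} (hF : IsPrimitiveAlong κ σ F) (i : Fin (k + 2)) :
    IsPrimitiveAlong κ (σ.face i) (fun x => F (stdSimplex.map i.succAbove x)) := by
  obtain ⟨δ, hδ, h⟩ := hF
  obtain ⟨δ', hδ', h'⟩ := Metric.uniformContinuous_iff.1
    (CompactSpace.uniformContinuous_of_continuous
      (stdSimplex.continuous_map (S := ℝ) i.succAbove)) δ hδ
  exact ⟨δ', hδ', fun x y hxy => h _ _ (h' hxy)⟩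

/-- A locally additive two-point function `κ` on a space defines a singular 1-cocycle. -/
theorem exists_singularCocycle_of_local (κ : X → X → A) {ι : Type*} (W : ι → Set X)
    (hW : ∀ k, IsOpen (W k)) (hcov : ∀ x, ∃ k, x ∈ W k)
    (hκ : ∀ k, ∀ x ∈ W k, ∀ y ∈ W k, ∀ z ∈ W k, κ x y + κ y z = κ x z)
    (G : AddSubgroup A) (hG : ∀ k, ∀ x ∈ W k, ∀ y ∈ W k, κ x y ∈ G) :
    ∃ h : SingularCochain X A 1, singularCoboundary X A 1 h = 0 ∧ (∀ s, h s ∈ G) ∧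
      ∀ (k : ι) (s : SingularSimplex X 1), (∀ t, s t ∈ W k) → h s = κ s.source s.target := by
  have hprim : ∀ (m : ℕ) (σ : SingularSimplex X m), ∃ F, (∀ x, F x ∈ G) ∧
      IsPrimitiveAlong κ σ F := fun m σ => by
    -- Below the Lebesgue number of the pulled back cover, triples of points land in one `W k`,
    -- where `κ` is additive.
    obtain ⟨ε, hε, hleb⟩ := lebesgue_number_lemma_of_metric (isCompact_univ)
      (fun k => (hW k).preimage σ.continuous)
      (fun x _ => by simpa using hcov (σ x))
    have hsm : ∀ x y z : stdSimplex ℝ (Fin (m + 1)), dist x y < ε → dist x z < ε →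
        ∃ k, σ x ∈ W k ∧ σ y ∈ W k ∧ σ z ∈ W k := fun x y z hxy hxz => by
      obtain ⟨k, hk⟩ := hleb x (mem_univ _)
      exact ⟨k, hk (Metric.mem_ball_self hε), hk (by rwa [Metric.mem_ball, dist_comm]),
        hk (by rwa [Metric.mem_ball, dist_comm])⟩
    exact (convex_stdSimplex ℝ (Fin (m + 1))).exists_primitive (bounded_stdSimplex _)
      (fun x y => κ (σ x) (σ y)) hε
      (fun x y z hxy _ hxz => by
        obtain ⟨k, hx, hy, hz⟩ := hsm x y z hxy hxz
        exact hκ k _ hx _ hy _ hz) G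
      (fun x y hxy => by
        obtain ⟨k, hx, hy, -⟩ := hsm x y y hxy hxy
        exact hG k _ hx _ hy)
  choose F hFG hF using hprim
  -- The cochain takes a path to the increment of a primitive between its ends. On the faces of a
  -- 2-simplex, the restrictions of a primitive on the whole simplex may be used, so the three
  -- increments cancel.
  refine ⟨fun s => F 1 s (stdSimplex.vertex 1) - F 1 s (stdSimplex.vertex 0), ?_,
    fun s => sub_mem (hFG _ _ _) (hFG _ _ _), fun k s hs => ?_⟩
  · ext σ
    have hface : ∀ i : Fin 3, F 1 (σ.face i) (stdSimplex.vertex 1) -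
        F 1 (σ.face i) (stdSimplex.vertex 0) =
        F 2 σ (stdSimplex.vertex (i.succAbove 1)) - F 2 σ (stdSimplex.vertex (i.succAbove 0)) :=
      fun i => by
        rw [(hF 1 (σ.face i)).sub_eq ((hF 2 σ).face i)]
        simp [stdSimplex.map_vertex]
    change ∑ i : Fin 3, (-1 : ℤ) ^ (i : ℕ) • (F 1 (σ.face i) (stdSimplex.vertex 1) -
        F 1 (σ.face i) (stdSimplex.vertex 0)) = 0
    have e0 : (0 : Fin 3).succAbove (0 : Fin 2) = 1 := rfl
    have e1 : (0 : Fin 3).succAbove (1 : Fin 2) = 2 := rfl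
    have e2 : (1 : Fin 3).succAbove (0 : Fin 2) = 0 := rfl
    have e3 : (1 : Fin 3).succAbove (1 : Fin 2) = 2 := rfl
    have e4 : (2 : Fin 3).succAbove (0 : Fin 2) = 0 := rfl
    have e5 : (2 : Fin 3).succAbove (1 : Fin 2) = 1 := rfl
    simp only [Fin.sum_univ_three, hface, e0, e1, e2, e3, e4, e5]
    simp
  · have hx0 : ∀ x ∈ W k, κ x x = 0 := fun x hx => by simpa using hκ k x hx x hx x hx
    -- Inside a single `W k` additivity is global and any `δ` works.
    have hp : IsPrimitiveAlong κ s (fun t => κ s.source (s t)) :=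
      ⟨1, one_pos, fun x y _ => by
        change κ s.source (s y) - κ s.source (s x) = _
        rw [← hκ k s.source (hs _) (s x) (hs x) (s y) (hs y), add_sub_cancel_left]⟩
    refine ((hF 1 s).sub_eq hp _ _).trans ?_
    change κ s.source s.target - κ s.source s.source = _
    rw [hx0 s.source (hs _), sub_zero]

/-- On a compact Hausdorff space, flat data with values in `A`, given by local functions that
differ by locally constant ones, are described by a singular 1-cocycle with values in a finitely
generated group. -/
theorem exists_fg_cocycle_of_flat [CompactSpace X] [T2Space X] (V : X → Set X)
    (hV : ∀ p, IsOpen (V p)) (hpV : ∀ p, p ∈ V p) (Φ : X → X → A)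
    (hΦ : ∀ p q, p ∈ V q → ∀ᶠ y in 𝓝 p, Φ p y - Φ q y = Φ p p - Φ q p) :
    ∃ h : SingularCochain X A 1, singularCoboundary X A 1 h = 0 ∧
      (∃ G : AddSubgroup A, G.FG ∧ ∀ s, h s ∈ G) ∧
      ∃ w : X → A, ∀ p, ∃ W : Set X, IsOpen W ∧ p ∈ W ∧
        ∀ s : SingularSimplex X 1, (∀ t, s t ∈ W) →
          h s = (Φ p s.target - Φ p s.source) + (w s.target - w s.source) := by
  classical
  -- The cover is shrunk so that only finitely many indices `r x` occur and membership in a closure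
  -- still implies membership in `V`.
  have hsh : ∀ p, ∃ U : Set X, IsOpen U ∧ p ∈ U ∧ closure U ⊆ V p := fun p => by
    obtain ⟨U, hU, hcl⟩ := (closed_nhds_basis p).mem_iff.1 ((hV p).mem_nhds (hpV p))
    exact ⟨interior U, isOpen_interior, mem_interior_iff_mem_nhds.2 hU.1,
      (closure_minimal interior_subset hU.2).trans hcl⟩
  choose U hUo hpU hUV using hsh
  obtain ⟨t, ht⟩ := isCompact_univ.elim_finite_subcover U hUo
    (fun x _ => mem_iUnion.2 ⟨x, hpU x⟩)
  have hr : ∀ x, ∃ a ∈ t, x ∈ U a := fun x => by simpa using ht (mem_univ x)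
  choose r hrt hrU using hr
  -- For each of the finitely many `a ∈ t`: either `p` is in the closure of `U a`, hence in `V a`,
  -- and `Φ p - Φ a` is constant near `p`; or `W` avoids `U a`, and then `a ≠ r x` for all `x ∈ W`.
  have hW : ∀ p, ∃ W : Set X, IsOpen W ∧ p ∈ W ∧ ∀ x ∈ W, ∀ y ∈ W,
      Φ p y - Φ (r x) y = Φ p p - Φ (r x) p := fun p => by
    have hev : ∀ a ∈ t, ∀ᶠ y in 𝓝 p, (p ∈ closure (U a) →
        Φ p y - Φ a y = Φ p p - Φ a p) ∧ (p ∉ closure (U a) → y ∉ U a) := fun a _ => by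
      by_cases hpa : p ∈ closure (U a)
      · filter_upwards [hΦ p a (hUV a hpa)] with y hy
        exact ⟨fun _ => hy, fun h => absurd hpa h⟩
      · filter_upwards [isClosed_closure.isOpen_compl.mem_nhds hpa] with y hy
        exact ⟨fun h => absurd h hpa, fun _ h => hy (subset_closure h)⟩
    obtain ⟨W, hW, hWo, hpW⟩ := eventually_nhds_iff.1 ((Finset.eventually_all t).2 hev)
    refine ⟨W, hWo, hpW, fun x hx y hy => (hW y hy (r x) (hrt x)).1 ?_⟩
    by_contra hcon
    exact (hW x hx (r x) (hrt x)).2 hcon (hrU x)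
  choose W hWo hpW hWΦ using hW
  obtain ⟨T, hT⟩ := isCompact_univ.elim_finite_subcover W hWo
    (fun x _ => mem_iUnion.2 ⟨x, hpW x⟩)
  -- On `W p` this equals `Φ (r x) p - Φ (r y) p`, which is additive. With `r x`, `r y` in `t` and
  -- `p` in `T` it takes finitely many values, and these generate the required group.
  let κ : X → X → A := fun x y => Φ (r x) y - Φ (r y) y
  have hκ : ∀ p, ∀ x ∈ W p, ∀ y ∈ W p, κ x y = Φ (r x) p - Φ (r y) p := fun p x hx y hy => by
    have h1 := hWΦ p x hx y hy
    have h2 := hWΦ p y hy y hy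
    have : κ x y = (Φ p y - Φ (r y) y) - (Φ p y - Φ (r x) y) := by simp only [κ]; abel
    rw [this, h1, h2]; abel
  let S : Finset A := (t ×ˢ t ×ˢ T).image fun q => Φ q.1 q.2.2 - Φ q.2.1 q.2.2
  obtain ⟨h, h1, h2, h3⟩ := exists_singularCocycle_of_local κ (fun p : T => W p)
    (fun p => hWo p) (fun x => by simpa using hT (mem_univ x))
    (fun p x hx y hy z hz => by
      rw [hκ p x hx y hy, hκ p y hy z hz, hκ p x hx z hz]; abel)
    (AddSubgroup.closure (S : Set A))
    (fun p x hx y hy => by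
      rw [hκ p x hx y hy]
      exact AddSubgroup.subset_closure (Finset.mem_coe.2 (Finset.mem_image.2
        ⟨(r x, r y, p), by simp [hrt], rfl⟩)))
  -- The correction `w` accounts for the passage from the function `Φ p` to the function `Φ (r x)`
  -- selected at each point.
  refine ⟨h, h1, ⟨_, ⟨S, rfl⟩, h2⟩, fun x => -Φ (r x) x, fun p => ?_⟩
  obtain ⟨q, hq, hpq⟩ : ∃ q ∈ T, p ∈ W q := by simpa using hT (mem_univ p)
  refine ⟨W q ∩ W p, (hWo q).inter (hWo p), ⟨hpq, hpW p⟩, fun s hs => ?_⟩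
  rw [h3 ⟨q, hq⟩ s fun t => (hs t).1]
  have e1 := hWΦ p s.source (hs _).2 s.source (hs _).2
  have e2 := hWΦ p s.source (hs _).2 s.target (hs _).2
  have e3 : Φ p s.target - Φ (r s.source) s.target = Φ p s.source - Φ (r s.source) s.source :=
    e2.trans e1.symm
  have e4 : Φ (r s.source) s.target = Φ p s.target - (Φ p s.source - Φ (r s.source) s.source) := by
    rw [← e3]; abel
  simp only [κ]
  rw [e4]; abel

end PathCocycle

/-! ### Lifting cocycles from `ℝ/ℤ` to `ℝ`. -/

section Lifting

variable {X : Type u} [TopologicalSpace X]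

theorem singularCoboundary_map {A : Type v} {B : Type w} [AddCommGroup A] [AddCommGroup B]
    (f : A →+ B) {k : ℕ} (c : SingularCochain X A k) (σ : SingularSimplex X (k + 1)) :
    singularCoboundary X B k (fun s => f (c s)) σ = f (singularCoboundary X A k c σ) := by
  simp [singularCoboundary]

/-- The identity `d² = 0` of the singular chain complex, read through the dictionary; it makes the
integral cochain `e` below a cocycle. -/
theorem singularCoboundary_singularCoboundary_real {k : ℕ} (c : SingularCochain X ℝ k) :
    singularCoboundary X ℝ (k + 1) (singularCoboundary X ℝ k c) = 0 := by
  conv_lhs => rw [← homCochain_cochainHom c, ← homCochain_d, ← homCochain_d,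
    HomologicalComplex.d_comp_d_assoc, Limits.zero_comp]
  rfl

/-- Some multiple of a homomorphism from a finitely generated subgroup of `ℝ/ℤ` lifts to `ℝ`. -/
theorem exists_real_lift_of_fg (G : AddSubgroup (AddCircle (1 : ℝ))) (hG : G.FG) :
    ∃ N : ℕ, 0 < N ∧ ∃ φ : G →+ ℝ,
      ∀ x : G, ((φ x : ℝ) : AddCircle (1 : ℝ)) = N • (x : AddCircle (1 : ℝ)) := by
  have : Module.Finite ℤ G := by
    rw [Module.Finite.iff_addGroup_fg]
    exact (AddGroup.fg_iff_addSubgroup_fg G).2 hG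
  let T := Submodule.torsion ℤ G
  obtain ⟨S, hS⟩ : T.FG := IsNoetherian.noetherian T
  -- The torsion subgroup is finitely generated; the product of annihilators of its generators is an
  -- exponent.
  have hN : ∃ N : ℕ, 0 < N ∧ ∀ x ∈ T, N • x = 0 := by
    have hex : ∀ x : G, ∃ n : ℕ, 0 < n ∧ (x ∈ T → n • x = 0) := fun x => by
      by_cases hx : x ∈ T
      · obtain ⟨n, hn⟩ := (Submodule.mem_torsion_iff x).1 hx
        have hn' : (n : ℤ) • x = 0 := hn
        refine ⟨(n : ℤ).natAbs, Int.natAbs_pos.2 (nonZeroDivisors.coe_ne_zero n), fun _ => ?_⟩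
        rw [← natCast_zsmul, Int.natCast_natAbs]
        rcases abs_choice (n : ℤ) with h | h <;> rw [h]
        · exact hn'
        · rw [neg_smul, hn', neg_zero]
      · exact ⟨1, one_pos, fun h => absurd h hx⟩
    choose n hn0 hn using hex
    refine ⟨∏ x ∈ S, n x, Finset.prod_pos fun x _ => hn0 x, fun x hx => ?_⟩
    rw [← hS] at hx
    induction hx using Submodule.span_induction with
    | mem x hx =>
      obtain ⟨c, hc⟩ := Finset.dvd_prod_of_mem n hx
      have hxT : x ∈ T := hS ▸ Submodule.subset_span hx
      rw [hc, mul_comm, mul_smul, hn x hxT, smul_zero]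
    | zero => simp
    | add x y _ _ hx hy => rw [smul_add, hx, hy, add_zero]
    | smul c x _ hx => rw [smul_comm, hx, smul_zero]
  obtain ⟨N, hN0, hN⟩ := hN
  -- Multiplication by `N` kills the torsion, so its image is torsion-free and finitely generated,
  -- hence free. The inclusion of this image into `ℝ/ℤ` therefore lifts to `ℝ`.
  let f : G →ₗ[ℤ] G := (N : ℤ) • LinearMap.id
  have htf : Module.IsTorsionFree ℤ (LinearMap.range f) := by
    rw [Module.isTorsionFree_iff_smul_eq_zero]
    rintro r ⟨_, x, rfl⟩ hr0
    have hr0' : r • (N : ℤ) • x = 0 := congrArg Subtype.val hr0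
    by_cases hr : r = 0
    · exact Or.inl hr
    · refine Or.inr (Subtype.ext ?_)
      have hxT : x ∈ T := (Submodule.mem_torsion_iff x).2
        ⟨⟨r * N, mem_nonZeroDivisors_of_ne_zero (mul_ne_zero hr (by exact_mod_cast hN0.ne'))⟩,
          by rw [← hr0', ← mul_smul]; rfl⟩
      change (N : ℤ) • x = 0
      rw [natCast_zsmul]
      exact hN x hxT
  have hfree : Module.Free ℤ (LinearMap.range f) := inferInstance
  let q : ℝ →ₗ[ℤ] AddCircle (1 : ℝ) :=
    (QuotientAddGroup.mk' (AddSubgroup.zmultiples (1 : ℝ))).toIntLinearMap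
  let j : LinearMap.range f →ₗ[ℤ] AddCircle (1 : ℝ) :=
    G.subtype.toIntLinearMap ∘ₗ (LinearMap.range f).subtype
  obtain ⟨φ, hφ⟩ := Module.projective_lifting_property q j
    (QuotientAddGroup.mk'_surjective _)
  refine ⟨N, hN0, (φ ∘ₗ f.rangeRestrict).toAddMonoidHom, fun x => ?_⟩
  have := LinearMap.congr_fun hφ (f.rangeRestrict x)
  refine this.trans ?_
  simp [j, f]

/-- A singular 1-cocycle with values in a finitely generated subgroup of `ℝ/ℤ` has a multiple that
lifts to a real cocycle; if `H²(X; ℤ)` is free, the cocycle itself lifts. -/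
theorem exists_real_cocycle_lift (h : SingularCochain X (AddCircle (1 : ℝ)) 1)
    (hh : singularCoboundary X _ 1 h = 0) (G : AddSubgroup (AddCircle (1 : ℝ))) (hG : G.FG)
    (hhG : ∀ s, h s ∈ G) :
    (∃ N : ℕ, 0 < N ∧ ∃ a : SingularCochain X ℝ 1, singularCoboundary X ℝ 1 a = 0 ∧
      ∀ s, ((a s : ℝ) : AddCircle (1 : ℝ)) = N • h s) ∧
    (Module.Free ℤ (SingularH2 X ℤ) → ∃ a : SingularCochain X ℝ 1,
      singularCoboundary X ℝ 1 a = 0 ∧ ∀ s, ((a s : ℝ) : AddCircle (1 : ℝ)) = h s) := by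
  obtain ⟨N, hN, φ, hφ⟩ := exists_real_lift_of_fg G hG
  let h' : SingularCochain X G 1 := fun s => ⟨h s, hhG s⟩
  let a : SingularCochain X ℝ 1 := fun s => φ (h' s)
  have ha : singularCoboundary X ℝ 1 a = 0 := by
    have h1 : singularCoboundary X G 1 h' = 0 := by
      ext σ
      rw [← AddSubgroup.coe_subtype, ← singularCoboundary_map]
      exact congrFun hh σ
    ext σ
    rw [singularCoboundary_map φ h', h1]
    simp
  have haN : ∀ s, ((a s : ℝ) : AddCircle (1 : ℝ)) = N • h s := fun s => hφ (h' s)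
  refine ⟨⟨N, hN, a, ha, haN⟩, fun hfree => ?_⟩
  let q : ℝ →+ AddCircle (1 : ℝ) := QuotientAddGroup.mk' (AddSubgroup.zmultiples (1 : ℝ))
  have hq0 : ∀ x : ℝ, q x = 0 → ∃ n : ℤ, (n : ℝ) = x := fun x hx => by
    obtain ⟨n, hn⟩ := (AddCircle.coe_eq_zero_iff (1 : ℝ)).1 hx
    exact ⟨n, by simpa using hn⟩
  -- An arbitrary real lift `H` of `h`: its coboundary is an integral cochain `e`, the Bockstein of
  -- `h`.
  choose H hH using fun s => QuotientAddGroup.mk'_surjective (AddSubgroup.zmultiples (1 : ℝ)) (h s)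
  have hHq : ∀ s, q (H s) = h s := hH
  choose e he using fun σ => hq0 (singularCoboundary X ℝ 1 H σ) (by
    rw [← singularCoboundary_map]
    simp only [hHq]
    exact congrFun hh σ)
  -- `N • H` and `a` both reduce to `N • h`, so they differ by an integral cochain `m`. As `δa = 0`,
  -- this gives `N • e = δm`.
  choose m hm using fun s => hq0 (N • H s - a s) (by
    rw [map_sub, map_nsmul, hHq]; exact sub_eq_zero.2 (haN s).symm)
  let c : ℤ →+ ℝ := Int.castAddHom ℝ
  have heZ : singularCoboundary X ℤ 2 e = 0 := by
    ext σ
    have h1 := singularCoboundary_map c e σ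
    have h2 : (fun σ => c (e σ)) = singularCoboundary X ℝ 1 H := funext he
    rw [h2, singularCoboundary_singularCoboundary_real] at h1
    exact Int.cast_injective (α := ℝ) (h1.symm.trans (by simp))
  have heN : N • e = singularCoboundary X ℤ 1 m := by
    ext σ
    have h1 := singularCoboundary_map c m σ
    have h2 : (fun s => c (m s)) = N • H - a := funext hm
    rw [h2, map_sub, ha, sub_zero, map_nsmul] at h1
    refine Int.cast_injective (α := ℝ) (Eq.trans ?_ h1)
    simp [← he σ]
  let z : (singularCoboundary X ℤ 2).ker := ⟨e, heZ⟩
  have hz : N • (QuotientAddGroup.mk z : SingularH2 X ℤ) = 0 := by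
    rw [← QuotientAddGroup.mk_nsmul, QuotientAddGroup.eq_zero_iff, AddSubgroup.mem_addSubgroupOf]
    exact ⟨m, heN.symm⟩
  have hz0 : (QuotientAddGroup.mk z : SingularH2 X ℤ) = 0 := by
    have : Module.IsTorsionFree ℤ (SingularH2 X ℤ) := inferInstance
    have h1 : (N : ℤ) • (QuotientAddGroup.mk z : SingularH2 X ℤ) = 0 := by
      rw [natCast_zsmul]; exact hz
    exact (smul_eq_zero.1 h1).resolve_left (by exact_mod_cast hN.ne')
  rw [QuotientAddGroup.eq_zero_iff, AddSubgroup.mem_addSubgroupOf] at hz0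
  obtain ⟨m', hm'⟩ := hz0
  have hm'e : singularCoboundary X ℤ 1 m' = e := hm'
  -- The class of `e` is zero, so `e = δm'`. Subtracting `m'` makes `H` a cocycle without changing
  -- its reduction.
  refine ⟨fun s => H s - m' s, ?_, fun s => ?_⟩
  · have h2 : (fun s => H s - (m' s : ℝ)) = H - fun s => c (m' s) := rfl
    rw [h2, map_sub, sub_eq_zero]
    ext σ
    rw [singularCoboundary_map c m', hm'e]
    exact (he σ).symm
  · have h1 : q (H s - m' s) = h s := by
      rw [map_sub, hHq, sub_eq_self]
      exact (AddCircle.coe_eq_zero_iff (1 : ℝ)).2 ⟨m' s, by simp⟩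
    exact h1

end Lifting

/-! ### Pullback, smoothness and exterior derivative in charts. -/

section FormCalculus

variable {E : Type*} [NormedAddCommGroup E] [NormedSpace ℝ E]
  {H : Type*} [TopologicalSpace H] {I : ModelWithCorners ℝ E H}
  {M : Type*} [TopologicalSpace M] [ChartedSpace H M]
  {E' : Type*} [NormedAddCommGroup E'] [NormedSpace ℝ E']
  {H' : Type*} [TopologicalSpace H'] {I' : ModelWithCorners ℝ E' H'}
  {M' : Type*} [TopologicalSpace M'] [ChartedSpace H' M']
  {E'' : Type*} [NormedAddCommGroup E''] [NormedSpace ℝ E'']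
  {H'' : Type*} [TopologicalSpace H''] {I'' : ModelWithCorners ℝ E'' H''}
  {M'' : Type*} [TopologicalSpace M''] [ChartedSpace H'' M''] {k : ℕ}

namespace DiffForm

theorem pullback_apply (f : M → M') (η : DiffForm I' M' k) (x : M) (v : Fin k → TangentSpace I x) :
    pullback (I := I) f η x v = η (f x) fun i => mfderiv I I' f x (v i) := rfl

theorem pullback_comp {g : M' → M''} {f : M → M'} {x : M} (η : DiffForm I'' M'' k)
    (hg : MDifferentiableAt I' I'' g (f x)) (hf : MDifferentiableAt I I' f x) :
    pullback (I := I) (g ∘ f) η x = pullback (I := I) f (pullback (I := I') g η) x := by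
  ext v
  simp only [pullback_apply, mfderiv_comp x hg hf]
  rfl

theorem pullback_congr {f g : M → M'} {x : M} (η : DiffForm I' M' k) (h : f =ᶠ[𝓝 x] g) :
    pullback (I := I) f η x = pullback (I := I) g η x := by
  ext v
  simp only [pullback_apply, h.mfderiv_eq]
  rw [h.eq_of_nhds]

theorem pullback_congr_form {f : M → M'} {x : M} {η η' : DiffForm I' M' k}
    (h : η (f x) = η' (f x)) : pullback (I := I) f η x = pullback (I := I) f η' x := by
  simp only [pullback, h]

theorem pullback_add (f : M → M') (η η' : DiffForm I' M' k) (x : M) :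
    pullback (I := I) f (η + η') x = pullback (I := I) f η x + pullback (I := I) f η' x := rfl

theorem pullback_sub (f : M → M') (η η' : DiffForm I' M' k) (x : M) :
    pullback (I := I) f (η - η') x = pullback (I := I) f η x - pullback (I := I) f η' x := by
  ext v
  simp only [pullback_apply, Pi.sub_apply, ContinuousAlternatingMap.sub_apply]

theorem pullback_smul (f : M → M') (c : ℝ) (η : DiffForm I' M' k) (x : M) :
    pullback (I := I) f (c • η) x = c • pullback (I := I) f η x := by
  ext v
  simp only [pullback_apply, Pi.smul_apply, ContinuousAlternatingMap.smul_apply]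

section Charts

variable [IsManifold I ∞ M] [I.Boundaryless] [IsManifold I' ∞ M'] [I'.Boundaryless]

/-- Functoriality of the pullback, after inserting the chart at `x₁` and its inverse. The equality
is one of germs, because chart and inverse cancel only on the chart domain. -/
theorem inChart_pullback {f : M → M'} {x : M} (η : DiffForm I' M' k)
    (hf : ContMDiffAt I I' ∞ f x) {x₀ : M} {x₁ : M'} (hx : x ∈ (extChartAt I x₀).source)
    (hx₁ : f x ∈ (extChartAt I' x₁).source) :
    (pullback (I := I) f η).inChart x₀ =ᶠ[𝓝 (extChartAt I x₀ x)]
      pullback (I := 𝓘(ℝ, E)) (I' := 𝓘(ℝ, E')) (extChartAt I' x₁ ∘ f ∘ (extChartAt I x₀).symm)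
        (η.inChart x₁) := by
  have hsymm : ContMDiffAt 𝓘(ℝ, E) I ∞ (extChartAt I x₀).symm (extChartAt I x₀ x) :=
    (contMDiffOn_extChartAt_symm x₀).contMDiffAt
      ((isOpen_extChartAt_target x₀).mem_nhds ((extChartAt I x₀).map_source hx))
  have hinv : (extChartAt I x₀).symm (extChartAt I x₀ x) = x := (extChartAt I x₀).left_inv hx
  have h1 : ∀ᶠ a in 𝓝 (extChartAt I x₀ x), ContMDiffAt I I' 1 f ((extChartAt I x₀).symm a) := by
    refine hsymm.continuousAt.tendsto.eventually ?_
    rw [hinv]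
    exact contMDiffAt_iff_contMDiffAt_nhds (by simp) |>.1 (hf.of_le (by exact_mod_cast le_top))
  have h2 : ∀ᶠ a in 𝓝 (extChartAt I x₀ x), ContMDiffAt 𝓘(ℝ, E) I 1 (extChartAt I x₀).symm a :=
    contMDiffAt_iff_contMDiffAt_nhds (by simp) |>.1 (hsymm.of_le (by exact_mod_cast le_top))
  have h3 : ∀ᶠ a in 𝓝 (extChartAt I x₀ x),
      f ((extChartAt I x₀).symm a) ∈ (extChartAt I' x₁).source := by
    have hc : ContinuousAt (f ∘ (extChartAt I x₀).symm) (extChartAt I x₀ x) :=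
      ContinuousAt.comp (by rw [hinv]; exact hf.continuousAt) hsymm.continuousAt
    exact hc.preimage_mem_nhds ((isOpen_extChartAt_source x₁).mem_nhds
      (by rw [Function.comp, hinv]; exact hx₁))
  filter_upwards [h1, h2, h3.eventually_nhds] with a ha1 ha2 ha3
  have hd1 := ha1.mdifferentiableAt one_ne_zero
  have hd2 := ha2.mdifferentiableAt one_ne_zero
  have hd3 : MDifferentiableAt I' 𝓘(ℝ, E') (extChartAt I' x₁) (f ((extChartAt I x₀).symm a)) :=
    mdifferentiableAt_extChartAt (by simpa using ha3.self_of_nhds)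
  have hd4 : MDifferentiableAt 𝓘(ℝ, E') I' (extChartAt I' x₁).symm
      (extChartAt I' x₁ (f ((extChartAt I x₀).symm a))) :=
    ((contMDiffOn_extChartAt_symm (n := ∞) x₁).contMDiffAt
      ((isOpen_extChartAt_target x₁).mem_nhds
        ((extChartAt I' x₁).map_source ha3.self_of_nhds))).mdifferentiableAt (by simp)
  have hd5 : MDifferentiableAt 𝓘(ℝ, E) I' (f ∘ (extChartAt I x₀).symm) a := hd1.comp a hd2
  refine (pullback_comp η hd1 hd2).symm.trans (Eq.trans ?_ (pullback_comp η hd4 (hd3.comp a hd5)))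
  refine pullback_congr η ?_
  filter_upwards [ha3] with b hb
  exact ((extChartAt I' x₁).left_inv hb).symm

theorem contMDiffAt_inChart_transition {f : M → M'} {x : M} (hf : ContMDiffAt I I' ∞ f x)
    {x₀ : M} {x₁ : M'} (hx : x ∈ (extChartAt I x₀).source)
    (hx₁ : f x ∈ (extChartAt I' x₁).source) :
    ContDiffAt ℝ ∞ (extChartAt I' x₁ ∘ f ∘ (extChartAt I x₀).symm) (extChartAt I x₀ x) := by
  rw [← contMDiffAt_iff_contDiffAt]
  have hinv : (extChartAt I x₀).symm (extChartAt I x₀ x) = x := (extChartAt I x₀).left_inv hx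
  have hsymm : ContMDiffAt 𝓘(ℝ, E) I ∞ (extChartAt I x₀).symm (extChartAt I x₀ x) :=
    (contMDiffOn_extChartAt_symm x₀).contMDiffAt
      ((isOpen_extChartAt_target x₀).mem_nhds ((extChartAt I x₀).map_source hx))
  refine ContMDiffAt.comp (I' := I') _ ?_ (ContMDiffAt.comp (I' := I) _ ?_ hsymm)
  · simp only [Function.comp, hinv]
    exact contMDiffAt_extChartAt' (by simpa using hx₁)
  · rw [hinv]; exact hf

/-- Under the isometry between alternating 1-forms and linear functionals the pullback is
composition with `fderiv`, which is smooth in the base point. -/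
theorem contDiffAt_pullback_one {f : E → E'} {a : E} {η : DiffForm 𝓘(ℝ, E') E' 1}
    (hη : ContDiffAt ℝ ∞ (F := E' [⋀^Fin 1]→L[ℝ] ℝ) η (f a)) (hf : ContDiffAt ℝ ∞ f a) :
    ContDiffAt ℝ ∞ (F := E [⋀^Fin 1]→L[ℝ] ℝ) (pullback (I := 𝓘(ℝ, E)) f η) a := by
  let e := ContinuousAlternatingMap.ofSubsingletonLIE (𝕜 := ℝ) (E := E) (F := ℝ) (0 : Fin 1)
  let e' := ContinuousAlternatingMap.ofSubsingletonLIE (𝕜 := ℝ) (E := E') (F := ℝ) (0 : Fin 1)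
  have h : (fun x => pullback (I := 𝓘(ℝ, E)) f η x : E → E [⋀^Fin 1]→L[ℝ] ℝ) =
      fun x => e ((e'.symm (η (f x))).comp (fderiv ℝ f x)) := by
    ext x v
    rw [pullback_apply]
    simp only [mfderiv_eq_fderiv]
    exact congrArg (η (f x)) (funext fun i => by
      rw [Subsingleton.elim i 0]; rfl)
  refine ContDiffAt.congr_of_eventuallyEq ?_ (Filter.Eventually.of_forall (congrFun h))
  refine e.contDiff.contDiffAt.comp a (ContDiffAt.clm_comp ?_ (hf.fderiv_right (by simp)))
  exact e'.symm.contDiff.contDiffAt.comp a (hη.comp a hf)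

/-- The form `η` is of class `C^∞` near `x`. -/
def SmoothAt (η : DiffForm I M k) (x : M) : Prop :=
  ContDiffAt ℝ ∞ (η.inChart x) (extChartAt I x x)

theorem inChart_eventuallyEq (η : DiffForm I M k) {x x₀ x₁ : M}
    (hx : x ∈ (extChartAt I x₀).source) (hx₁ : x ∈ (extChartAt I x₁).source) :
    η.inChart x₀ =ᶠ[𝓝 (extChartAt I x₀ x)]
      pullback (I := 𝓘(ℝ, E)) (I' := 𝓘(ℝ, E)) (extChartAt I x₁ ∘ id ∘ (extChartAt I x₀).symm)
        (η.inChart x₁) := by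
  refine Filter.EventuallyEq.trans (Filter.Eventually.of_forall fun a => ?_)
    (inChart_pullback η (f := id) contMDiffAt_id hx hx₁)
  refine (pullback_congr_form ?_).symm
  ext v
  rw [pullback_apply]
  simp only [mfderiv_id]
  rfl

theorem chart_transition_apply {x x₀ : M} {x₁ : M'} {f : M → M'}
    (hx : x ∈ (extChartAt I x₀).source) :
    (extChartAt I' x₁ ∘ f ∘ (extChartAt I x₀).symm) (extChartAt I x₀ x) =
      extChartAt I' x₁ (f x) := by
  simp only [Function.comp, (extChartAt I x₀).left_inv hx]

/-- `SmoothAt` only tests the preferred chart at the point, whereas `SmoothOn` tests all preferred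
charts; the change of charts bridges the two. -/
theorem contDiffAt_inChart {η : DiffForm I M 1} {x x₀ : M} (h : η.SmoothAt x)
    (hx : x ∈ (extChartAt I x₀).source) :
    ContDiffAt ℝ ∞ (η.inChart x₀) (extChartAt I x₀ x) := by
  have hx1 := mem_extChartAt_source (I := I) x
  refine ContDiffAt.congr_of_eventuallyEq ?_ (inChart_eventuallyEq η hx hx1)
  refine contDiffAt_pullback_one ?_
    (contMDiffAt_inChart_transition (f := id) contMDiffAt_id hx hx1)
  rw [chart_transition_apply hx]
  exact h

theorem isOpen_chart_preimage {s : Set M} (hs : IsOpen s) (x₀ : M) :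
    IsOpen ((extChartAt I x₀).target ∩ (extChartAt I x₀).symm ⁻¹' s) :=
  (continuousOn_extChartAt_symm x₀).isOpen_inter_preimage (isOpen_extChartAt_target x₀) hs

theorem SmoothOn.smoothAt {η : DiffForm I M k} {s : Set M} (h : η.SmoothOn s) (hs : IsOpen s)
    {x : M} (hx : x ∈ s) : η.SmoothAt x := by
  refine (h x).contDiffAt ((isOpen_chart_preimage hs x).mem_nhds
    ⟨mem_extChartAt_target x, ?_⟩)
  rw [mem_preimage, (extChartAt I x).left_inv (mem_extChartAt_source x)]
  exact hx

theorem smoothOn_of_smoothAt {η : DiffForm I M 1} {s : Set M} (h : ∀ x ∈ s, η.SmoothAt x) :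
    η.SmoothOn s := fun x₀ a ha => by
  have h1 := contDiffAt_inChart (h _ ha.2) ((extChartAt I x₀).map_target ha.1)
  rw [(extChartAt I x₀).right_inv ha.1] at h1
  exact h1.contDiffWithinAt

theorem SmoothAt.pullback {η : DiffForm I' M' 1} {f : M → M'} {x : M} (h : η.SmoothAt (f x))
    (hf : ContMDiffAt I I' ∞ f x) : (DiffForm.pullback (I := I) f η).SmoothAt x := by
  have hx := mem_extChartAt_source (I := I) x
  have hx' := mem_extChartAt_source (I := I') (f x)
  refine ContDiffAt.congr_of_eventuallyEq ?_ (inChart_pullback η hf hx hx')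
  refine contDiffAt_pullback_one ?_ (contMDiffAt_inChart_transition hf hx hx')
  rw [chart_transition_apply hx]
  exact h

theorem inChart_congr {η η' : DiffForm I M k} {x x₀ : M} (hx : x ∈ (extChartAt I x₀).source)
    (h : ∀ᶠ y in 𝓝 x, η y = η' y) :
    η.inChart x₀ =ᶠ[𝓝 (extChartAt I x₀ x)] η'.inChart x₀ := by
  have hc : ContinuousAt (extChartAt I x₀).symm (extChartAt I x₀ x) :=
    continuousAt_extChartAt_symm'' ((extChartAt I x₀).map_source hx)
  have h' := hc.tendsto.eventually (by rw [(extChartAt I x₀).left_inv hx]; exact h)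
  filter_upwards [h'] with a ha
  exact pullback_congr_form ha

theorem SmoothAt.congr {η η' : DiffForm I M k} {x : M} (hη : η.SmoothAt x)
    (h : ∀ᶠ y in 𝓝 x, η' y = η y) : η'.SmoothAt x :=
  ContDiffAt.congr_of_eventuallyEq hη (inChart_congr (mem_extChartAt_source x) h)

theorem d_congr {η η' : DiffForm I M k} {x : M} (h : ∀ᶠ y in 𝓝 x, η y = η' y) :
    η.d x = η'.d x := by
  simp only [d, (inChart_congr (mem_extChartAt_source x) h).extDeriv_eq]

theorem SmoothAt.add {η η' : DiffForm I M k} {x : M} (h : η.SmoothAt x) (h' : η'.SmoothAt x) :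
    (η + η').SmoothAt x := ContDiffAt.add h h'

theorem inChart_smul (c : ℝ) (η : DiffForm I M k) (x₀ : M) :
    (c • η).inChart x₀ = c • η.inChart x₀ := by
  funext a
  exact pullback_smul _ c η a

theorem inChart_sub (η η' : DiffForm I M k) (x₀ : M) :
    (η - η').inChart x₀ = η.inChart x₀ - η'.inChart x₀ := by
  funext a
  exact pullback_sub _ η η' a

theorem SmoothAt.smul {η : DiffForm I M k} {x : M} (c : ℝ) (h : η.SmoothAt x) :
    (c • η).SmoothAt x := by
  unfold SmoothAt
  rw [inChart_smul]
  exact ContDiffAt.const_smul c h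

theorem SmoothAt.sub {η η' : DiffForm I M k} {x : M} (h : η.SmoothAt x) (h' : η'.SmoothAt x) :
    (η - η').SmoothAt x := by
  unfold SmoothAt
  rw [inChart_sub]
  exact ContDiffAt.sub h h'

theorem d_add {η η' : DiffForm I M k} {x : M} (h : η.SmoothAt x) (h' : η'.SmoothAt x) :
    (η + η').d x = η.d x + η'.d x := by
  have h1 : (η + η').inChart x = η.inChart x + η'.inChart x := rfl
  simp only [d, h1]
  rw [extDeriv_add (ContDiffAt.differentiableAt h (by simp))
    (ContDiffAt.differentiableAt h' (by simp))]
  rfl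

theorem d_smul {η : DiffForm I M k} {x : M} (c : ℝ) : (c • η).d x = c • η.d x := by
  simp only [d, inChart_smul]
  rw [extDeriv_smul]
  rfl

theorem d_sub {η η' : DiffForm I M k} {x : M} (h : η.SmoothAt x) (h' : η'.SmoothAt x) :
    (η - η').d x = η.d x - η'.d x := by
  have h1 : η - η' = η + (-1 : ℝ) • η' := by
    funext y; ext v; simp [sub_eq_add_neg]
  rw [h1, d_add h (h'.smul _), d_smul]
  ext v; simp [sub_eq_add_neg]

theorem two_le_infty : (2 : WithTop ℕ∞) ≤ ∞ := by
  exact WithTop.coe_le_coe.2 (le_top : (2 : ℕ∞) ≤ ⊤)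

/-- Naturality of `extDeriv` on normed spaces, combined with the chain rule for `f` read in the
charts at `x₀` and `x₁`. -/
theorem extDeriv_inChart_pullback {η : DiffForm I' M' k} {f : M → M'} {x x₀ : M} {x₁ : M'}
    (hx : x ∈ (extChartAt I x₀).source) (hx' : f x ∈ (extChartAt I' x₁).source)
    (h : DifferentiableAt ℝ (η.inChart x₁) (extChartAt I' x₁ (f x)))
    (hf : ContMDiffAt I I' ∞ f x) (v : Fin (k + 1) → TangentSpace I x) :
    extDeriv ((DiffForm.pullback (I := I) f η).inChart x₀) (extChartAt I x₀ x)
        (fun j => mfderiv I 𝓘(ℝ, E) (extChartAt I x₀) x (v j)) =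
      extDeriv (η.inChart x₁) (extChartAt I' x₁ (f x)) (fun j =>
        mfderiv I' 𝓘(ℝ, E') (extChartAt I' x₁) (f x) (mfderiv I I' f x (v j))) := by
  have hT := contMDiffAt_inChart_transition hf hx hx'
  have hTx := chart_transition_apply (I' := I') (x₁ := x₁) (f := f) hx
  rw [(inChart_pullback η hf hx hx').extDeriv_eq]
  have h2 : extDeriv (DiffForm.pullback (I := 𝓘(ℝ, E)) (I' := 𝓘(ℝ, E'))
      (extChartAt I' x₁ ∘ f ∘ (extChartAt I x₀).symm) (η.inChart x₁)) (extChartAt I x₀ x) =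
      (extDeriv (η.inChart x₁) (extChartAt I' x₁ (f x))).compContinuousLinearMap
        (fderiv ℝ (extChartAt I' x₁ ∘ f ∘ (extChartAt I x₀).symm) (extChartAt I x₀ x)) := by
    rw [← hTx]
    rw [← extDeriv_pullback (r := ∞) (by rw [hTx]; exact h) hT
      (by simp only [minSmoothness_of_isRCLikeNormedField]; exact two_le_infty)]
    congr 1
    funext a
    simp only [DiffForm.pullback, mfderiv_eq_fderiv]
    rfl
  have h3 : (fderiv ℝ (extChartAt I' x₁ ∘ f ∘ (extChartAt I x₀).symm) (extChartAt I x₀ x)).comp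
      (mfderiv I 𝓘(ℝ, E) (extChartAt I x₀) x) =
      (mfderiv I' 𝓘(ℝ, E') (extChartAt I' x₁) (f x)).comp (mfderiv I I' f x) := by
    have hd1 : MDifferentiableAt I 𝓘(ℝ, E) (extChartAt I x₀) x :=
      mdifferentiableAt_extChartAt (by simpa using hx)
    have hd2 : MDifferentiableAt I' 𝓘(ℝ, E') (extChartAt I' x₁) (f x) :=
      mdifferentiableAt_extChartAt (by simpa using hx')
    have hd3 : MDifferentiableAt 𝓘(ℝ, E) 𝓘(ℝ, E')
        (extChartAt I' x₁ ∘ f ∘ (extChartAt I x₀).symm) (extChartAt I x₀ x) :=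
      (hT.differentiableAt (by simp)).mdifferentiableAt
    rw [← mfderiv_eq_fderiv]
    refine (mfderiv_comp x hd3 hd1).symm.trans
      (Eq.trans ?_ (mfderiv_comp x hd2 (hf.mdifferentiableAt (by simp))))
    refine Filter.EventuallyEq.mfderiv_eq ?_
    filter_upwards [(isOpen_extChartAt_source x₀).mem_nhds hx] with y hy
    simp only [Function.comp, (extChartAt I x₀).left_inv hy]
  rw [h2]
  refine congrArg (extDeriv (η.inChart x₁) (extChartAt I' x₁ (f x))) ?_
  funext j
  exact DFunLike.congr_fun h3 (v j)

/-- The exterior derivative commutes with pullbacks. -/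
theorem d_pullback {η : DiffForm I' M' k} {f : M → M'} {x : M} (h : η.SmoothAt (f x))
    (hf : ContMDiffAt I I' ∞ f x) :
    (DiffForm.pullback (I := I) f η).d x = DiffForm.pullback (I := I) f η.d x := by
  ext v
  exact extDeriv_inChart_pullback (mem_extChartAt_source x) (mem_extChartAt_source (f x))
    (ContDiffAt.differentiableAt h (by simp)) hf v

theorem pullback_id (η : DiffForm I M k) : DiffForm.pullback (I := I) id η = η := by
  funext x
  ext v
  rw [pullback_apply]
  simp only [mfderiv_id]
  rfl

end Charts

end DiffForm

end FormCalculus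

/-! ### The forms `dt` and `d arg / 2π`. -/

section OneForms

variable {E : Type*} [NormedAddCommGroup E] [NormedSpace ℝ E]
  {H : Type*} [TopologicalSpace H] {I : ModelWithCorners ℝ E H}
  {M : Type*} [TopologicalSpace M] [ChartedSpace H M]

/-- The form `dt` on the real line. -/
def lineForm : DiffForm 𝓘(ℝ, ℝ) ℝ 1 := fun _ =>
  ContinuousAlternatingMap.ofSubsingleton ℝ ℝ ℝ (0 : Fin 1) (ContinuousLinearMap.id ℝ ℝ)

/-- The form `Im (dz / z) / 2π` on the complex plane, i.e. `1 / 2π` times the differential of the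
argument. -/
def argForm : DiffForm 𝓘(ℝ, ℂ) ℂ 1 := fun z =>
  ContinuousAlternatingMap.ofSubsingleton ℝ ℂ ℝ (0 : Fin 1)
    ((2 * Real.pi)⁻¹ • (Complex.imCLM.comp (ContinuousLinearMap.mul ℝ ℂ z⁻¹)))

/-- The derivative of a vector-valued function on a manifold in the direction `v`. -/
def vderiv {F : Type*} [NormedAddCommGroup F] [NormedSpace ℝ F] (f : M → F) (x : M)
    (v : TangentSpace I x) : F := mfderiv I 𝓘(ℝ, F) f x v

namespace DiffForm

theorem one_ext {η η' : DiffForm I M 1} {x : M}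
    (h : ∀ v : TangentSpace I x, η x (fun _ => v) = η' x (fun _ => v)) : η x = η' x := by
  ext v
  have hv : v = fun _ => v 0 := funext fun i => by rw [Subsingleton.elim i 0]
  rw [hv]
  exact h (v 0)

theorem pullback_lineForm (f : M → ℝ) (x : M) (v : TangentSpace I x) :
    pullback (I := I) f lineForm x (fun _ => v) = vderiv f x v := rfl

theorem argForm_apply (z : ℂ) (v : ℂ) : argForm z (fun _ => v) = (z⁻¹ * v).im / (2 * Real.pi) := by
  rw [div_eq_inv_mul]; rfl

theorem pullback_argForm (f : M → ℂ) (x : M) (v : TangentSpace I x) :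
    pullback (I := I) f argForm x (fun _ => v) =
      ((f x)⁻¹ * vderiv f x v).im / (2 * Real.pi) := argForm_apply _ _

/-- Logarithmic derivatives add under products. This turns multiplicative transition functions into
additive changes of connection form. -/
theorem pullback_argForm_mul {f g : M → ℂ} {x : M} (hf : MDifferentiableAt I 𝓘(ℝ, ℂ) f x)
    (hg : MDifferentiableAt I 𝓘(ℝ, ℂ) g x) (hf0 : f x ≠ 0) (hg0 : g x ≠ 0) :
    pullback (I := I) (fun y => f y * g y) argForm x =
      pullback (I := I) f argForm x + pullback (I := I) g argForm x := by
  have h := (hf.hasMFDerivAt.mul' hg.hasMFDerivAt).mfderiv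
  refine one_ext (η := pullback (I := I) (fun y => f y * g y) argForm)
    (η' := pullback (I := I) f argForm + pullback (I := I) g argForm) fun v => ?_
  have h2 : vderiv (fun y => f y * g y) x v =
      f x * vderiv g x v + vderiv f x v * g x := by
    exact DFunLike.congr_fun h v
  rw [pullback_argForm, h2]
  change _ = pullback (I := I) f argForm x (fun _ => v) + pullback (I := I) g argForm x (fun _ => v)
  rw [pullback_argForm, pullback_argForm, ← add_div, ← Complex.add_im]
  congr 2
  field_simp
  ring

theorem pullback_argForm_const (c : ℂ) (x : M) :
    pullback (I := I) (fun _ : M => c) argForm x = 0 := by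
  refine one_ext (η := pullback (I := I) (fun _ : M => c) argForm) (η' := 0) fun v => ?_
  rw [pullback_argForm]
  have h : vderiv (fun _ : M => c) x v = 0 := by
    rw [vderiv, mfderiv_const]; rfl
  rw [h]
  simp

theorem pullback_argForm_pow {f : M → ℂ} {x : M} (hf : MDifferentiableAt I 𝓘(ℝ, ℂ) f x)
    (hf0 : f x ≠ 0) (N : ℕ) :
    pullback (I := I) (fun y => f y ^ N) argForm x =
      (N : ℝ) • pullback (I := I) f argForm x := by
  have hd : ∀ N : ℕ, MDifferentiableAt I 𝓘(ℝ, ℂ) (fun y => f y ^ N) x := fun N =>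
    MDifferentiableAt.comp (I' := 𝓘(ℝ, ℂ)) x (g := fun z : ℂ => z ^ N)
      (DifferentiableAt.mdifferentiableAt (by fun_prop)) hf
  induction N with
  | zero => simpa using pullback_argForm_const (I := I) 1 x
  | succ N ih =>
    simp only [pow_succ]
    rw [pullback_argForm_mul (hd N) hf (pow_ne_zero _ hf0) hf0, ih]
    push_cast
    rw [add_smul, one_smul]

/-- The polar form of a nonvanishing complex function with phase `ξ` and log-modulus `μ`. -/
theorem pullback_argForm_exp {μ ξ : M → ℝ} {x : M} (hμ : MDifferentiableAt I 𝓘(ℝ, ℝ) μ x)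
    (hξ : MDifferentiableAt I 𝓘(ℝ, ℝ) ξ x) :
    pullback (I := I) (fun y => Complex.exp (μ y + 2 * Real.pi * Complex.I * ξ y)) argForm x =
      pullback (I := I) ξ lineForm x := by
  refine one_ext (η := pullback (I := I)
    (fun y => Complex.exp (μ y + 2 * Real.pi * Complex.I * ξ y)) argForm)
    (η' := pullback (I := I) ξ lineForm) fun v => ?_
  let F : ℝ × ℝ → ℂ := fun q => Complex.exp (q.1 + 2 * Real.pi * Complex.I * q.2)
  have hF : HasFDerivAt F (Complex.exp (μ x + 2 * Real.pi * Complex.I * ξ x) •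
      ((Complex.ofRealCLM.comp (ContinuousLinearMap.fst ℝ ℝ ℝ)) +
        (2 * Real.pi * Complex.I) • (Complex.ofRealCLM.comp (ContinuousLinearMap.snd ℝ ℝ ℝ))))
      (μ x, ξ x) := by
    have h1 : HasFDerivAt (fun q : ℝ × ℝ => ((q.1 : ℂ) + 2 * Real.pi * Complex.I * q.2))
      ((Complex.ofRealCLM.comp (ContinuousLinearMap.fst ℝ ℝ ℝ)) +
        (2 * Real.pi * Complex.I) • (Complex.ofRealCLM.comp (ContinuousLinearMap.snd ℝ ℝ ℝ)))
      (μ x, ξ x) :=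
      (Complex.ofRealCLM.comp (ContinuousLinearMap.fst ℝ ℝ ℝ)).hasFDerivAt.add
        ((Complex.ofRealCLM.comp (ContinuousLinearMap.snd ℝ ℝ ℝ)).hasFDerivAt.const_mul _)
    exact h1.cexp
  have hp : HasMFDerivAt I 𝓘(ℝ, ℝ × ℝ) (fun y => (μ y, ξ y)) x
      (ContinuousLinearMap.prod (mfderiv I 𝓘(ℝ, ℝ) μ x : E →L[ℝ] ℝ)
        (mfderiv I 𝓘(ℝ, ℝ) ξ x : E →L[ℝ] ℝ) : E →L[ℝ] ℝ × ℝ) :=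
    ⟨hμ.hasMFDerivAt.1.prodMk hξ.hasMFDerivAt.1, hμ.hasMFDerivAt.2.prodMk hξ.hasMFDerivAt.2⟩
  have h := (HasMFDerivAt.comp (f := fun y => (μ y, ξ y)) x hF.hasMFDerivAt hp).mfderiv
  have h2 : vderiv (fun y => Complex.exp (μ y + 2 * Real.pi * Complex.I * ξ y)) x v
      = Complex.exp (μ x + 2 * Real.pi * Complex.I * ξ x) *
        (((vderiv μ x v : ℝ) : ℂ) + 2 * Real.pi * Complex.I * ((vderiv ξ x v : ℝ) : ℂ)) :=
    DFunLike.congr_fun h v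
  rw [pullback_argForm, h2, pullback_lineForm, inv_mul_cancel_left₀ (Complex.exp_ne_zero _)]
  generalize vderiv μ x v = a
  generalize vderiv ξ x v = b
  have hpi := Real.pi_ne_zero
  simp [hpi]

/-- A nonvanishing smooth complex function has locally a smooth logarithm. -/
theorem exists_local_polar {f : M → ℂ} {x : M} (hf : ContMDiffAt I 𝓘(ℝ, ℂ) ∞ f x)
    (hf0 : f x ≠ 0) : ∃ μ ξ : M → ℝ, ContMDiffAt I 𝓘(ℝ, ℝ) ∞ μ x ∧ ContMDiffAt I 𝓘(ℝ, ℝ) ∞ ξ x ∧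
      ∀ᶠ y in 𝓝 x, f y = Complex.exp (μ y + 2 * Real.pi * Complex.I * ξ y) := by
  -- Dividing by `f x` moves the value at `x` to `1`, away from the branch cut of the logarithm.
  let G : ℂ → ℂ := fun z => Complex.log (z / f x) + Complex.log (f x)
  have hslit : f x / f x ∈ Complex.slitPlane := by rw [div_self hf0]; simp
  have hG : ContDiffAt ℝ ∞ G (f x) := by
    have h1 : ContDiffAt ℂ ∞ (fun z : ℂ => Complex.log (z / f x)) (f x) :=
      ((analyticAt_id.div analyticAt_const hf0).clog hslit).contDiffAt
    exact (h1.restrict_scalars ℝ).add contDiffAt_const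
  have hGf : ContMDiffAt I 𝓘(ℝ, ℂ) ∞ (fun y => G (f y)) x := hG.contMDiffAt.comp x hf
  refine ⟨fun y => (G (f y)).re, fun y => (2 * Real.pi)⁻¹ * (G (f y)).im, ?_, ?_, ?_⟩
  · exact Complex.reCLM.contDiff.contMDiff.contMDiffAt.comp x hGf
  · have h1 : ContDiff ℝ ∞ (fun z : ℂ => (2 * Real.pi)⁻¹ * z.im) :=
      contDiff_const.mul Complex.imCLM.contDiff
    exact h1.contMDiff.contMDiffAt.comp x hGf
  · have hc : ContinuousAt (fun y => f y / f x) x := hf.continuousAt.div_const _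
    filter_upwards [hc.preimage_mem_nhds (Complex.isOpen_slitPlane.mem_nhds hslit)] with y hy
    have hy0 : f y / f x ≠ 0 := Complex.slitPlane_ne_zero hy
    have e1 : ((G (f y)).re : ℂ) + 2 * Real.pi * Complex.I *
        (((2 * Real.pi)⁻¹ * (G (f y)).im : ℝ) : ℂ) = G (f y) := by
      have hpi : (Real.pi : ℂ) ≠ 0 := by exact_mod_cast Real.pi_ne_zero
      conv_rhs => rw [← Complex.re_add_im (G (f y))]
      push_cast
      field_simp
    rw [e1]
    simp only [G]
    rw [Complex.exp_add, Complex.exp_log hy0, Complex.exp_log hf0, div_mul_cancel₀ _ hf0]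

theorem inChart_self {k : ℕ} (η : DiffForm 𝓘(ℝ, E) E k) (x : E) : η.inChart x = η := by
  unfold inChart
  have : ((extChartAt 𝓘(ℝ, E) x).symm : E → E) = id := rfl
  rw [this]
  exact pullback_id η

theorem smoothAt_self {k : ℕ} {η : DiffForm 𝓘(ℝ, E) E k} {x : E} :
    η.SmoothAt x ↔ ContDiffAt ℝ ∞ (F := E [⋀^Fin k]→L[ℝ] ℝ) η x := by
  unfold SmoothAt
  rw [inChart_self]
  rfl

theorem d_self {k : ℕ} (η : DiffForm 𝓘(ℝ, E) E k) (x : E) : η.d x = extDeriv (n := k) η x := by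
  unfold d
  rw [inChart_self]
  ext v
  have h : (extChartAt 𝓘(ℝ, E) x : E → E) = id := rfl
  rw [h]
  simp only [mfderiv_id]
  rfl

theorem lineForm_smoothAt (x : ℝ) : lineForm.SmoothAt x := by
  rw [smoothAt_self]
  exact contDiffAt_const

theorem lineForm_d : lineForm.d = 0 := by
  funext x
  rw [d_self]
  have h : extDeriv (n := 1) lineForm x = extDeriv (fun _ : ℝ =>
    ContinuousAlternatingMap.ofSubsingleton ℝ ℝ ℝ (0 : Fin 1) (ContinuousLinearMap.id ℝ ℝ)) x := rfl
  rw [h, extDeriv]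
  ext
  simp [ContinuousAlternatingMap.alternatizeUncurryFin_apply]
  rfl

theorem argForm_smoothAt {z : ℂ} (hz : z ≠ 0) : argForm.SmoothAt z := by
  rw [smoothAt_self]
  let e := ContinuousAlternatingMap.ofSubsingletonLIE (𝕜 := ℝ) (E := ℂ) (F := ℝ) (0 : Fin 1)
  refine e.contDiff.contDiffAt.comp z (ContDiffAt.const_smul _ ?_)
  refine contDiffAt_const.clm_comp ((ContinuousLinearMap.mul ℝ ℂ).contDiff.contDiffAt.comp z ?_)
  exact contDiffAt_inv ℝ hz

theorem d_pullback_lineForm [IsManifold I ∞ M] [I.Boundaryless] {f : M → ℝ} {x : M}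
    (hf : ContMDiffAt I 𝓘(ℝ, ℝ) ∞ f x) : (pullback (I := I) f lineForm).d x = 0 := by
  rw [d_pullback (lineForm_smoothAt _) hf, lineForm_d]
  rfl

/-- A local polar form of the identity shows that `argForm` is locally the differential of a
function. -/
theorem argForm_d {z : ℂ} (hz : z ≠ 0) : argForm.d z = 0 := by
  obtain ⟨μ, ξ, hμ, hξ, h⟩ := exists_local_polar (I := 𝓘(ℝ, ℂ)) (f := id) (x := z)
    contMDiffAt_id hz
  rw [← d_pullback_lineForm hξ]
  refine d_congr ?_
  have h1 := contMDiffAt_iff_contMDiffAt_nhds (by simp) |>.1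
    (hμ.of_le (show (1 : WithTop ℕ∞) ≤ ∞ by exact_mod_cast le_top))
  have h2 := contMDiffAt_iff_contMDiffAt_nhds (by simp) |>.1
    (hξ.of_le (show (1 : WithTop ℕ∞) ≤ ∞ by exact_mod_cast le_top))
  filter_upwards [h1, h2, h.eventually_nhds] with y hy1 hy2 hy3
  rw [← pullback_argForm_exp (hy1.mdifferentiableAt one_ne_zero)
    (hy2.mdifferentiableAt one_ne_zero), ← pullback_congr argForm hy3, pullback_id]

end DiffForm

end OneForms

/-! ### The Poincaré lemma for 1-forms. -/

section Poincare

variable {E : Type*} [NormedAddCommGroup E] [NormedSpace ℝ E]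
  {H : Type*} [TopologicalSpace H] {I : ModelWithCorners ℝ E H}
  {M : Type*} [TopologicalSpace M] [ChartedSpace H M]

theorem contDiffAt_of_hasFDerivAt {s : Set E} (hs : IsOpen s) {f : E → ℝ} {f' : E → E →L[ℝ] ℝ}
    (hf : ∀ a ∈ s, HasFDerivAt f (f' a) a) (hf' : ContDiffOn ℝ ∞ f' s) {a : E} (ha : a ∈ s) :
    ContDiffAt ℝ ∞ f a := by
  refine ((contDiffOn_infty_iff_fderiv_of_isOpen hs).2
    ⟨fun b hb => (hf b hb).differentiableAt.differentiableWithinAt, ?_⟩).contDiffAt (hs.mem_nhds ha)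
  exact hf'.congr fun b hb => (hf b hb).fderiv

theorem extDeriv_one_apply {ζ : E → E [⋀^Fin 1]→L[ℝ] ℝ} {a : E} (h : DifferentiableAt ℝ ζ a)
    (u v : E) : extDeriv ζ a ![u, v] = fderiv ℝ ζ a u ![v] - fderiv ℝ ζ a v ![u] := by
  rw [extDeriv_apply h]
  have h0 : (0 : Fin 2).removeNth ![u, v] = ![v] := by
    ext i; fin_cases i; rfl
  have h1 : (1 : Fin 2).removeNth ![u, v] = ![u] := by
    ext i; fin_cases i; rfl
  simp [Fin.sum_univ_two, sub_eq_add_neg, h0, h1, fderiv_continuousAlternatingMap_apply_const_apply h]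

theorem extDeriv_two_apply {ζ : E → E [⋀^Fin 2]→L[ℝ] ℝ} {a : E} (h : DifferentiableAt ℝ ζ a)
    (u v w : E) : extDeriv ζ a ![u, v, w] =
      fderiv ℝ ζ a u ![v, w] - fderiv ℝ ζ a v ![u, w] + fderiv ℝ ζ a w ![u, v] := by
  rw [extDeriv_apply h]
  have h0 : (0 : Fin 3).removeNth ![u, v, w] = ![v, w] := by
    ext i; fin_cases i <;> rfl
  have h1 : (1 : Fin 3).removeNth ![u, v, w] = ![u, w] := by
    ext i; fin_cases i <;> rfl
  have h2 : (2 : Fin 3).removeNth ![u, v, w] = ![u, v] := by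
    ext i; fin_cases i <;> rfl
  simp [Fin.sum_univ_three, sub_eq_add_neg, h0, h1, h2, fderiv_continuousAlternatingMap_apply_const_apply h]

/-- The Poincaré lemma for 1-forms on a convex open set. -/
theorem exists_primitive_of_closed {s : Set E} (hs : IsOpen s) (hc : Convex ℝ s)
    {ζ : DiffForm 𝓘(ℝ, E) E 1} (hζ : ∀ a ∈ s, ζ.SmoothAt a) (hd : ∀ a ∈ s, ζ.d a = 0) :
    ∃ f : E → ℝ, ∀ a ∈ s, ContDiffAt ℝ ∞ f a ∧ ζ a = DiffForm.pullback f lineForm a := by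
  let e := ContinuousAlternatingMap.ofSubsingletonLIE (𝕜 := ℝ) (E := E) (F := ℝ) (0 : Fin 1)
  let Z : E → E [⋀^Fin 1]→L[ℝ] ℝ := ζ
  let f' : E → E →L[ℝ] ℝ := fun a => e.symm (Z a)
  have hZ : ∀ a ∈ s, ContDiffAt ℝ ∞ Z a := fun a ha => DiffForm.smoothAt_self.1 (hζ a ha)
  have hf' : ContDiffOn ℝ ∞ f' s := fun a ha =>
    (e.symm.contDiff.contDiffAt.comp a (hZ a ha)).contDiffWithinAt
  -- Closedness says that the derivative of the form, viewed as a map to the dual space, is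
  -- symmetric.
  obtain ⟨f, hf⟩ := hc.exists_forall_hasFDerivAt_of_fderiv_symmetric hs
    (hf'.differentiableOn (by simp)) fun a ha u v => by
      have h1 : extDeriv Z a ![u, v] = 0 := by
        have := DiffForm.d_self ζ a
        rw [hd a ha] at this
        change extDeriv (n := 1) ζ a ![u, v] = 0
        rw [← this]; rfl
      have hdZ : DifferentiableAt ℝ Z a := (hZ a ha).differentiableAt (by simp)
      rw [extDeriv_one_apply hdZ, sub_eq_zero] at h1
      have h2 : fderiv ℝ f' a = (e.symm.toContinuousLinearEquiv : _ →L[ℝ] _) ∘L fderiv ℝ Z a :=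
        e.symm.toContinuousLinearEquiv.comp_fderiv
      rw [h2]
      have h3 : ∀ (y : E [⋀^Fin 1]→L[ℝ] ℝ) (w : E), e.symm y w = y ![w] := fun y w =>
        congrArg y (funext fun i => by fin_cases i; rfl)
      exact (h3 _ _).trans (h1.trans (h3 _ _).symm)
  refine ⟨f, fun a ha => ⟨contDiffAt_of_hasFDerivAt hs hf hf' ha, DiffForm.one_ext fun v => ?_⟩⟩
  rw [DiffForm.pullback_lineForm, vderiv, mfderiv_eq_fderiv, (hf a ha).fderiv]
  rfl

/-- The local Poincaré lemma for 1-forms on a manifold. -/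
theorem exists_local_primitive_of_closed [IsManifold I ∞ M] [I.Boundaryless]
    {η : DiffForm I M 1} {x : M} (hs : ∀ᶠ y in 𝓝 x, η.SmoothAt y) (hd : ∀ᶠ y in 𝓝 x, η.d y = 0) :
    ∃ f : M → ℝ, ∀ᶠ y in 𝓝 x, ContMDiffAt I 𝓘(ℝ, ℝ) ∞ f y ∧
      η y = DiffForm.pullback (I := I) f lineForm y := by
  let φ := extChartAt I x
  have hsymm : ∀ a ∈ φ.target, ContMDiffAt 𝓘(ℝ, E) I ∞ φ.symm a := fun a ha =>
    (contMDiffOn_extChartAt_symm x).contMDiffAt ((isOpen_extChartAt_target x).mem_nhds ha)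
  have hc : Filter.Tendsto φ.symm (𝓝 (φ x)) (𝓝 x) := by
    have := (continuousAt_extChartAt_symm (I := I) x).tendsto
    rwa [(extChartAt I x).left_inv (mem_extChartAt_source x)] at this
  obtain ⟨r, hr, hball⟩ := Metric.eventually_nhds_iff_ball.1 ((hc.eventually (hs.and hd)).and
    ((isOpen_extChartAt_target (I := I) x).mem_nhds (mem_extChartAt_target x)))
  obtain ⟨f, hf⟩ := exists_primitive_of_closed (ζ := DiffForm.pullback (I := 𝓘(ℝ, E)) φ.symm η)
    Metric.isOpen_ball (convex_ball (φ x) r)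
    (fun a ha => DiffForm.SmoothAt.pullback (hball a ha).1.1 (hsymm a (hball a ha).2))
    (fun a ha => by
      rw [DiffForm.d_pullback (hball a ha).1.1 (hsymm a (hball a ha).2)]
      ext v
      rw [DiffForm.pullback_apply, (hball a ha).1.2]
      rfl)
  refine ⟨f ∘ φ, ?_⟩
  have hφ : ∀ᶠ y in 𝓝 x, φ y ∈ Metric.ball (φ x) r :=
    (continuousAt_extChartAt x).preimage_mem_nhds (Metric.ball_mem_nhds _ hr)
  filter_upwards [hφ, (extChartAt_source_mem_nhds (I := I) x)] with y hy hys
  have hφy : ContMDiffAt I 𝓘(ℝ, E) ∞ φ y := contMDiffAt_extChartAt' (by simpa using hys)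
  refine ⟨(hf _ hy).1.contMDiffAt.comp y hφy, ?_⟩
  have hφd := hφy.mdifferentiableAt (by simp)
  rw [DiffForm.pullback_comp lineForm ((hf _ hy).1.contMDiffAt.mdifferentiableAt (by simp)) hφd,
    ← DiffForm.pullback_congr_form (hf _ hy).2]
  rw [← DiffForm.pullback_comp η ((hsymm _ (hball _ hy).2).mdifferentiableAt (by simp)) hφd]
  have : φ.symm ∘ φ =ᶠ[𝓝 y] id := by
    filter_upwards [(isOpen_extChartAt_source x).mem_nhds hys] with z hz
    exact φ.left_inv hz
  rw [DiffForm.pullback_congr η this, DiffForm.pullback_id]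

end Poincare

/-! ### Smooth dependence of integrals on parameters. -/

section Parametric

/-- Differentiation under the integral sign; the dominating constant is a bound for `fderiv ℝ g` on
the compact set `[0, 1] × closedBall a r`. -/
theorem hasFDerivAt_parametric_integral {E F : Type} [NormedAddCommGroup E] [NormedSpace ℝ E]
    [ProperSpace E] [NormedAddCommGroup F] [NormedSpace ℝ F] {V : Set (ℝ × E)} (hV : IsOpen V)
    {U : Set E} (hU : IsOpen U) (hUV : Icc (0 : ℝ) 1 ×ˢ U ⊆ V) {g : ℝ × E → F}
    (hg : ContDiffOn ℝ 1 g V) {a : E} (ha : a ∈ U) :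
    HasFDerivAt (fun a => ∫ t in (0 : ℝ)..1, g (t, a))
      (∫ t in (0 : ℝ)..1, (fderiv ℝ g (t, a)).comp (ContinuousLinearMap.inr ℝ ℝ E)) a := by
  obtain ⟨r, hr, hball⟩ := Metric.nhds_basis_closedBall.mem_iff.1 (hU.mem_nhds ha)
  have hsub : Icc (0 : ℝ) 1 ×ˢ Metric.closedBall a r ⊆ V :=
    (prod_mono_right hball).trans hUV
  have hcont : ContinuousOn (fderiv ℝ g) V := hg.continuousOn_fderiv_of_isOpen hV le_rfl
  obtain ⟨C, hC⟩ := (isCompact_Icc.prod (isCompact_closedBall a r)).exists_bound_of_continuousOn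
    (hcont.mono hsub)
  have hslice : ∀ b ∈ Metric.closedBall a r, MapsTo (fun t : ℝ => (t, b)) (Icc 0 1) V :=
    fun b hb t ht => hsub ⟨ht, hb⟩
  have hgc : ∀ b ∈ Metric.closedBall a r, ContinuousOn (fun t : ℝ => g (t, b)) (Icc 0 1) :=
    fun b hb => hg.continuousOn.comp (by fun_prop) (hslice b hb)
  have haB : a ∈ Metric.closedBall a r := Metric.mem_closedBall_self hr.le
  have hsubIoc : uIoc (0 : ℝ) 1 ⊆ Icc 0 1 := by
    rw [uIoc_of_le zero_le_one]; exact Ioc_subset_Icc_self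
  have hmeas : ∀ {G : Type} [NormedAddCommGroup G] {f : ℝ → G}, ContinuousOn f (Icc 0 1) →
      AEStronglyMeasurable f (volume.restrict (uIoc (0 : ℝ) 1)) := fun {G} _ {f} hf =>
    (hf.aestronglyMeasurable_of_isCompact isCompact_Icc measurableSet_Icc).mono_measure
      (Measure.restrict_mono hsubIoc le_rfl)
  refine intervalIntegral.hasFDerivAt_integral_of_dominated_of_fderiv_le
    (F := fun b t => g (t, b))
    (F' := fun b t => (fderiv ℝ g (t, b)).comp (ContinuousLinearMap.inr ℝ ℝ E))
    (bound := fun _ => C) (Metric.closedBall_mem_nhds a hr) ?_ ?_ ?_ ?_ ?_ ?_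
  · filter_upwards [Metric.closedBall_mem_nhds a hr] with b hb
    exact hmeas (hgc b hb)
  · exact ContinuousOn.intervalIntegrable (by rw [uIcc_of_le zero_le_one]; exact hgc a haB)
  · exact hmeas (ContinuousOn.clm_comp (hcont.comp (by fun_prop) (hslice a haB))
      continuousOn_const)
  · refine Filter.Eventually.of_forall fun t ht b hb => ?_
    refine (ContinuousLinearMap.opNorm_comp_le _ _).trans ?_
    refine (mul_le_of_le_one_right (norm_nonneg _)
      (ContinuousLinearMap.norm_inr_le_one ℝ ℝ E)).trans (hC (t, b) ⟨hsubIoc ht, hb⟩)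
  · simp
  · refine Filter.Eventually.of_forall fun t ht b hb => ?_
    have hd : HasFDerivAt g (fderiv ℝ g (t, b)) (t, b) :=
      ((hg.contDiffAt (hV.mem_nhds (hsub ⟨hsubIoc ht, hb⟩))).differentiableAt
        one_ne_zero).hasFDerivAt
    have h2 : HasFDerivAt (fun b : E => (t, b)) (ContinuousLinearMap.inr ℝ ℝ E) b :=
      hasFDerivAt_prodMk_right t b
    exact hd.comp b h2

/-- Induction on `n`. The target `F` is quantified inside the induction because the derivative is
again a parametric integral, with values in `E →L[ℝ] F`. -/
theorem contDiffOn_parametric_integral {E : Type} [NormedAddCommGroup E] [NormedSpace ℝ E]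
    [ProperSpace E] {V : Set (ℝ × E)} (hV : IsOpen V)
    {U : Set E} (hU : IsOpen U) (hUV : Icc (0 : ℝ) 1 ×ˢ U ⊆ V) (n : ℕ) :
    ∀ {F : Type} [NormedAddCommGroup F] [NormedSpace ℝ F] {g : ℝ × E → F},
      ContDiffOn ℝ ∞ g V → ContDiffOn ℝ n (fun a => ∫ t in (0 : ℝ)..1, g (t, a)) U := by
  have hle : (1 : WithTop ℕ∞) ≤ ∞ := by exact_mod_cast le_top
  induction n with
  | zero =>
    intro F _ _ g hg
    refine contDiffOn_zero.2 fun a ha => ?_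
    exact (hasFDerivAt_parametric_integral hV hU hUV (hg.of_le hle) ha
      ).continuousAt.continuousWithinAt
  | succ n ih =>
    intro F _ _ g hg
    have hd := fun a ha => hasFDerivAt_parametric_integral hV hU hUV (hg.of_le hle) (a := a) ha
    rw [show ((n + 1 : ℕ) : WithTop ℕ∞) = (n : WithTop ℕ∞) + 1 by push_cast; rfl]
    refine (contDiffOn_succ_iff_fderiv_of_isOpen hU).2
      ⟨fun a ha => (hd a ha).differentiableAt.differentiableWithinAt, fun h => absurd h (by exact_mod_cast WithTop.coe_ne_top), ?_⟩
    refine ContDiffOn.congr (ih (g := fun q => (fderiv ℝ g q).comp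
      (ContinuousLinearMap.inr ℝ ℝ E)) ?_) fun a ha => (hd a ha).fderiv
    exact (hg.fderiv_of_isOpen hV le_rfl).clm_comp contDiffOn_const

end Parametric

/-! ### The Poincaré lemma for 2-forms, with the radial primitive. -/

section PoincareTwo

variable {E : Type} [NormedAddCommGroup E] [NormedSpace ℝ E]

/-- Currying of alternating 2-forms. -/
def curryTwo : (E [⋀^Fin 2]→L[ℝ] ℝ) →L[ℝ] E →L[ℝ] E [⋀^Fin 1]→L[ℝ] ℝ :=
  (ContinuousAlternatingMap.curryLeftLI (𝕜 := ℝ) (E := E) (F := ℝ) (n := 1)).toContinuousLinearMap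

theorem curryTwo_apply (y : E [⋀^Fin 2]→L[ℝ] ℝ) (u v : E) : curryTwo y u ![v] = y ![u, v] := rfl

theorem contDiff_curryTwo : ContDiff ℝ ∞ (fun y : E [⋀^Fin 2]→L[ℝ] ℝ => curryTwo y) :=
  ContinuousLinearMap.contDiff (𝕜 := ℝ) (E := E [⋀^Fin 2]→L[ℝ] ℝ)
    (F := E →L[ℝ] E [⋀^Fin 1]→L[ℝ] ℝ) curryTwo

theorem hasFDerivAt_curryTwo (y : E [⋀^Fin 2]→L[ℝ] ℝ) :
    HasFDerivAt (fun y : E [⋀^Fin 2]→L[ℝ] ℝ => curryTwo y) curryTwo y :=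
  ContinuousLinearMap.hasFDerivAt (𝕜 := ℝ) (E := E [⋀^Fin 2]→L[ℝ] ℝ)
    (F := E →L[ℝ] E [⋀^Fin 1]→L[ℝ] ℝ) curryTwo

theorem hasDerivAt_curryTwo {f : ℝ → E [⋀^Fin 2]→L[ℝ] ℝ} {f' : E [⋀^Fin 2]→L[ℝ] ℝ} {s : ℝ}
    (h : HasDerivAt f f' s) : HasDerivAt (fun s => curryTwo (f s)) (curryTwo f') s :=
  HasFDerivAt.comp_hasDerivAt (F := E [⋀^Fin 2]→L[ℝ] ℝ)
    (E := E →L[ℝ] E [⋀^Fin 1]→L[ℝ] ℝ) s (hasFDerivAt_curryTwo (f s)) h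

/-- The contraction of a 2-form with the radial vector field, along the homothety of ratio `t`. -/
def radialContraction (ζ : E → E [⋀^Fin 2]→L[ℝ] ℝ) (c : E) (q : ℝ × E) : E [⋀^Fin 1]→L[ℝ] ℝ :=
  q.1 • curryTwo (ζ (c + q.1 • (q.2 - c))) (q.2 - c)

/-- The radial primitive of a 2-form on a ball with centre `c`. -/
def radialPrimitive (ζ : E → E [⋀^Fin 2]→L[ℝ] ℝ) (c a : E) : E [⋀^Fin 1]→L[ℝ] ℝ :=
  ∫ t in (0 : ℝ)..1, radialContraction ζ c (t, a)

variable {ζ : E → E [⋀^Fin 2]→L[ℝ] ℝ} {c : E} {r : ℝ}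

theorem homothety_mem_ball {t : ℝ} (ht : t ∈ Icc (0 : ℝ) 1) {a : E} (ha : a ∈ Metric.ball c r) :
    c + t • (a - c) ∈ Metric.ball c r := by
  have hr : 0 < r := dist_nonneg.trans_lt ha
  exact (convex_ball c r).add_smul_sub_mem (Metric.mem_ball_self hr) ha ht

/-- The domain is an open set of pairs containing `[0, 1] × ball`, as differentiation under the
integral requires. -/
theorem contDiffOn_radialContraction (hζ : ContDiffOn ℝ ∞ ζ (Metric.ball c r)) :
    ContDiffOn ℝ ∞ (radialContraction ζ c)
      ((fun q : ℝ × E => c + q.1 • (q.2 - c)) ⁻¹' Metric.ball c r) := by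
  have h1 : ContDiff ℝ ∞ (fun q : ℝ × E => c + q.1 • (q.2 - c)) := by fun_prop
  have h2 : ContDiffOn ℝ ∞ (fun q : ℝ × E => curryTwo
      (ζ (c + q.1 • (q.2 - c))))
      ((fun q : ℝ × E => c + q.1 • (q.2 - c)) ⁻¹' Metric.ball c r) :=
    contDiff_curryTwo.comp_contDiffOn (hζ.comp h1.contDiffOn fun _ h => h)
  exact contDiff_fst.contDiffOn.smul (h2.clm_apply (contDiff_snd.sub contDiff_const).contDiffOn)

theorem hasDerivAt_radialContraction_apply {t : ℝ} {a : E}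
    (h : DifferentiableAt ℝ ζ (c + t • (a - c))) (u v : E) :
    HasDerivAt (fun s : ℝ => radialContraction ζ c (t, a + s • u) ![v])
      (t * (t * fderiv ℝ ζ (c + t • (a - c)) u ![a - c, v] + ζ (c + t • (a - c)) ![u, v])) 0 := by
  have hp : HasDerivAt (fun s : ℝ => c + t • (a + s • u - c)) (t • u) 0 := by
    have : HasDerivAt (fun s : ℝ => a + s • u) ((1 : ℝ) • u) 0 :=
      ((hasDerivAt_id (0 : ℝ)).smul_const u).const_add a
    simpa using ((this.sub_const c).const_smul t).const_add c
  have hx : HasDerivAt (fun s : ℝ => a + s • u - c) u 0 := by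
    simpa using (((hasDerivAt_id (0 : ℝ)).smul_const u).const_add a).sub_const c
  have hz : HasDerivAt (fun s : ℝ => ζ (c + t • (a + s • u - c)))
      (fderiv ℝ ζ (c + t • (a - c)) (t • u)) 0 := by
    have h' : HasFDerivAt ζ (fderiv ℝ ζ (c + t • (a - c))) (c + t • (a + (0 : ℝ) • u - c)) := by
      simpa using h.hasFDerivAt
    exact h'.comp_hasDerivAt (0 : ℝ) hp
  have hk : HasDerivAt (fun s : ℝ => curryTwo (ζ (c + t • (a + s • u - c))))
      (curryTwo (fderiv ℝ ζ (c + t • (a - c)) (t • u))) 0 :=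
    hasDerivAt_curryTwo hz
  have hc : HasDerivAt (fun s : ℝ => curryTwo (ζ (c + t • (a + s • u - c))) (a + s • u - c))
      (curryTwo (fderiv ℝ ζ (c + t • (a - c)) (t • u)) (a - c) +
        curryTwo (ζ (c + t • (a - c))) u) 0 := by
    simpa only [zero_smul, add_zero] using hk.clm_apply hx
  have hev : HasDerivAt
      (fun s : ℝ => curryTwo (ζ (c + t • (a + s • u - c))) (a + s • u - c) ![v])
      ((curryTwo (fderiv ℝ ζ (c + t • (a - c)) (t • u)) (a - c) +
        curryTwo (ζ (c + t • (a - c))) u) ![v]) 0 :=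
    (ContinuousAlternatingMap.apply ℝ E ℝ ![v]).hasFDerivAt.comp_hasDerivAt (0 : ℝ) hc
  have := hev.const_mul t
  simp only [ContinuousAlternatingMap.add_apply, curryTwo_apply, map_smul] at this
  exact this

theorem contDiffOn_radialPrimitive [ProperSpace E] (hζ : ContDiffOn ℝ ∞ ζ (Metric.ball c r)) :
    ContDiffOn ℝ ∞ (radialPrimitive ζ c) (Metric.ball c r) := by
  refine contDiffOn_infty.2 fun n => contDiffOn_parametric_integral (Metric.isOpen_ball.preimage
    (by fun_prop)) Metric.isOpen_ball ?_ n (contDiffOn_radialContraction hζ)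
  rintro ⟨t, a⟩ ⟨ht, ha⟩
  exact homothety_mem_ball ht ha

theorem continuousOn_radialContraction (hζ : ContDiffOn ℝ ∞ ζ (Metric.ball c r)) {a : E}
    (ha : a ∈ Metric.ball c r) :
    ContinuousOn (fun t : ℝ => radialContraction ζ c (t, a)) (Icc 0 1) :=
  (contDiffOn_radialContraction hζ).continuousOn.comp (by fun_prop)
    fun _ ht => homothety_mem_ball ht ha

theorem intervalIntegrable_of_Icc {F : Type*} [NormedAddCommGroup F] {f : ℝ → F}
    (hf : ContinuousOn f (Icc 0 1)) : IntervalIntegrable f volume 0 1 :=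
  ContinuousOn.intervalIntegrable (by rwa [uIcc_of_le zero_le_one])

theorem radialPrimitive_apply (hζ : ContDiffOn ℝ ∞ ζ (Metric.ball c r)) {a : E}
    (ha : a ∈ Metric.ball c r) (v : E) :
    radialPrimitive ζ c a ![v] = ∫ t in (0 : ℝ)..1, radialContraction ζ c (t, a) ![v] :=
  ((ContinuousAlternatingMap.apply ℝ E ℝ ![v]).intervalIntegral_comp_comm
    (intervalIntegrable_of_Icc (continuousOn_radialContraction hζ ha))).symm

/-- The integrand inserts two parallel vectors into an alternating form. As a consequence the radial
sides of a cone do not contribute in Stokes' theorem. -/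
theorem radialPrimitive_radial (hζ : ContDiffOn ℝ ∞ ζ (Metric.ball c r)) {a : E}
    (ha : a ∈ Metric.ball c r) {b : ℝ} {w : E} (hw : a - c = b • w) :
    radialPrimitive ζ c a ![w] = 0 := by
  rw [radialPrimitive_apply hζ ha]
  have : ∀ t : ℝ, radialContraction ζ c (t, a) ![w] = 0 := fun t => by
    have h1 : curryTwo (ζ (c + t • (a - c))) w ![w] = 0 :=
      (ζ _).map_eq_zero_of_eq (i := 0) (j := 1) _ rfl (by simp)
    have h2 : radialContraction ζ c (t, a) = t • curryTwo (ζ (c + t • (a - c))) (a - c) := rfl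
    rw [h2, ContinuousAlternatingMap.smul_apply]
    rw [show curryTwo (ζ (c + t • (a - c))) (a - c) = curryTwo (ζ (c + t • (a - c))) (b • w) by
      conv_lhs => arg 2; rw [hw]]
    rw [map_smul, ContinuousAlternatingMap.smul_apply, h1, smul_zero, smul_zero]
  simp [this]

theorem fderiv_radialPrimitive [ProperSpace E] (hζ : ContDiffOn ℝ ∞ ζ (Metric.ball c r)) {a : E}
    (ha : a ∈ Metric.ball c r) (u v : E) :
    fderiv ℝ (radialPrimitive ζ c) a u ![v] = ∫ t in (0 : ℝ)..1,
      t * (t * fderiv ℝ ζ (c + t • (a - c)) u ![a - c, v] + ζ (c + t • (a - c)) ![u, v]) := by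
  have hle : (1 : WithTop ℕ∞) ≤ ∞ := by exact_mod_cast le_top
  set V := (fun q : ℝ × E => c + q.1 • (q.2 - c)) ⁻¹' Metric.ball c r
  have hV : IsOpen V := Metric.isOpen_ball.preimage (by fun_prop)
  have hg := contDiffOn_radialContraction hζ
  have hmem : ∀ t ∈ Icc (0 : ℝ) 1, (t, a) ∈ V := fun t ht => homothety_mem_ball ht ha
  have hd := hasFDerivAt_parametric_integral hV Metric.isOpen_ball
    (fun q hq => homothety_mem_ball hq.1 hq.2) (hg.of_le hle) ha
  have hfd : ContinuousOn (fun t : ℝ => (fderiv ℝ (radialContraction ζ c) (t, a)).comp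
      (ContinuousLinearMap.inr ℝ ℝ E)) (Icc 0 1) :=
    (((hg.of_le hle).continuousOn_fderiv_of_isOpen hV le_rfl).comp (by fun_prop)
      hmem).clm_comp continuousOn_const
  have hd' : fderiv ℝ (radialPrimitive ζ c) a = _ := hd.fderiv
  rw [hd']
  let ev : (E →L[ℝ] E [⋀^Fin 1]→L[ℝ] ℝ) →L[ℝ] ℝ :=
    (ContinuousAlternatingMap.apply ℝ E ℝ ![v]).comp (ContinuousLinearMap.apply ℝ _ u)
  refine (ContinuousLinearMap.intervalIntegral_comp_comm (𝕜 := ℝ)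
    (E := E →L[ℝ] E [⋀^Fin 1]→L[ℝ] ℝ) (F := ℝ) ev (μ := volume) (a := 0) (b := 1) (f := fun t : ℝ => (fderiv ℝ (radialContraction ζ c) (t, a)).comp
    (ContinuousLinearMap.inr ℝ ℝ E))
    (by
    refine ContinuousOn.intervalIntegrable ?_
    rw [uIcc_of_le zero_le_one]; exact hfd)).symm.trans ?_
  refine intervalIntegral.integral_congr fun t ht => ?_
  rw [uIcc_of_le zero_le_one] at ht
  have hζd : DifferentiableAt ℝ ζ (c + t • (a - c)) :=
    (hζ.contDiffAt (Metric.isOpen_ball.mem_nhds (hmem t ht))).differentiableAt (by simp)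
  -- The partial derivative under the integral is identified by computing the directional derivative
  -- along `u` in two ways.
  refine HasDerivAt.unique (f := fun s : ℝ => radialContraction ζ c (t, a + s • u) ![v]) (x := 0) ?_
    (hasDerivAt_radialContraction_apply hζd u v)
  have h1 : HasFDerivAt (radialContraction ζ c) (fderiv ℝ (radialContraction ζ c) (t, a))
      (t, a + (0 : ℝ) • u) := by
    simpa using ((hg.contDiffAt (hV.mem_nhds (hmem t ht))).differentiableAt (by simp)).hasFDerivAt
  have h2 : HasDerivAt (fun s : ℝ => (t, a + s • u)) (0, u) 0 := by
    have : HasDerivAt (fun s : ℝ => a + s • u) u 0 := by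
      simpa using ((hasDerivAt_id (0 : ℝ)).smul_const u).const_add a
    exact (hasDerivAt_const 0 t).prodMk this
  exact (ContinuousAlternatingMap.apply ℝ E ℝ ![v]).hasFDerivAt.comp_hasDerivAt (0 : ℝ)
    (h1.comp_hasDerivAt (0 : ℝ) h2)

/-- The Poincaré lemma for 2-forms on a ball. -/
theorem extDeriv_radialPrimitive [ProperSpace E] (hζ : ContDiffOn ℝ ∞ ζ (Metric.ball c r))
    (hd : ∀ a ∈ Metric.ball c r, extDeriv ζ a = 0) {a : E} (ha : a ∈ Metric.ball c r) :
    extDeriv (radialPrimitive ζ c) a = ζ a := by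
  have hle : (1 : WithTop ℕ∞) ≤ ∞ := by exact_mod_cast le_top
  have hζd : ∀ t ∈ Icc (0 : ℝ) 1, DifferentiableAt ℝ ζ (c + t • (a - c)) := fun t ht =>
    (hζ.contDiffAt (Metric.isOpen_ball.mem_nhds (homothety_mem_ball ht ha))).differentiableAt
      (by simp)
  have hline : ContinuousOn (fun t : ℝ => ζ (c + t • (a - c))) (Icc 0 1) :=
    hζ.continuousOn.comp (by fun_prop) fun t ht => homothety_mem_ball ht ha
  have hline' : ContinuousOn (fun t : ℝ => fderiv ℝ ζ (c + t • (a - c))) (Icc 0 1) :=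
    ((hζ.of_le hle).continuousOn_fderiv_of_isOpen Metric.isOpen_ball le_rfl).comp (by fun_prop)
      fun t ht => homothety_mem_ball ht ha
  have hev : ∀ {f : ℝ → E [⋀^Fin 2]→L[ℝ] ℝ} (w : Fin 2 → E), ContinuousOn f (Icc 0 1) →
      ContinuousOn (fun t => f t w) (Icc 0 1) := fun w hf =>
    (ContinuousAlternatingMap.apply ℝ E ℝ w).continuous.comp_continuousOn hf
  have hint : ∀ u v : E, IntervalIntegrable (fun t : ℝ =>
      t * (t * fderiv ℝ ζ (c + t • (a - c)) u ![a - c, v] + ζ (c + t • (a - c)) ![u, v]))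
      volume 0 1 := fun u v => intervalIntegrable_of_Icc <| continuousOn_id.mul
    ((continuousOn_id.mul (hev _ (hline'.clm_apply continuousOn_const))).add (hev _ hline))
  ext w
  obtain ⟨u, v, rfl⟩ : ∃ u v, w = ![u, v] :=
    ⟨w 0, w 1, by ext i; fin_cases i <;> rfl⟩
  rw [extDeriv_one_apply (((contDiffOn_radialPrimitive hζ).contDiffAt
      (Metric.isOpen_ball.mem_nhds ha)).differentiableAt (by simp)),
    fderiv_radialPrimitive hζ ha, fderiv_radialPrimitive hζ ha,
    ← intervalIntegral.integral_sub (hint u v) (hint v u)]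
  -- By closedness the antisymmetrized integrand is the derivative of `t ^ 2 * ζ (c + t • (a - c))
  -- ![u, v]`, whose values at `1` and `0` are `ζ a ![u, v]` and `0`.
  have hderiv : ∀ t ∈ uIcc (0 : ℝ) 1, HasDerivAt (fun t : ℝ => t ^ 2 * ζ (c + t • (a - c)) ![u, v])
      (t * (t * fderiv ℝ ζ (c + t • (a - c)) u ![a - c, v] + ζ (c + t • (a - c)) ![u, v]) -
        t * (t * fderiv ℝ ζ (c + t • (a - c)) v ![a - c, u] + ζ (c + t • (a - c)) ![v, u])) t := by
    intro t ht
    rw [uIcc_of_le zero_le_one] at ht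
    have h0 := hd _ (homothety_mem_ball ht ha)
    have h1 := extDeriv_two_apply (hζd t ht) (a - c) u v
    rw [h0] at h1
    have h2 : ζ (c + t • (a - c)) ![v, u] = - ζ (c + t • (a - c)) ![u, v] := by
      have := (ζ (c + t • (a - c))).map_swap ![u, v] (i := 0) (j := 1) (by simp)
      refine Eq.trans (congrArg _ ?_) this
      ext i; fin_cases i <;> rfl
    have h3 : HasDerivAt (fun t : ℝ => c + t • (a - c)) (a - c) t := by
      simpa using ((hasDerivAt_id t).smul_const (a - c)).const_add c
    have h4 := (ContinuousAlternatingMap.apply ℝ E ℝ ![u, v]).hasFDerivAt.comp_hasDerivAt t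
      ((hζd t ht).hasFDerivAt.comp_hasDerivAt t h3)
    have h5 := (hasDerivAt_pow 2 t).mul h4
    refine h5.congr_deriv ?_
    have h1' : 0 = fderiv ℝ ζ (c + t • (a - c)) (a - c) ![u, v] -
      fderiv ℝ ζ (c + t • (a - c)) u ![a - c, v] +
      fderiv ℝ ζ (c + t • (a - c)) v ![a - c, u] := h1
    rw [h2]
    change _ * ζ (c + t • (a - c)) ![u, v] + t ^ 2 * fderiv ℝ ζ (c + t • (a - c)) (a - c) ![u, v] = _
    push_cast
    linear_combination t ^ 2 * h1'.symm
  rw [intervalIntegral.integral_eq_sub_of_hasDerivAt hderiv ((hint u v).sub (hint v u))]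
  simp

end PoincareTwo

/-! ### Fubini and Stokes on the unit triangle. -/

section Triangle

theorem isCompact_unitTriangle : IsCompact unitTriangle := by
  refine (isCompact_Icc.prod isCompact_Icc : IsCompact (Icc (0 : ℝ) 1 ×ˢ Icc (0 : ℝ) 1)
    ).of_isClosed_subset ?_ ?_
  · refine (isClosed_le continuous_const continuous_fst).inter
      ((isClosed_le continuous_const continuous_snd).inter
      (isClosed_le (continuous_fst.add continuous_snd) continuous_const))
  · rintro ⟨a, b⟩ ⟨h1, h2, h3⟩
    simp only at h1 h2 h3
    exact ⟨⟨h1, by linarith⟩, ⟨h2, by linarith⟩⟩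

theorem measurableSet_unitTriangle : MeasurableSet unitTriangle :=
  isCompact_unitTriangle.isClosed.measurableSet

theorem integral_unitTriangle {g : ℝ × ℝ → ℝ} (hg : ContinuousOn g unitTriangle) :
    ∫ q in unitTriangle, g q = ∫ a in (0 : ℝ)..1, ∫ b in (0 : ℝ)..(1 - a), g (a, b) := by
  have hi : Integrable (unitTriangle.indicator g) (volume.prod volume) :=
    (integrable_indicator_iff measurableSet_unitTriangle).2
      (hg.integrableOn_compact isCompact_unitTriangle)
  rw [← integral_indicator measurableSet_unitTriangle, Measure.volume_eq_prod, integral_prod _ hi,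
    intervalIntegral.integral_of_le zero_le_one, ← integral_Icc_eq_integral_Ioc,
    ← integral_indicator measurableSet_Icc]
  refine integral_congr_ae (Filter.Eventually.of_forall fun a => ?_)
  by_cases ha : a ∈ Icc (0 : ℝ) 1
  · simp only [indicator_of_mem ha]
    rw [intervalIntegral.integral_of_le (sub_nonneg.2 ha.2), ← integral_Icc_eq_integral_Ioc,
      ← integral_indicator measurableSet_Icc]
    refine integral_congr_ae (Filter.Eventually.of_forall fun b => ?_)
    by_cases hb : b ∈ Icc (0 : ℝ) (1 - a)
    · have : (a, b) ∈ unitTriangle := ⟨ha.1, hb.1, by simpa using (by linarith [hb.2] : a + b ≤ 1)⟩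
      simp only [indicator_of_mem hb, indicator_of_mem this]
    · have : (a, b) ∉ unitTriangle := fun h => hb ⟨h.2.1, by have := h.2.2; simp at this; linarith⟩
      simp only [indicator_of_notMem hb, indicator_of_notMem this]
  · simp only [indicator_of_notMem ha]
    have : ∀ b : ℝ, (a, b) ∉ unitTriangle := fun b h => ha
      ⟨h.1, by have h1 := h.2.1; have := h.2.2; simp at this h1; linarith⟩
    simp [this]

theorem integral_unitTriangle_symm {g : ℝ × ℝ → ℝ} (hg : ContinuousOn g unitTriangle) :
    ∫ q in unitTriangle, g q = ∫ b in (0 : ℝ)..1, ∫ a in (0 : ℝ)..(1 - b), g (a, b) := by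
  have hswap : Prod.swap ⁻¹' unitTriangle = unitTriangle := by
    ext ⟨a, b⟩
    simp only [unitTriangle, mem_preimage, Prod.swap_prod_mk, mem_ofPred_eq]
    constructor <;> rintro ⟨h1, h2, h3⟩ <;> exact ⟨h2, h1, by linarith⟩
  have h := integral_unitTriangle (g := g ∘ Prod.swap)
    (hg.comp continuous_swap.continuousOn fun q hq => hswap.symm ▸ hq)
  have hm : MeasurePreserving (Prod.swap : ℝ × ℝ → ℝ × ℝ) volume volume :=
    Measure.measurePreserving_swap
  have h2 := hm.setIntegral_preimage_emb (MeasurableEquiv.prodComm.measurableEmbedding) g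
    unitTriangle
  rw [hswap] at h2
  rw [← h2]
  exact h

theorem intervalIntegral_fderiv_line {f : ℝ × ℝ → ℝ} {c : ℝ} {h : ℝ → ℝ × ℝ} {w : ℝ × ℝ}
    (hh : ∀ t, HasDerivAt h w t) (hc : 0 ≤ c) {U : Set (ℝ × ℝ)} (hU : IsOpen U)
    (hf : ContDiffOn ℝ 1 f U) (hmem : ∀ t ∈ Icc 0 c, h t ∈ U) :
    ∫ t in (0 : ℝ)..c, fderiv ℝ f (h t) w = f (h c) - f (h 0) := by
  refine intervalIntegral.integral_eq_sub_of_hasDerivAt (f := f ∘ h) (fun t ht => ?_) ?_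
  · rw [uIcc_of_le hc] at ht
    exact (((hf.contDiffAt (hU.mem_nhds (hmem t ht))).differentiableAt one_ne_zero
      ).hasFDerivAt).comp_hasDerivAt t (hh t)
  · refine ContinuousOn.intervalIntegrable ?_
    rw [uIcc_of_le hc]
    exact ((hf.continuousOn_fderiv_of_isOpen hU le_rfl).comp
      (fun t _ => (hh t).continuousAt.continuousWithinAt) hmem).clm_apply continuousOn_const

/-- Stokes' theorem for 1-forms on the unit triangle. -/
theorem integral_extDeriv_unitTriangle {η : ℝ × ℝ → (ℝ × ℝ) [⋀^Fin 1]→L[ℝ] ℝ} {U : Set (ℝ × ℝ)}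
    (hU : IsOpen U) (hΔ : unitTriangle ⊆ U) (hη : ContDiffOn ℝ 1 η U) :
    ∫ q in unitTriangle, extDeriv η q ![((1 : ℝ), (0 : ℝ)), (0, 1)] =
      (∫ b in (0 : ℝ)..1, (η (1 - b, b) ![(0, 1)] - η (0, b) ![(0, 1)])) -
        ∫ a in (0 : ℝ)..1, (η (a, 1 - a) ![(1, 0)] - η (a, 0) ![(1, 0)]) := by
  have hd : ∀ q ∈ unitTriangle, DifferentiableAt ℝ η q := fun q hq =>
    (hη.contDiffAt (hU.mem_nhds (hΔ hq))).differentiableAt one_ne_zero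
  have hev : ∀ w : ℝ × ℝ, ContDiffOn ℝ 1 (fun q => η q ![w]) U := fun w =>
    (ContinuousAlternatingMap.apply ℝ (ℝ × ℝ) ℝ ![w]).contDiff.comp_contDiffOn hη
  have hfd : ∀ w : ℝ × ℝ, ∀ q ∈ unitTriangle, ∀ u,
      fderiv ℝ (fun q => η q ![w]) q u = fderiv ℝ η q u ![w] := fun w q hq u =>
    fderiv_continuousAlternatingMap_apply_const_apply (hd q hq) _ _
  have hcont : ∀ w u : ℝ × ℝ, ContinuousOn (fun q => fderiv ℝ (fun q => η q ![w]) q u)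
      unitTriangle := fun w u =>
    (((hev w).continuousOn_fderiv_of_isOpen hU le_rfl).mono hΔ).clm_apply continuousOn_const
  have hI : ∀ w u : ℝ × ℝ, IntegrableOn (fun q => fderiv ℝ (fun q => η q ![w]) q u)
      unitTriangle := fun w u => (hcont w u).integrableOn_compact isCompact_unitTriangle
  have h1 : ∫ q in unitTriangle, extDeriv η q ![((1 : ℝ), (0 : ℝ)), (0, 1)] =
      (∫ q in unitTriangle, fderiv ℝ (fun q => η q ![((0 : ℝ), (1 : ℝ))]) q (1, 0)) -
      ∫ q in unitTriangle, fderiv ℝ (fun q => η q ![((1 : ℝ), (0 : ℝ))]) q (0, 1) := by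
    rw [← integral_sub (hI _ _) (hI _ _)]
    refine setIntegral_congr_fun measurableSet_unitTriangle fun q hq => ?_
    rw [extDeriv_one_apply (hd q hq), hfd _ q hq, hfd _ q hq]
  -- Each of the two terms is integrated first in the variable in which it is differentiated, so
  -- that the inner integral is a difference of boundary values.
  rw [h1, integral_unitTriangle_symm (hcont _ _), integral_unitTriangle (hcont _ _)]
  congr 1
  · refine intervalIntegral.integral_congr fun b hb => ?_
    rw [uIcc_of_le zero_le_one] at hb
    exact intervalIntegral_fderiv_line (h := fun t => (t, b)) (w := (1, 0))
      (fun t => (hasDerivAt_id t).prodMk (hasDerivAt_const t b)) (sub_nonneg.2 hb.2) hU (hev _)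
      fun t ht => hΔ ⟨ht.1, hb.1, by have := ht.2; simp only; linarith⟩
  · refine intervalIntegral.integral_congr fun a ha => ?_
    rw [uIcc_of_le zero_le_one] at ha
    exact intervalIntegral_fderiv_line (h := fun t => (a, t)) (w := (0, 1))
      (fun t => (hasDerivAt_const t a).prodMk (hasDerivAt_id t)) (sub_nonneg.2 ha.2) hU (hev _)
      fun t ht => hΔ ⟨ha.1, ht.1, by have := ht.2; simp only; linarith⟩

end Triangle

/-! ### Integrals of closed 2-forms over cones. -/

section Cone

variable {E : Type} [NormedAddCommGroup E] [NormedSpace ℝ E]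

/-- The cone with apex `c` over the path `S`, parametrized by the unit triangle so that it is as
smooth as `S`. -/
def coneMap (c : E) (S : ℝ → E) (q : ℝ × ℝ) : E :=
  c + q.1 • (S q.2 - c) + q.2 • (S (1 - q.1) - c)

/-- The value is the convex combination of `c`, `S q.2`, `S (1 - q.1)` with weights `1 - q.1 - q.2`,
`q.1`, `q.2`. -/
theorem coneMap_mem {c : E} {S : ℝ → E} {r : ℝ} (hS : ∀ t ∈ Icc (0 : ℝ) 1, S t ∈ Metric.ball c r)
    {q : ℝ × ℝ} (hq : q ∈ unitTriangle) : coneMap c S q ∈ Metric.ball c r := by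
  obtain ⟨h1, h2, h3⟩ := hq
  have hr : 0 < r := dist_nonneg.trans_lt (hS 0 (by simp))
  have key := (convex_ball c r).sum_mem (t := Finset.univ)
    (w := ![1 - q.1 - q.2, q.1, q.2]) (z := ![c, S q.2, S (1 - q.1)])
    (fun i _ => by fin_cases i <;> simp <;> linarith) (by simp [Fin.sum_univ_three]; ring)
    (fun i _ => by
      fin_cases i
      · exact Metric.mem_ball_self hr
      · exact hS _ ⟨h2, by linarith⟩
      · exact hS _ ⟨by linarith, by linarith⟩)
  convert key using 1
  simp only [Fin.sum_univ_three, coneMap, Matrix.cons_val_zero, Matrix.cons_val_one,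
    Matrix.cons_val]
  module

/-- The integral of a closed 2-form over a cone is the integral of its radial primitive over the
base of the cone. -/
theorem integral_coneMap [ProperSpace E] {c : E} {r : ℝ} {ζ : DiffForm 𝓘(ℝ, E) E 2}
    (hζ : ContDiffOn ℝ ∞ (F := E [⋀^Fin 2]→L[ℝ] ℝ) ζ (Metric.ball c r))
    (hd : ∀ a ∈ Metric.ball c r, extDeriv (E := E) (n := 2) ζ a = 0) {S : ℝ → E} {J : Set ℝ}
    (hJ : IsOpen J) (hIJ : Icc (0 : ℝ) 1 ⊆ J) (hS : ContDiffOn ℝ ∞ S J)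
    (hSb : ∀ t ∈ Icc (0 : ℝ) 1, S t ∈ Metric.ball c r) :
    ∃ U : Set (ℝ × ℝ), IsOpen U ∧ unitTriangle ⊆ U ∧ ContDiffOn ℝ ∞ (coneMap c S) U ∧
      MapsTo (coneMap c S) U (Metric.ball c r) ∧
      ∫ q in unitTriangle, DiffForm.pullback (I := 𝓘(ℝ, ℝ × ℝ)) (coneMap c S) ζ q
        ![((1 : ℝ), (0 : ℝ)), (0, 1)] =
      ∫ t in (0 : ℝ)..1, DiffForm.pullback (I := 𝓘(ℝ, ℝ)) (I' := 𝓘(ℝ, E)) S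
        (radialPrimitive ζ c) t ![(1 : ℝ)] := by
  set F := coneMap c S with hFdef
  let θ : DiffForm 𝓘(ℝ, E) E 1 := radialPrimitive ζ c
  let U₀ : Set (ℝ × ℝ) := (fun q : ℝ × ℝ => q.2) ⁻¹' J ∩ (fun q : ℝ × ℝ => 1 - q.1) ⁻¹' J
  have hU₀ : IsOpen U₀ := (hJ.preimage continuous_snd).inter (hJ.preimage (by fun_prop))
  have hF₀ : ContDiffOn ℝ ∞ F U₀ := by
    refine (contDiffOn_const.add (contDiffOn_fst.smul ((hS.comp contDiffOn_snd
      fun q hq => hq.1).sub contDiffOn_const))).add (contDiffOn_snd.smul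
      ((hS.comp (contDiffOn_const.sub contDiffOn_fst) fun q hq => hq.2).sub contDiffOn_const))
  set U := U₀ ∩ F ⁻¹' Metric.ball c r with hUdef
  have hU : IsOpen U := hF₀.continuousOn.isOpen_inter_preimage hU₀ Metric.isOpen_ball
  have hΔ : unitTriangle ⊆ U := fun q hq => ⟨⟨hIJ ⟨hq.2.1, by linarith [hq.1, hq.2.2]⟩,
    hIJ ⟨by linarith [hq.2.1, hq.2.2], by linarith [hq.1]⟩⟩, coneMap_mem hSb hq⟩
  have hF : ContDiffOn ℝ ∞ F U := hF₀.mono inter_subset_left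
  refine ⟨U, hU, hΔ, hF, fun q hq => hq.2, ?_⟩
  have hFat : ∀ q ∈ U, ContDiffAt ℝ ∞ F q := fun q hq => hF.contDiffAt (hU.mem_nhds hq)
  have hFd : ∀ q ∈ U, MDifferentiableAt 𝓘(ℝ, ℝ × ℝ) 𝓘(ℝ, E) F q := fun q hq =>
    ((hFat q hq).differentiableAt (by simp)).mdifferentiableAt
  have hθ : ∀ a ∈ Metric.ball c r, ContDiffAt ℝ ∞ (F := E [⋀^Fin 1]→L[ℝ] ℝ) θ a := fun a ha =>
    (contDiffOn_radialPrimitive hζ).contDiffAt (Metric.isOpen_ball.mem_nhds ha)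
  let η : ℝ × ℝ → (ℝ × ℝ) [⋀^Fin 1]→L[ℝ] ℝ := DiffForm.pullback (I := 𝓘(ℝ, ℝ × ℝ)) F θ
  have hη : ContDiffOn ℝ ∞ η U := fun q hq =>
    (DiffForm.contDiffAt_pullback_one (hθ _ hq.2) (hFat q hq)).contDiffWithinAt
  have hdη : ∀ q ∈ U, extDeriv η q =
      DiffForm.pullback (I := 𝓘(ℝ, ℝ × ℝ)) F ζ q := by
    intro q hq
    have hd' := DiffForm.d_self (E := ℝ × ℝ) (k := 1) η q
    refine hd'.symm.trans ?_
    have := DiffForm.d_pullback (I := 𝓘(ℝ, ℝ × ℝ)) (DiffForm.smoothAt_self.2 (hθ _ hq.2))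
      (hFat q hq).contMDiffAt
    refine this.trans (DiffForm.pullback_congr_form ?_)
    rw [DiffForm.d_self]
    exact extDeriv_radialPrimitive hζ hd hq.2
  have hst := integral_extDeriv_unitTriangle hU hΔ (hη.of_le (by exact_mod_cast le_top))
  have hside : ∀ t ∈ Icc (0 : ℝ) 1, (1 - t, t) ∈ unitTriangle := fun t ht =>
    ⟨sub_nonneg.2 ht.2, ht.1, by simp⟩
  -- On the two legs of the triangle the cone map is affine, which gives its derivative there.
  have hline : ∀ {q w : ℝ × ℝ} {e e' : E}, q ∈ U → HasDerivAt (fun t : ℝ => q + t • w) w 0 →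
      (∀ t : ℝ, F (q + t • w) = e + t • e') → fderiv ℝ F q w = e' := by
    intro q w e e' hq hw h
    have h1 : HasFDerivAt F (fderiv ℝ F q) (q + (0 : ℝ) • w) := by
      simpa using ((hFat q hq).differentiableAt (by simp)).hasFDerivAt
    refine (h1.comp_hasDerivAt (0 : ℝ) hw).unique ?_
    have h2 : F ∘ (fun t : ℝ => q + t • w) = fun t => e + t • e' := funext h
    rw [h2]
    simpa using ((hasDerivAt_id (0 : ℝ)).smul_const e').const_add e
  have hw : ∀ q w : ℝ × ℝ, HasDerivAt (fun t : ℝ => q + t • w) w 0 := fun q w => by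
    simpa using ((hasDerivAt_id (0 : ℝ)).smul_const w).const_add q
  have hη_apply : ∀ (q w : ℝ × ℝ), η q ![w] = radialPrimitive ζ c (F q) ![fderiv ℝ F q w] := by
    intro q w
    change DiffForm.pullback (I := 𝓘(ℝ, ℝ × ℝ)) F θ q ![w] = _
    rw [DiffForm.pullback_apply, mfderiv_eq_fderiv]
    exact congrArg (radialPrimitive ζ c (F q)) (funext fun i => by fin_cases i; rfl)
  -- The legs are mapped to radial segments, on which the radial primitive vanishes; only the
  -- hypotenuse is left.
  have hB : ∀ b ∈ Icc (0 : ℝ) 1, η (0, b) ![(0, 1)] = 0 := fun b hb => by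
    have hq : (0, b) ∈ U := hΔ ⟨le_rfl, hb.1, by simpa using hb.2⟩
    rw [hη_apply, hline (e := c + b • (S 1 - c)) (e' := S 1 - c) hq (hw _ _) fun t => by
      simp [F, coneMap]; module]
    exact radialPrimitive_radial hζ hq.2 (b := b) (by simp [F, coneMap])
  have hD : ∀ a ∈ Icc (0 : ℝ) 1, η (a, 0) ![(1, 0)] = 0 := fun a ha => by
    have hq : (a, 0) ∈ U := hΔ ⟨ha.1, le_rfl, by simpa using ha.2⟩
    rw [hη_apply, hline (e := c + a • (S 0 - c)) (e' := S 0 - c) hq (hw _ _) fun t => by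
      simp [F, coneMap]; module]
    exact radialPrimitive_radial hζ hq.2 (b := a) (by simp [F, coneMap])
  have h1 : ∫ q in unitTriangle, DiffForm.pullback (I := 𝓘(ℝ, ℝ × ℝ)) F ζ q
      ![((1 : ℝ), (0 : ℝ)), (0, 1)] =
      ∫ q in unitTriangle, extDeriv η q ![((1 : ℝ), (0 : ℝ)), (0, 1)] :=
    setIntegral_congr_fun measurableSet_unitTriangle fun q hq =>
      congrArg (fun y : (ℝ × ℝ) [⋀^Fin 2]→L[ℝ] ℝ => y ![((1 : ℝ), (0 : ℝ)), (0, 1)])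
        (hdη q (hΔ hq)).symm
  rw [h1, hst]
  have h2 : ∫ b in (0 : ℝ)..1, (η (1 - b, b) ![(0, 1)] - η (0, b) ![(0, 1)]) =
      ∫ b in (0 : ℝ)..1, η (1 - b, b) ![(0, 1)] := intervalIntegral.integral_congr fun b hb => by
    rw [uIcc_of_le zero_le_one] at hb
    simp only [hB b hb, sub_zero]
  -- The substitution `a = 1 - b` brings both remaining integrals to the same parametrization of the
  -- hypotenuse.
  have h3 : ∫ a in (0 : ℝ)..1, (η (a, 1 - a) ![(1, 0)] - η (a, 0) ![(1, 0)]) =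
      ∫ b in (0 : ℝ)..1, η (1 - b, b) ![(1, 0)] := by
    have := intervalIntegral.integral_comp_sub_left (a := 0) (b := 1)
      (fun a : ℝ => η (a, 1 - a) ![(1, 0)]) 1
    simp only [sub_zero, sub_self, sub_sub_cancel] at this
    rw [this]
    refine intervalIntegral.integral_congr fun b hb => ?_
    rw [uIcc_of_le zero_le_one] at hb
    simp only [hD b hb, sub_zero]
  have hcont : ∀ w : ℝ × ℝ, IntervalIntegrable (fun b : ℝ => η (1 - b, b) ![w]) volume 0 1 :=
    fun w => intervalIntegrable_of_Icc <|
      (ContinuousAlternatingMap.apply ℝ (ℝ × ℝ) ℝ ![w]).continuous.comp_continuousOn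
        (hη.continuousOn.comp (by fun_prop) fun t ht => hΔ (hside t ht))
  rw [h2, h3, ← intervalIntegral.integral_sub (hcont _) (hcont _)]
  refine intervalIntegral.integral_congr fun t ht => ?_
  rw [uIcc_of_le zero_le_one] at ht
  have hq := hΔ (hside t ht)
  have hh : HasDerivAt (fun b : ℝ => (1 - b, b)) ((-1 : ℝ), (1 : ℝ)) t :=
    ((hasDerivAt_id t).const_sub 1).prodMk (hasDerivAt_id t)
  -- The hypotenuse is mapped to the base path `S`. Its tangent vector `(-1, 1)` combines the two
  -- boundary terms into the pullback by `S`.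
  have hSF : S = F ∘ fun b : ℝ => (1 - b, b) := by
    funext b
    simp only [F, coneMap, Function.comp, sub_sub_cancel]
    module
  have hmf : mfderiv 𝓘(ℝ, ℝ) 𝓘(ℝ, ℝ × ℝ) (fun b : ℝ => (1 - b, b)) t (1 : ℝ) =
      ((-1 : ℝ), (1 : ℝ)) := by
    rw [mfderiv_eq_fderiv, hh.hasFDerivAt.fderiv]
    change (1 : ℝ) • ((-1 : ℝ), (1 : ℝ)) = _
    rw [one_smul]
  have hS' : DiffForm.pullback (I := 𝓘(ℝ, ℝ)) S θ t ![(1 : ℝ)] = η (1 - t, t) ![(-1, 1)] := by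
    have h := DiffForm.pullback_comp (I := 𝓘(ℝ, ℝ)) (f := fun b : ℝ => (1 - b, b)) (x := t) θ
      (hFd _ hq) hh.hasFDerivAt.differentiableAt.mdifferentiableAt
    rw [← hSF] at h
    refine (congrArg (fun y : ℝ [⋀^Fin 1]→L[ℝ] ℝ => y ![(1 : ℝ)]) h).trans ?_
    exact congrArg (η (1 - t, t)) (funext fun i => by fin_cases i; exact hmf)
  rw [hS']
  have hlin : ∀ (y : (ℝ × ℝ) [⋀^Fin 1]→L[ℝ] ℝ), y ![(0, 1)] - y ![(1, 0)] = y ![(-1, 1)] := by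
    intro y
    let e := ContinuousAlternatingMap.ofSubsingletonLIE (𝕜 := ℝ) (E := ℝ × ℝ) (F := ℝ) (0 : Fin 1)
    have h3 : ∀ w : ℝ × ℝ, e.symm y w = y ![w] := fun w =>
      congrArg y (funext fun i => by fin_cases i; rfl)
    rw [← h3, ← h3, ← h3, ← map_sub]
    simp
  exact hlin _

end Cone

/-! ### Coordinates on the standard simplices. -/

section EdgePoint

theorem stdSimplex_map_apply {k l : ℕ} (f : Fin k → Fin l) (p : stdSimplex ℝ (Fin k)) (j : Fin l) :
    stdSimplex.map f p j = ∑ i, if f i = j then p i else 0 := by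
  rw [stdSimplex.map_coe, FunOnFinite.linearMap_apply_apply, Finset.sum_filter]

/-- The point `(1 - t, t)` of the standard 1-simplex, constantly extended outside `[0, 1]`. -/
def edgePoint (t : ℝ) : stdSimplex ℝ (Fin 2) :=
  ⟨![1 - (projIcc (0 : ℝ) 1 zero_le_one t : ℝ), projIcc (0 : ℝ) 1 zero_le_one t], by
    intro i
    have := (projIcc (0 : ℝ) 1 zero_le_one t).2
    fin_cases i
    · simpa using this.2
    · exact this.1, by simp [Fin.sum_univ_two]⟩

theorem continuous_edgePoint : Continuous edgePoint := by
  refine Continuous.subtype_mk (continuous_pi fun i => ?_) _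
  have : Continuous fun t : ℝ => (projIcc (0 : ℝ) 1 zero_le_one t : ℝ) :=
    continuous_subtype_val.comp continuous_projIcc
  fin_cases i
  · exact continuous_const.sub this
  · exact this

theorem edgePoint_apply_one {t : ℝ} (ht : t ∈ Icc (0 : ℝ) 1) : edgePoint t 1 = t := by
  have : edgePoint t 1 = (projIcc (0 : ℝ) 1 zero_le_one t : ℝ) := rfl
  rw [this, projIcc_of_mem _ ht]

theorem stdSimplex_ext_one {p q : stdSimplex ℝ (Fin 2)} (h : p 1 = q 1) : p = q := by
  have hp := stdSimplex.add_eq_one p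
  have hq := stdSimplex.add_eq_one q
  refine stdSimplex.ext (funext fun i => ?_)
  fin_cases i
  · change p 0 = q 0; linarith
  · exact h

theorem stdSimplex_mem_Icc {k : ℕ} (p : stdSimplex ℝ (Fin k)) (i : Fin k) : p i ∈ Icc (0 : ℝ) 1 :=
  ⟨stdSimplex.zero_le p i, stdSimplex.le_one p i⟩

theorem edgePoint_eq (p : stdSimplex ℝ (Fin 2)) : edgePoint (p 1) = p :=
  stdSimplex_ext_one (edgePoint_apply_one (stdSimplex_mem_Icc p 1))

theorem edgePoint_zero : edgePoint 0 = stdSimplex.vertex 0 :=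
  stdSimplex_ext_one (by rw [edgePoint_apply_one (by simp)]; simp)

theorem edgePoint_one : edgePoint 1 = stdSimplex.vertex 1 :=
  stdSimplex_ext_one (by rw [edgePoint_apply_one (by simp)]; simp)

theorem stdSimplex_mem_unitTriangle (p : stdSimplex ℝ (Fin 3)) : (p 1, p 2) ∈ unitTriangle := by
  have h := stdSimplex.sum_eq_one p
  rw [Fin.sum_univ_three] at h
  refine ⟨stdSimplex.zero_le p 1, stdSimplex.zero_le p 2, ?_⟩
  have := stdSimplex.zero_le p 0
  simp only
  linarith

end EdgePoint

/-! ### Cones and straight segments in chart balls. -/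

section ChartBall

variable {E : Type} [NormedAddCommGroup E] [NormedSpace ℝ E]
  {H : Type*} [TopologicalSpace H] (I : ModelWithCorners ℝ E H) [I.Boundaryless]
  {M : Type u} [TopologicalSpace M] [ChartedSpace H M]

/-- The radius of a ball contained in the target of the preferred chart at `x`. -/
def chartRadius (x : M) : ℝ :=
  Classical.choose (Metric.isOpen_iff.1 (isOpen_extChartAt_target (I := I) x) _
    (mem_extChartAt_target x))

theorem chartRadius_pos (x : M) : 0 < chartRadius I x :=
  (Classical.choose_spec (Metric.isOpen_iff.1 (isOpen_extChartAt_target (I := I) x) _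
    (mem_extChartAt_target x))).1

theorem ball_chartRadius_subset (x : M) :
    Metric.ball (extChartAt I x x) (chartRadius I x) ⊆ (extChartAt I x).target :=
  (Classical.choose_spec (Metric.isOpen_iff.1 (isOpen_extChartAt_target (I := I) x) _
    (mem_extChartAt_target x))).2

/-- A neighbourhood of `x` which is a ball in the preferred chart at `x`. -/
def chartBall (x : M) : Set M :=
  (extChartAt I x).source ∩ extChartAt I x ⁻¹' Metric.ball (extChartAt I x x) (chartRadius I x)

theorem isOpen_chartBall (x : M) : IsOpen (chartBall I x) :=
  (continuousOn_extChartAt x).isOpen_inter_preimage (isOpen_extChartAt_source x) Metric.isOpen_ball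

theorem mem_chartBall_self (x : M) : x ∈ chartBall I x :=
  ⟨mem_extChartAt_source x, Metric.mem_ball_self (chartRadius_pos I x)⟩

/-- The singular simplex with the given expression in the preferred chart at `x`. -/
def chartSimplex {k : ℕ} (x : M) (h : C(stdSimplex ℝ (Fin (k + 1)), E))
    (hh : ∀ p, h p ∈ Metric.ball (extChartAt I x x) (chartRadius I x)) : SingularSimplex M k :=
  ⟨fun p => (extChartAt I x).symm (h p), (continuousOn_extChartAt_symm x).comp_continuous
    h.continuous fun p => ball_chartRadius_subset I x (hh p)⟩

/-- The path from `x` to `y` which is straight in the preferred chart at `x`. -/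
def chartSegment (x y : M) : SingularSimplex M 1 :=
  open Classical in
  if hy : y ∈ chartBall I x then
    chartSimplex I x
      ⟨fun p => extChartAt I x x + p 1 • (extChartAt I x y - extChartAt I x x),
        continuous_const.add (((continuous_apply 1).comp continuous_subtype_val).smul
          continuous_const)⟩
      fun p => homothety_mem_ball (stdSimplex_mem_Icc p 1) hy.2
  -- A default value: `chartSegment_apply` and its applications assume that `y` lies in the chart
  -- ball.
  else .const _ x

theorem chartSegment_apply {x y : M} (hy : y ∈ chartBall I x) (p : stdSimplex ℝ (Fin 2)) :
    chartSegment I x y p = (extChartAt I x).symm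
      (extChartAt I x x + p 1 • (extChartAt I x y - extChartAt I x x)) := by
  rw [chartSegment, dif_pos hy]
  rfl

/-- A path in a chart ball is a face of a 2-simplex whose other faces are straight segments. -/
theorem exists_chartCone {x : M} {s : SingularSimplex M 1} (hs : ∀ p, s p ∈ chartBall I x) :
    ∃ σ : SingularSimplex M 2, σ.face 0 = s ∧ σ.face 1 = chartSegment I x s.target ∧
      σ.face 2 = chartSegment I x s.source ∧
      ∀ p, σ p = (extChartAt I x).symm (coneMap (extChartAt I x x)
        (fun t => extChartAt I x (s (edgePoint t))) (p 1, p 2)) := by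
  set S : ℝ → E := fun t => extChartAt I x (s (edgePoint t)) with hS
  have hSc : Continuous S := (continuousOn_extChartAt x).comp_continuous
    (s.continuous.comp continuous_edgePoint) fun t => (hs _).1
  have hcoord : ∀ i : Fin 3, Continuous fun p : stdSimplex ℝ (Fin 3) => p i := fun i =>
    (continuous_apply i).comp continuous_subtype_val
  refine ⟨chartSimplex I x ⟨fun p => coneMap (extChartAt I x x) S (p 1, p 2), ?_⟩ fun p =>
    coneMap_mem (fun t _ => (hs _).2) (stdSimplex_mem_unitTriangle p), ?_, ?_, ?_, fun p => rfl⟩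
  · exact (continuous_const.add ((hcoord 1).smul ((hSc.comp (hcoord 2)).sub continuous_const))).add
      ((hcoord 2).smul ((hSc.comp (continuous_const.sub (hcoord 1))).sub continuous_const))
  -- Face 0 is opposite the apex, where the cone map is `S`. Faces 1 and 2 are the legs, on which
  -- one coordinate is zero and the path enters only through its final and its initial point
  -- respectively.
  · ext p
    change (extChartAt I x).symm (coneMap _ S (stdSimplex.map (Fin.succAbove 0) p 1,
      stdSimplex.map (Fin.succAbove 0) p 2)) = _
    have h1 : stdSimplex.map (Fin.succAbove (0 : Fin 3)) p 1 = p 0 := by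
      rw [stdSimplex_map_apply]; simp [Fin.sum_univ_two]
    have h2 : stdSimplex.map (Fin.succAbove (0 : Fin 3)) p 2 = p 1 := by
      rw [stdSimplex_map_apply]; simp [Fin.sum_univ_two]
    have h3 : p 0 = 1 - p 1 := by linarith [stdSimplex.add_eq_one p]
    have h4 : coneMap (extChartAt I x x) S (1 - p 1, p 1) = S (p 1) := by
      simp only [coneMap, sub_sub_cancel]; module
    rw [h1, h2, h3, h4]
    exact (congrArg (fun q => (extChartAt I x).symm (extChartAt I x (s q))) (edgePoint_eq p)).trans
      ((extChartAt I x).left_inv (hs p).1)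
  · ext p
    refine Eq.trans ?_ (chartSegment_apply I (y := s.target) (hs _) p).symm
    change (extChartAt I x).symm (coneMap _ S (stdSimplex.map (Fin.succAbove 1) p 1,
      stdSimplex.map (Fin.succAbove 1) p 2)) = _
    have h1 : stdSimplex.map (Fin.succAbove (1 : Fin 3)) p 1 = 0 := by
      rw [stdSimplex_map_apply]; simp [Fin.sum_univ_two, Fin.succAbove]
    have h2 : stdSimplex.map (Fin.succAbove (1 : Fin 3)) p 2 = p 1 := by
      rw [stdSimplex_map_apply]; simp [Fin.sum_univ_two, Fin.succAbove]
    rw [h1, h2]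
    simp [coneMap, hS, edgePoint_one, SingularSimplex.target]
  · ext p
    refine Eq.trans ?_ (chartSegment_apply I (y := s.source) (hs _) p).symm
    change (extChartAt I x).symm (coneMap _ S (stdSimplex.map (Fin.succAbove 2) p 1,
      stdSimplex.map (Fin.succAbove 2) p 2)) = _
    have h1 : stdSimplex.map (Fin.succAbove (2 : Fin 3)) p 1 = p 1 := by
      rw [stdSimplex_map_apply]; simp [Fin.sum_univ_two, Fin.succAbove]
    have h2 : stdSimplex.map (Fin.succAbove (2 : Fin 3)) p 2 = 0 := by
      rw [stdSimplex_map_apply]; simp [Fin.sum_univ_two, Fin.succAbove]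
    rw [h1, h2]
    simp [coneMap, hS, edgePoint_zero, SingularSimplex.source]

theorem singularCoboundary_one_apply {A : Type*} [AddCommGroup A] (a : SingularCochain M A 1)
    (σ : SingularSimplex M 2) :
    singularCoboundary M A 1 a σ = a (σ.face 0) - a (σ.face 1) + a (σ.face 2) := by
  simp [singularCoboundary, Fin.sum_univ_three, sub_eq_add_neg]

/-- A 1-cocycle is determined on paths in a chart ball by its values on straight segments. -/
theorem cocycle_apply_chartBall {A : Type*} [AddCommGroup A] {a : SingularCochain M A 1}
    (ha : singularCoboundary M A 1 a = 0) {x : M} {s : SingularSimplex M 1}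
    (hs : ∀ p, s p ∈ chartBall I x) :
    a s = a (chartSegment I x s.target) - a (chartSegment I x s.source) := by
  obtain ⟨σ, h0, h1, h2, -⟩ := exists_chartCone I hs
  have := singularCoboundary_one_apply a σ
  rw [ha, h0, h1, h2] at this
  have h : 0 = a s - a (chartSegment I x s.target) + a (chartSegment I x s.source) := this
  rw [eq_comm, sub_add_eq_add_sub, sub_eq_zero] at h
  rw [← h, add_sub_cancel_right]

end ChartBall

/-! ### Line integrals of 1-forms. -/

section LineIntegral

variable {E : Type*} [NormedAddCommGroup E] [NormedSpace ℝ E]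
  {H : Type*} [TopologicalSpace H] {I : ModelWithCorners ℝ E H} [I.Boundaryless]
  {M : Type*} [TopologicalSpace M] [ChartedSpace H M] [IsManifold I ∞ M]

namespace DiffForm

/-- The integral of a 1-form along a path parametrized by `[0, 1]`. -/
def lineIntegral (η : DiffForm I M 1) (S : ℝ → M) : ℝ :=
  ∫ t in (0 : ℝ)..1, pullback (I := 𝓘(ℝ, ℝ)) S η t ![(1 : ℝ)]

theorem intervalIntegrable_pullback {η : DiffForm I M 1} {S : ℝ → M}
    (hη : ∀ t ∈ Icc (0 : ℝ) 1, η.SmoothAt (S t))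
    (hS : ∀ t ∈ Icc (0 : ℝ) 1, ContMDiffAt 𝓘(ℝ, ℝ) I ∞ S t) :
    IntervalIntegrable (fun t => pullback (I := 𝓘(ℝ, ℝ)) S η t ![(1 : ℝ)]) volume 0 1 := by
  refine intervalIntegrable_of_Icc fun t ht => ContinuousAt.continuousWithinAt ?_
  have h := (smoothAt_self.1 ((hη t ht).pullback (hS t ht))).continuousAt
  exact (ContinuousAlternatingMap.apply ℝ ℝ ℝ ![(1 : ℝ)]).continuous.continuousAt.comp h

theorem lineIntegral_sub {η η' : DiffForm I M 1} {S : ℝ → M}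
    (hη : ∀ t ∈ Icc (0 : ℝ) 1, η.SmoothAt (S t)) (hη' : ∀ t ∈ Icc (0 : ℝ) 1, η'.SmoothAt (S t))
    (hS : ∀ t ∈ Icc (0 : ℝ) 1, ContMDiffAt 𝓘(ℝ, ℝ) I ∞ S t) :
    lineIntegral (η - η') S = lineIntegral η S - lineIntegral η' S := by
  rw [lineIntegral, lineIntegral, lineIntegral, ← intervalIntegral.integral_sub
    (intervalIntegrable_pullback hη hS) (intervalIntegrable_pullback hη' hS)]
  refine intervalIntegral.integral_congr fun t _ => ?_
  exact congrArg (fun y : ℝ [⋀^Fin 1]→L[ℝ] ℝ => y ![(1 : ℝ)]) (pullback_sub S η η' t)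

/-- The fundamental theorem of calculus for `R ∘ S`. The primitive is needed only along the path. -/
theorem lineIntegral_eq_of_primitive {η : DiffForm I M 1} {S : ℝ → M} {R : M → ℝ}
    (hS : ∀ t ∈ Icc (0 : ℝ) 1, ContMDiffAt 𝓘(ℝ, ℝ) I ∞ S t)
    (hR : ∀ t ∈ Icc (0 : ℝ) 1, ContMDiffAt I 𝓘(ℝ, ℝ) ∞ R (S t))
    (h : ∀ t ∈ Icc (0 : ℝ) 1, η (S t) = pullback (I := I) R lineForm (S t)) :
    lineIntegral η S = R (S 1) - R (S 0) := by
  have hRS : ∀ t ∈ Icc (0 : ℝ) 1, ContMDiffAt 𝓘(ℝ, ℝ) 𝓘(ℝ, ℝ) ∞ (R ∘ S) t := fun t ht =>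
    (hR t ht).comp t (hS t ht)
  have hd : ∀ t ∈ Icc (0 : ℝ) 1, HasDerivAt (R ∘ S)
      (pullback (I := 𝓘(ℝ, ℝ)) S η t ![(1 : ℝ)]) t := fun t ht => by
    have h1 : pullback (I := 𝓘(ℝ, ℝ)) S η t = pullback (I := 𝓘(ℝ, ℝ)) (R ∘ S) lineForm t := by
      rw [pullback_comp lineForm ((hR t ht).mdifferentiableAt (by simp))
        ((hS t ht).mdifferentiableAt (by simp))]
      exact pullback_congr_form (h t ht)
    have h2 : pullback (I := 𝓘(ℝ, ℝ)) (R ∘ S) lineForm t ![(1 : ℝ)] = deriv (R ∘ S) t := by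
      change mfderiv 𝓘(ℝ, ℝ) 𝓘(ℝ, ℝ) (R ∘ S) t (1 : ℝ) = _
      rw [mfderiv_eq_fderiv]
      exact fderiv_apply_one_eq_deriv
    have h3 := (congrArg (fun y : ℝ [⋀^Fin 1]→L[ℝ] ℝ => y ![(1 : ℝ)]) h1).trans h2
    refine HasDerivAt.congr_deriv ?_ h3.symm
    exact ((hRS t ht).contDiffAt.differentiableAt (by simp)).hasDerivAt
  refine intervalIntegral.integral_eq_sub_of_hasDerivAt (f := R ∘ S) (fun t ht => ?_) ?_
  · rw [uIcc_of_le zero_le_one] at ht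
    exact hd t ht
  · have hc : ContinuousOn (deriv (R ∘ S)) (Icc 0 1) := fun t ht => by
      have := ((hRS t ht).contDiffAt.continuousAt_fderiv (by simp)).clm_apply
        (continuousAt_const (y := (1 : ℝ)))
      exact this.continuousWithinAt
    exact intervalIntegrable_of_Icc (hc.congr fun t ht => (hd t ht).deriv.symm)

end DiffForm

end LineIntegral

/-! ### Potentials modulo `ℤ` of an integral form. -/

section Potentials

variable {E : Type} [NormedAddCommGroup E] [NormedSpace ℝ E]
  {H : Type*} [TopologicalSpace H] {I : ModelWithCorners ℝ E H} [I.Boundaryless]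
  {M : Type u} [TopologicalSpace M] [ChartedSpace H M] [IsManifold I ∞ M]

/-- The radial primitive of a 2-form on the chart ball at `x`. -/
def DiffForm.chartPrimitive (Ω : DiffForm I M 2) (x : M) : DiffForm I M 1 :=
  DiffForm.pullback (I := I) (I' := 𝓘(ℝ, E)) (extChartAt I x)
    (radialPrimitive (Ω.inChart x) (extChartAt I x x))

theorem contMDiffAt_extChartAt_of_mem_chartBall {x y : M} (hy : y ∈ chartBall I x) :
    ContMDiffAt I 𝓘(ℝ, E) ∞ (extChartAt I x) y :=
  contMDiffAt_extChartAt' (by simpa using hy.1)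

theorem contMDiffAt_extChartAt_symm_of_mem_ball {x : M} {a : E}
    (ha : a ∈ Metric.ball (extChartAt I x x) (chartRadius I x)) :
    ContMDiffAt 𝓘(ℝ, E) I ∞ (extChartAt I x).symm a :=
  (contMDiffOn_extChartAt_symm x).contMDiffAt ((isOpen_extChartAt_target x).mem_nhds
    (ball_chartRadius_subset I x ha))

theorem DiffForm.Smooth.contDiffOn_inChart {k : ℕ} {Ω : DiffForm I M k} (hΩ : Ω.Smooth) (x : M) :
    ContDiffOn ℝ ∞ (F := E [⋀^Fin k]→L[ℝ] ℝ) (Ω.inChart x)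
      (Metric.ball (extChartAt I x x) (chartRadius I x)) :=
  (hΩ x).mono fun _ ha => ⟨ball_chartRadius_subset I x ha, mem_univ _⟩

theorem DiffForm.extDeriv_inChart_eq_zero {Ω : DiffForm I M 2} (hΩ : Ω.Smooth) (hd : Ω.d = 0)
    (x : M) {a : E} (ha : a ∈ Metric.ball (extChartAt I x x) (chartRadius I x)) :
    extDeriv (E := E) (n := 2) (Ω.inChart x) a = 0 := by
  refine (DiffForm.d_self (E := E) (k := 2) (Ω.inChart x) a).symm.trans ?_
  have := DiffForm.d_pullback (hΩ.smoothAt isOpen_univ (mem_univ ((extChartAt I x).symm a)))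
    (contMDiffAt_extChartAt_symm_of_mem_ball ha)
  refine this.trans ?_
  rw [hd]
  rfl

theorem DiffForm.smoothAt_chartPrimitive [ProperSpace E] {Ω : DiffForm I M 2} (hΩ : Ω.Smooth)
    {x y : M} (hy : y ∈ chartBall I x) : (Ω.chartPrimitive x).SmoothAt y :=
  SmoothAt.pullback (smoothAt_self.2 ((contDiffOn_radialPrimitive
    (hΩ.contDiffOn_inChart x)).contDiffAt (Metric.isOpen_ball.mem_nhds hy.2)))
    (contMDiffAt_extChartAt_of_mem_chartBall hy)

theorem DiffForm.d_chartPrimitive [ProperSpace E] {Ω : DiffForm I M 2} (hΩ : Ω.Smooth)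
    (hd : Ω.d = 0) {x y : M} (hy : y ∈ chartBall I x) : (Ω.chartPrimitive x).d y = Ω y := by
  have hφ := contMDiffAt_extChartAt_of_mem_chartBall hy
  have hψ := contMDiffAt_extChartAt_symm_of_mem_ball hy.2
  have h1 := d_pullback (smoothAt_self.2 ((contDiffOn_radialPrimitive
    (hΩ.contDiffOn_inChart x)).contDiffAt (Metric.isOpen_ball.mem_nhds hy.2))) hφ
  have h2 : d (I := 𝓘(ℝ, E)) (M := E) (k := 1)
      (radialPrimitive (Ω.inChart x) (extChartAt I x x)) (extChartAt I x y) = pullback (I := 𝓘(ℝ, E)) (extChartAt I x).symm Ω (extChartAt I x y) := by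
    refine (d_self (E := E) (k := 1) _ _).trans ?_
    exact extDeriv_radialPrimitive (hΩ.contDiffOn_inChart x)
      (fun a ha => extDeriv_inChart_eq_zero hΩ hd x ha) hy.2
  refine (h1.trans (pullback_congr_form h2)).trans ?_
  rw [← pullback_comp Ω (hψ.mdifferentiableAt (by simp)) (hφ.mdifferentiableAt (by simp))]
  have : (extChartAt I x).symm ∘ extChartAt I x =ᶠ[𝓝 y] id := by
    filter_upwards [(isOpen_extChartAt_source x).mem_nhds hy.1] with z hz
    exact (extChartAt I x).left_inv hz
  rw [pullback_congr Ω this, pullback_id]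

/-- `integral_coneMap` transported by the chart. It links the de Rham condition, stated on smooth
2-simplices, to line integrals of the chart primitives. -/
theorem integral_chartCone [ProperSpace E] {Ω : DiffForm I M 2} (hΩ : Ω.Smooth) (hd : Ω.d = 0)
    {x : M} {S : ℝ → M} {J : Set ℝ} (hJ : IsOpen J) (hIJ : Icc (0 : ℝ) 1 ⊆ J)
    (hS : ContMDiffOn 𝓘(ℝ, ℝ) I ∞ S J) (hSb : ∀ t ∈ Icc (0 : ℝ) 1, S t ∈ chartBall I x)
    {σ : SingularSimplex M 2} (hσ : ∀ p, σ p = (extChartAt I x).symm (coneMap (extChartAt I x x)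
      (fun t => extChartAt I x (S (edgePoint t 1))) (p 1, p 2))) :
    ∃ f, IsSmoothParam I σ f ∧
      integralOverTriangle Ω f = (Ω.chartPrimitive x).lineIntegral S := by
  let J' := J ∩ S ⁻¹' chartBall I x
  have hJ' : IsOpen J' := hS.continuousOn.isOpen_inter_preimage hJ (isOpen_chartBall I x)
  have hSat : ∀ t ∈ J', ContMDiffAt 𝓘(ℝ, ℝ) I ∞ S t := fun t ht =>
    hS.contMDiffAt (hJ.mem_nhds ht.1)
  have hIJ' : ∀ t ∈ Icc (0 : ℝ) 1, t ∈ J' := fun t ht => ⟨hIJ ht, hSb t ht⟩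
  obtain ⟨U, hU, hΔ, hF, hFb, hint⟩ := integral_coneMap (S := extChartAt I x ∘ S)
    (hΩ.contDiffOn_inChart x) (fun a ha => DiffForm.extDeriv_inChart_eq_zero hΩ hd x ha) hJ' hIJ'
    (fun t ht => ((contMDiffAt_extChartAt_of_mem_chartBall ht.2).comp t
      (hSat t ht)).contDiffAt.contDiffWithinAt) fun t ht => (hSb t ht).2
  have hFat : ∀ q ∈ U, ContMDiffAt 𝓘(ℝ, ℝ × ℝ) 𝓘(ℝ, E) ∞
      (coneMap (extChartAt I x x) (extChartAt I x ∘ S)) q :=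
    fun q hq => (hF.contDiffAt (hU.mem_nhds hq)).contMDiffAt
  refine ⟨(extChartAt I x).symm ∘ coneMap (extChartAt I x x) (extChartAt I x ∘ S),
    ⟨⟨U, hU, hΔ, fun q hq => ?_⟩, fun p => ?_⟩, ?_⟩
  · exact ((contMDiffAt_extChartAt_symm_of_mem_ball (hFb hq)).comp q
      (hFat q hq)).contMDiffWithinAt
  · rw [hσ]
    have h1 : 1 - p 1 ∈ Icc (0 : ℝ) 1 := by
      have := stdSimplex_mem_Icc p 1
      exact ⟨by linarith [this.2], by linarith [this.1]⟩
    simp only [coneMap, Function.comp, edgePoint_apply_one (stdSimplex_mem_Icc p 2),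
      edgePoint_apply_one h1]
  · rw [integralOverTriangle, DiffForm.lineIntegral]
    refine (setIntegral_congr_fun measurableSet_unitTriangle fun q hq => ?_).trans
      (hint.trans (intervalIntegral.integral_congr fun t ht => ?_))
    · exact congrArg (fun y : (ℝ × ℝ) [⋀^Fin 2]→L[ℝ] ℝ => y ![((1 : ℝ), (0 : ℝ)), (0, 1)])
        (DiffForm.pullback_comp (I := 𝓘(ℝ, ℝ × ℝ)) Ω ((contMDiffAt_extChartAt_symm_of_mem_ball
          (hFb (hΔ hq))).mdifferentiableAt (by simp)) ((hFat q (hΔ hq)).mdifferentiableAt (by simp)))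
    · rw [uIcc_of_le zero_le_one] at ht
      exact congrArg (fun y : ℝ [⋀^Fin 1]→L[ℝ] ℝ => y ![(1 : ℝ)])
        (DiffForm.pullback_comp (I := 𝓘(ℝ, ℝ)) (I'' := 𝓘(ℝ, E)) (x := t)
          (radialPrimitive (Ω.inChart x) (extChartAt I x x))
          ((contMDiffAt_extChartAt_of_mem_chartBall (hSb t ht)).mdifferentiableAt (by simp))
          ((hSat t (hIJ' t ht)).mdifferentiableAt (by simp)))

/-- The potentials of an integral form: functions `f x` with values in `ℝ/ℤ` such that `f x - f y`
is locally a primitive of the difference of the radial primitives at `x` and `y`. -/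
theorem exists_integral_potentials [ProperSpace E] {Ω : DiffForm I M 2} (hΩ : Ω.Smooth)
    (hd : Ω.d = 0) (hint : IsIntegralForm Ω) :
    ∃ f : M → M → AddCircle (1 : ℝ), ∀ i j, ∀ x ∈ chartBall I i ∩ chartBall I j,
      ∃ R : M → ℝ, ∀ᶠ y in 𝓝 x, ContMDiffAt I 𝓘(ℝ, ℝ) ∞ R y ∧
        Ω.chartPrimitive i y - Ω.chartPrimitive j y = DiffForm.pullback (I := I) R lineForm y ∧
        f i y - f j y = f i x - f j x + ((R y - R x : ℝ) : AddCircle (1 : ℝ)) := by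
  obtain ⟨c, -, b, hb⟩ := hint
  -- Motivation: for a short path `s` from `x` to `y` in the ball at `i`, the integrality condition
  -- on the cone over `s` says that, modulo `ℤ`, the integral of the chart primitive along `s` is `b
  -- s` plus the increment of this function. The term `b s` does not depend on `i` and cancels in
  -- differences.
  refine ⟨fun i y => ((-b (chartSegment I i y) : ℝ) : AddCircle (1 : ℝ)), fun i j x hx => ?_⟩
  have hnhds : ∀ᶠ y in 𝓝 x, y ∈ chartBall I i ∩ chartBall I j :=
    ((isOpen_chartBall I i).inter (isOpen_chartBall I j)).mem_nhds hx
  obtain ⟨R, hR⟩ := exists_local_primitive_of_closed (x := x)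
    (η := Ω.chartPrimitive i - Ω.chartPrimitive j)
    (hnhds.mono fun y hy => (DiffForm.smoothAt_chartPrimitive hΩ hy.1).sub
      (DiffForm.smoothAt_chartPrimitive hΩ hy.2))
    (hnhds.mono fun y hy => by
      rw [DiffForm.d_sub (DiffForm.smoothAt_chartPrimitive hΩ hy.1)
        (DiffForm.smoothAt_chartPrimitive hΩ hy.2), DiffForm.d_chartPrimitive hΩ hd hy.1,
        DiffForm.d_chartPrimitive hΩ hd hy.2, sub_self])
  refine ⟨R, ?_⟩
  let φ := extChartAt I x
  have hc : Filter.Tendsto φ.symm (𝓝 (φ x)) (𝓝 x) := by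
    have := (continuousAt_extChartAt_symm (I := I) x).tendsto
    rwa [(extChartAt I x).left_inv (mem_extChartAt_source x)] at this
  obtain ⟨r, hr, hball⟩ := Metric.eventually_nhds_iff_ball.1 ((hc.eventually (hnhds.and hR)).and
    ((isOpen_extChartAt_target (I := I) x).mem_nhds (mem_extChartAt_target x)))
  have hφ : ∀ᶠ y in 𝓝 x, φ y ∈ Metric.ball (φ x) r :=
    (continuousAt_extChartAt x).preimage_mem_nhds (Metric.ball_mem_nhds _ hr)
  filter_upwards [hφ, (extChartAt_source_mem_nhds (I := I) x), hR] with y hy hys hRy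
  refine ⟨hRy.1, hRy.2, ?_⟩
  -- A smooth test path from `x` to `y`, straight in the chart at `x`, which stays in both chart
  -- balls.
  let ℓ : ℝ → E := fun t => φ x + t • (φ y - φ x)
  have hℓ : ContDiff ℝ ∞ ℓ := by fun_prop
  let S : ℝ → M := φ.symm ∘ ℓ
  let J := ℓ ⁻¹' Metric.ball (φ x) r
  have hJ : IsOpen J := Metric.isOpen_ball.preimage hℓ.continuous
  have hIJ : Icc (0 : ℝ) 1 ⊆ J := fun t ht => homothety_mem_ball ht hy
  have hSat : ∀ t ∈ J, ContMDiffAt 𝓘(ℝ, ℝ) I ∞ S t := fun t ht =>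
    ((contMDiffOn_extChartAt_symm x).contMDiffAt ((isOpen_extChartAt_target x).mem_nhds
      (hball _ ht).2)).comp t hℓ.contDiffAt.contMDiffAt
  have hS : ContMDiffOn 𝓘(ℝ, ℝ) I ∞ S J := fun t ht => (hSat t ht).contMDiffWithinAt
  have hS0 : S 0 = x := by
    simp only [S, ℓ, Function.comp, zero_smul, add_zero]
    exact φ.left_inv (mem_extChartAt_source x)
  have hS1 : S 1 = y := by
    simp only [S, ℓ, Function.comp, one_smul, add_sub_cancel]
    exact φ.left_inv hys
  let s : SingularSimplex M 1 := ⟨fun p => S (p 1), hS.continuousOn.comp_continuous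
    ((continuous_apply 1).comp continuous_subtype_val) fun p => hIJ (stdSimplex_mem_Icc p 1)⟩
  have h_source : s.source = x := by
    change S ((stdSimplex.vertex 0 : stdSimplex ℝ (Fin 2)) 1) = x
    simpa using hS0
  have h_target : s.target = y := by
    change S ((stdSimplex.vertex 1 : stdSimplex ℝ (Fin 2)) 1) = y
    simpa using hS1
  -- The integral over the cone is `c σ` plus `δb` on its three faces, and `c σ` is an integer.
  have key : ∀ k, (∀ t ∈ J, S t ∈ chartBall I k) →
      (((Ω.chartPrimitive k).lineIntegral S : ℝ) : AddCircle (1 : ℝ)) =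
      ((b s : ℝ) : AddCircle (1 : ℝ)) - ((b (chartSegment I k y) : ℝ) : AddCircle (1 : ℝ)) +
        ((b (chartSegment I k x) : ℝ) : AddCircle (1 : ℝ)) := by
    intro k hk
    obtain ⟨σ, h0, h1, h2, hσ⟩ := exists_chartCone I (x := k) (s := s)
      fun p => hk _ (hIJ (stdSimplex_mem_Icc p 1))
    obtain ⟨f, hf, hfint⟩ := integral_chartCone hΩ hd hJ hIJ hS (fun t ht => hk t (hIJ ht)) hσ
    rw [← hfint, hb σ f hf, singularCoboundary_one_apply, h0, h1, h2, h_source, h_target]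
    have hz : (((c σ : ℤ) : ℝ) : AddCircle (1 : ℝ)) = 0 :=
      (AddCircle.coe_eq_zero_iff (1 : ℝ)).2 ⟨c σ, by simp⟩
    rw [AddCircle.coe_add, AddCircle.coe_add, AddCircle.coe_sub, hz, zero_add]
  have hSI : ∀ t ∈ Icc (0 : ℝ) 1, ContMDiffAt 𝓘(ℝ, ℝ) I ∞ S t := fun t ht => hSat t (hIJ ht)
  have hsub := DiffForm.lineIntegral_sub (S := S)
    (fun t ht => DiffForm.smoothAt_chartPrimitive hΩ (hball _ (hIJ ht)).1.1.1)
    (fun t ht => DiffForm.smoothAt_chartPrimitive hΩ (hball _ (hIJ ht)).1.1.2) hSI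
  rw [DiffForm.lineIntegral_eq_of_primitive (S := S) hSI (fun t ht => (hball _ (hIJ ht)).1.2.1)
    (fun t ht => (hball _ (hIJ ht)).1.2.2), hS0, hS1] at hsub
  rw [hsub, AddCircle.coe_sub, key i fun t ht => (hball _ ht).1.1.1,
    key j fun t ht => (hball _ ht).1.1.2]
  simp only [AddCircle.coe_neg]
  abel

end Potentials

/-! ### Product rule for pullbacks of 1-forms. -/

section Diagonal

variable {E : Type*} [NormedAddCommGroup E] [NormedSpace ℝ E]
  {H : Type*} [TopologicalSpace H] {I : ModelWithCorners ℝ E H}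
  {M : Type*} [TopologicalSpace M] [ChartedSpace H M]
  {E' : Type*} [NormedAddCommGroup E'] [NormedSpace ℝ E']
  {H' : Type*} [TopologicalSpace H'] {I' : ModelWithCorners ℝ E' H'}
  {M' : Type*} [TopologicalSpace M'] [ChartedSpace H' M']

theorem ContMDiffAt.mul_complex {f g : M → ℂ} {x : M} (hf : ContMDiffAt I 𝓘(ℝ, ℂ) ∞ f x)
    (hg : ContMDiffAt I 𝓘(ℝ, ℂ) ∞ g x) : ContMDiffAt I 𝓘(ℝ, ℂ) ∞ (fun y => f y * g y) x :=
  ContMDiffAt.comp x (g := fun q : ℂ × ℂ => q.1 * q.2) (f := fun y => (f y, g y))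
    contDiff_mul.contDiffAt.contMDiffAt (hf.prodMk_space hg)

theorem DiffForm.map_add_one (η : DiffForm I M 1) (x : M) (v w : TangentSpace I x) :
    η x (fun _ => v + w) = η x (fun _ => v) + η x (fun _ => w) := by
  let e := ContinuousAlternatingMap.ofSubsingletonLIE (𝕜 := ℝ) (E := E) (F := ℝ) (0 : Fin 1)
  exact map_add (e.symm (η x)) v w

/-- The differential of `y ↦ Ψ (f y, y)` is the sum of the two partial differentials. With `Ψ` the
fibrewise multiplication this yields the Leibniz rule for connections. -/
theorem DiffForm.pullback_diag {Ψ : ℂ × M → M'} {f : M → ℂ} {x : M} (η : DiffForm I' M' 1)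
    (hΨ : MDifferentiableAt (𝓘(ℝ, ℂ).prod I) I' Ψ (f x, x))
    (hf : MDifferentiableAt I 𝓘(ℝ, ℂ) f x) :
    pullback (I := I) (fun y => Ψ (f y, y)) η x =
      pullback (I := I) f (pullback (I := 𝓘(ℝ, ℂ)) (fun z => Ψ (z, x)) η) x +
        pullback (I := I) (fun y => Ψ (f x, y)) η x := by
  refine one_ext (η := pullback (I := I) (fun y => Ψ (f y, y)) η)
    (η' := pullback (I := I) f (pullback (I := 𝓘(ℝ, ℂ)) (fun z => Ψ (z, x)) η) +
      pullback (I := I) (fun y => Ψ (f x, y)) η) fun v => ?_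
  have h1 : mfderiv I I' (fun y => Ψ (f y, y)) x v =
      mfderiv 𝓘(ℝ, ℂ) I' (fun z => Ψ (z, x)) (f x) (mfderiv I 𝓘(ℝ, ℂ) f x v) +
        mfderiv I I' (fun y => Ψ (f x, y)) x v := by
    have hc := mfderiv_comp (f := fun y => (f y, id y)) x hΨ (hf.prodMk mdifferentiableAt_id)
    rw [hf.mfderiv_prod mdifferentiableAt_id, mfderiv_id] at hc
    exact (congrArg (fun L : E →L[ℝ] E' => L v) hc).trans (mfderiv_prod_eq_add_apply hΨ)
  change η (Ψ (f x, x)) (fun _ => mfderiv I I' (fun y => Ψ (f y, y)) x v) =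
    η (Ψ (f x, x)) _ + η (Ψ (f x, x)) _
  rw [h1]
  exact map_add_one η _ _ _

end Diagonal

/-! ### Coordinates on line bundles and the Leibniz rule for connection forms. -/

namespace LineBundle

variable {m : ℕ} {M : Type u} [TopologicalSpace M] [ChartedSpace (EuclideanSpace ℝ (Fin m)) M]
  [IsManifold (𝓡 m) ∞ M] (E : LineBundle.{u, w} m M)
  {F : Type*} [NormedAddCommGroup F] [NormedSpace ℝ F]
  {H : Type*} [TopologicalSpace H] {J : ModelWithCorners ℝ F H}
  {N : Type*} [TopologicalSpace N] [ChartedSpace H N]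

/-- The fibre coordinate of a vector in the trivialization with index `i`. -/
def fibreCoord (i : E.ι) (p : E.Total) : ℂ := E.g (E.indexAt p.1) i p.1 * E.coord p

/-- The vector with base point `x` and coordinate `z` in the trivialization with index `i`. -/
def point (i : E.ι) (x : M) (z : ℂ) : E.Total := ⟨x, (E.g i (E.indexAt x) x * z : ℂ)⟩

variable {E}

theorem g_mul_g {i j : E.ι} {x : M} (hi : x ∈ E.baseSet i) (hj : x ∈ E.baseSet j) :
    E.g j i x * E.g i j x = 1 := by
  rw [E.g_comp i j i x ⟨⟨hi, hj⟩, hi⟩, E.g_self i x hi]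

theorem g_ne_zero {i j : E.ι} {x : M} (hi : x ∈ E.baseSet i) (hj : x ∈ E.baseSet j) :
    E.g i j x ≠ 0 := right_ne_zero_of_mul_eq_one (g_mul_g hi hj)

theorem contMDiffAt_g {i j : E.ι} {x : M} (hi : x ∈ E.baseSet i) (hj : x ∈ E.baseSet j) :
    ContMDiffAt (𝓡 m) 𝓘(ℝ, ℂ) ∞ (E.g i j) x :=
  (E.contMDiffOn_g i j).contMDiffAt
    (((E.isOpen_baseSet i).inter (E.isOpen_baseSet j)).mem_nhds ⟨hi, hj⟩)

theorem fibreCoord_indexAt (p : E.Total) : E.fibreCoord (E.indexAt p.1) p = E.coord p := by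
  rw [fibreCoord, E.g_self _ _ (E.mem_baseSet_at p.1), one_mul]

theorem fibreCoord_change {i j : E.ι} {p : E.Total} (hi : p.1 ∈ E.baseSet i)
    (hj : p.1 ∈ E.baseSet j) : E.fibreCoord j p = E.g i j p.1 * E.fibreCoord i p := by
  rw [fibreCoord, fibreCoord, ← mul_assoc,
    E.g_comp _ i j p.1 ⟨⟨E.mem_baseSet_at _, hi⟩, hj⟩]

theorem fibreCoord_ne_zero {i : E.ι} {p : E.Total} (hi : p.1 ∈ E.baseSet i) :
    E.fibreCoord i p ≠ 0 ↔ p ∈ E.nonzero := by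
  rw [fibreCoord, mul_ne_zero_iff]
  exact ⟨fun h => h.2, fun h => ⟨g_ne_zero (E.mem_baseSet_at _) hi, h⟩⟩

theorem fibreCoord_point {i : E.ι} {x : M} (hi : x ∈ E.baseSet i) (z : ℂ) :
    E.fibreCoord i (E.point i x z) = z := by
  change E.g (E.indexAt x) i x * (E.g i (E.indexAt x) x * z) = z
  rw [← mul_assoc, g_mul_g hi (E.mem_baseSet_at x), one_mul]

theorem point_fibreCoord {i : E.ι} {p : E.Total} (hi : p.1 ∈ E.baseSet i) :
    E.point i p.1 (E.fibreCoord i p) = p := by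
  obtain ⟨x, c⟩ := p
  let z : ℂ := c
  have : E.g i (E.indexAt x) x * (E.g (E.indexAt x) i x * z) = z := by
    rw [← mul_assoc, g_mul_g (E.mem_baseSet_at x) hi, one_mul]
  exact congrArg (TotalSpace.mk x) this

theorem fibreCoord_smul (i : E.ι) (z : ℂ) (p : E.Total) :
    E.fibreCoord i (E.smul z p) = z * E.fibreCoord i p :=
  mul_left_comm _ _ _

theorem smul_mem_nonzero {z : ℂ} (hz : z ≠ 0) {p : E.Total} (hp : p ∈ E.nonzero) :
    E.smul z p ∈ E.nonzero := mul_ne_zero hz hp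

theorem smul_smul (z z' : ℂ) (p : E.Total) : E.smul z (E.smul z' p) = E.smul (z * z') p :=
  congrArg (TotalSpace.mk p.1) (mul_assoc z z' (E.coord p)).symm

/-- Smoothness of maps to the total space, in coordinates. -/
theorem contMDiffAt_total {f : N → E.Total} {x : N} {i : E.ι} (hi : (f x).1 ∈ E.baseSet i) :
    ContMDiffAt J (totalModel m) ∞ f x ↔ ContMDiffAt J (𝓡 m) ∞ (fun y => (f y).1) x ∧
      ContMDiffAt J 𝓘(ℝ, ℂ) ∞ (fun y => E.fibreCoord i (f y)) x := by
  refine contMDiffAt_totalSpace.trans (and_congr_right fun h => ?_)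
  have h0 : ∀ y, (trivializationAt ℂ E.core.Fiber (f x).proj (f y)).2 =
    E.fibreCoord (E.indexAt (f x).1) (f y) := fun y => rfl
  simp only [h0]
  have key : ∀ j k : E.ι, (f x).1 ∈ E.baseSet j → (f x).1 ∈ E.baseSet k →
      ContMDiffAt J 𝓘(ℝ, ℂ) ∞ (fun y => E.fibreCoord j (f y)) x →
      ContMDiffAt J 𝓘(ℝ, ℂ) ∞ (fun y => E.fibreCoord k (f y)) x := by
    intro j k hj hk hjs
    have hg : ContMDiffAt J 𝓘(ℝ, ℂ) ∞ (fun y => E.g j k (f y).1) x :=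
      ContMDiffAt.comp x (g := E.g j k) (contMDiffAt_g hj hk) h
    refine (hg.mul_complex hjs).congr_of_eventuallyEq ?_
    filter_upwards [h.continuousAt.preimage_mem_nhds (((E.isOpen_baseSet j).inter
      (E.isOpen_baseSet k)).mem_nhds ⟨hj, hk⟩)] with y hy
    exact fibreCoord_change hy.1 hy.2
  exact ⟨key _ _ (E.mem_baseSet_at _) hi, key _ _ hi (E.mem_baseSet_at _)⟩

theorem contMDiffAt_proj_total (p : E.Total) :
    ContMDiffAt (totalModel m) (𝓡 m) ∞ (TotalSpace.proj : E.Total → M) p :=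
  ((contMDiffAt_total (E.mem_baseSet_at p.1)).1 contMDiffAt_id).1

theorem contMDiffAt_fibreCoord {i : E.ι} {p : E.Total} (hi : p.1 ∈ E.baseSet i) :
    ContMDiffAt (totalModel m) 𝓘(ℝ, ℂ) ∞ (E.fibreCoord i) p :=
  ((contMDiffAt_total hi).1 contMDiffAt_id).2

theorem eventually_mem_baseSet {i : E.ι} {p : E.Total} (hi : p.1 ∈ E.baseSet i) :
    ∀ᶠ q in 𝓝 p, q.1 ∈ E.baseSet i :=
  (contMDiffAt_proj_total p).continuousAt.preimage_mem_nhds ((E.isOpen_baseSet i).mem_nhds hi)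

theorem isOpen_nonzero : IsOpen E.nonzero := by
  refine isOpen_iff_mem_nhds.2 fun p hp => ?_
  have hi := E.mem_baseSet_at p.1
  filter_upwards [eventually_mem_baseSet hi,
    (contMDiffAt_fibreCoord hi).continuousAt.eventually_ne ((fibreCoord_ne_zero hi).2 hp)]
    with q hq hq'
  exact (fibreCoord_ne_zero hq).1 hq'

theorem contMDiffAt_smul_comp {f : N → ℂ} {s : N → E.Total} {x : N}
    (hf : ContMDiffAt J 𝓘(ℝ, ℂ) ∞ f x) (hs : ContMDiffAt J (totalModel m) ∞ s x) :
    ContMDiffAt J (totalModel m) ∞ (fun y => E.smul (f y) (s y)) x := by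
  have hi := E.mem_baseSet_at (s x).1
  have h := (contMDiffAt_total hi).1 hs
  refine (contMDiffAt_total (f := fun y => E.smul (f y) (s y)) hi).2 ⟨h.1, ?_⟩
  simp only [fibreCoord_smul]
  exact hf.mul_complex h.2

theorem contMDiffAt_point {i : E.ι} {x : M} (hi : x ∈ E.baseSet i) (z : ℂ) :
    ContMDiffAt (𝓡 m) (totalModel m) ∞ (fun y => E.point i y z) x := by
  refine (contMDiffAt_total (f := fun y => E.point i y z) hi).2 ⟨contMDiffAt_id, ?_⟩
  refine (contMDiffAt_const (c := z)).congr_of_eventuallyEq ?_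
  filter_upwards [(E.isOpen_baseSet i).mem_nhds hi] with y hy
  exact fibreCoord_point hy z

namespace Connection

/-- A connection form restricts to `Im (dz / z) / 2π` on each fibre. -/
theorem pullback_smul_left (α : E.Connection) {p : E.Total} (hp : p ∈ E.nonzero) {z : ℂ}
    (hz : z ≠ 0) :
    DiffForm.pullback (I := 𝓘(ℝ, ℂ)) (fun z => E.smul z p) α.form z = argForm z := by
  refine DiffForm.one_ext (η := DiffForm.pullback (I := 𝓘(ℝ, ℂ)) (fun z => E.smul z p) α.form)
    fun (v : ℂ) => ?_
  have hsmul : MDifferentiableAt 𝓘(ℝ, ℂ) (totalModel m) (fun z => E.smul z p) z :=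
    (contMDiffAt_smul_comp contMDiffAt_id contMDiffAt_const).mdifferentiableAt (by simp)
  -- A curve through `z` with velocity `v`, chosen as an orbit so that the normalization `vertical`
  -- applies with `v / z`.
  let c : ℝ → ℂ := fun t => Complex.exp (t * (v / z)) * z
  have hc : HasDerivAt c v 0 := by
    have h1 : HasDerivAt (fun t : ℝ => (t : ℂ) * (v / z)) (v / z) 0 := by
      simpa using (Complex.ofRealCLM.hasDerivAt (x := (0 : ℝ))).mul_const (v / z)
    have h2 := (h1.cexp).mul_const z
    refine h2.congr_deriv ?_
    simp
    field_simp
  have hc0 : c 0 = z := by simp [c]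
  have hv := α.vertical (E.smul z p) (smul_mem_nonzero hz hp) (v / z)
  have hcurve : (fun t : ℝ => E.smul (Complex.exp (t * (v / z))) (E.smul z p)) =
      (fun z => E.smul z p) ∘ c := funext fun t => smul_smul _ _ _
  rw [hcurve, DiffForm.pullback_comp α.form (by rw [hc0]; exact hsmul)
    hc.hasFDerivAt.differentiableAt.mdifferentiableAt] at hv
  rw [DiffForm.argForm_apply, ← div_eq_inv_mul, ← hv]
  have hm : mfderiv 𝓘(ℝ, ℝ) 𝓘(ℝ, ℂ) c 0 (1 : ℝ) = v := by
    rw [mfderiv_eq_fderiv]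
    exact fderiv_apply_one_eq_deriv.trans hc.deriv
  let η : ℂ → ℂ [⋀^Fin 1]→L[ℝ] ℝ := DiffForm.pullback (I := 𝓘(ℝ, ℂ)) (fun z => E.smul z p) α.form
  change η z (fun _ => v) = η (c 0) _
  rw [hc0]
  exact congrArg (η z) (funext fun i => by fin_cases i; exact hm.symm)

/-- The Leibniz rule for connection forms. -/
theorem pullback_smul (α : E.Connection) {f : N → ℂ} {s : N → E.Total} {x : N}
    (hf : ContMDiffAt J 𝓘(ℝ, ℂ) ∞ f x) (hs : ContMDiffAt J (totalModel m) ∞ s x) (hf0 : f x ≠ 0)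
    (hs0 : s x ∈ E.nonzero) :
    DiffForm.pullback (I := J) (fun y => E.smul (f y) (s y)) α.form x =
      DiffForm.pullback (I := J) f argForm x + DiffForm.pullback (I := J) s α.form x := by
  have hΨ : ContMDiffAt (𝓘(ℝ, ℂ).prod J) (totalModel m) ∞
      (fun q : ℂ × N => E.smul q.1 (s q.2)) (f x, x) :=
    contMDiffAt_smul_comp contMDiffAt_fst (ContMDiffAt.comp (f x, x) (g := s) hs contMDiffAt_snd)
  rw [DiffForm.pullback_diag (Ψ := fun q : ℂ × N => E.smul q.1 (s q.2)) α.form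
    (hΨ.mdifferentiableAt (by simp)) (hf.mdifferentiableAt (by simp))]
  congr 1
  · exact DiffForm.pullback_congr_form (α.pullback_smul_left hs0 hf0)
  · have h1 : (fun y => E.smul (f x) (s y)) = E.smul (f x) ∘ s := rfl
    have h2 : ContMDiffAt (totalModel m) (totalModel m) ∞ (E.smul (f x)) (s x) :=
      contMDiffAt_smul_comp contMDiffAt_const contMDiffAt_id
    simp only [h1]
    rw [DiffForm.pullback_comp α.form (h2.mdifferentiableAt (by simp))
      (hs.mdifferentiableAt (by simp))]
    exact DiffForm.pullback_congr_form (α.invariant _ hf0 _ hs0)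

end Connection

end LineBundle

/-! ### Connections and their local connection forms. -/

namespace LineBundle

variable {m : ℕ} {M : Type u} [TopologicalSpace M] [ChartedSpace (EuclideanSpace ℝ (Fin m)) M]
  [IsManifold (𝓡 m) ∞ M] {E : LineBundle.{u, w} m M}
  {F : Type*} [NormedAddCommGroup F] [NormedSpace ℝ F]
  {H : Type*} [TopologicalSpace H] {J : ModelWithCorners ℝ F H}
  {N : Type*} [TopologicalSpace N] [ChartedSpace H N]

theorem total_ext {i : E.ι} {p q : E.Total} (h : p.1 = q.1) (hi : p.1 ∈ E.baseSet i)
    (hc : E.fibreCoord i p = E.fibreCoord i q) : p = q := by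
  rw [← point_fibreCoord hi, ← point_fibreCoord (h ▸ hi : q.1 ∈ E.baseSet i), hc, h]

/-- The forms `θ i` on the sets of the cover are the local connection forms of a connection. -/
structure IsLocalData (E : LineBundle.{u, w} m M) (θ : E.ι → DiffForm (𝓡 m) M 1) : Prop where
  smoothAt : ∀ i, ∀ x ∈ E.baseSet i, (θ i).SmoothAt x
  change : ∀ i j, ∀ x ∈ E.baseSet i ∩ E.baseSet j,
    θ i x = θ j x + DiffForm.pullback (I := 𝓡 m) (E.g i j) argForm x

/-- The unit section of the trivialization with index `i`. -/
def unitSection (E : LineBundle.{u, w} m M) (i : E.ι) (x : M) : E.Total := E.point i x 1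

theorem fibreCoord_unitSection {i : E.ι} {x : M} (hi : x ∈ E.baseSet i) :
    E.fibreCoord i (E.unitSection i x) = 1 := fibreCoord_point hi 1

theorem unitSection_mem_nonzero {i : E.ι} {x : M} (hi : x ∈ E.baseSet i) :
    E.unitSection i x ∈ E.nonzero :=
  (fibreCoord_ne_zero (p := E.unitSection i x) hi).1
    (by rw [fibreCoord_unitSection hi]; exact one_ne_zero)

theorem contMDiffAt_unitSection {i : E.ι} {x : M} (hi : x ∈ E.baseSet i) :
    ContMDiffAt (𝓡 m) (totalModel m) ∞ (E.unitSection i) x := contMDiffAt_point hi 1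

namespace Connection

/-- The pullback of a connection form by the unit section of a trivialization. -/
def localForm (α : E.Connection) (i : E.ι) : DiffForm (𝓡 m) M 1 :=
  DiffForm.pullback (I := 𝓡 m) (E.unitSection i) α.form

/-- Near `x` the unit section of index `i` is `g i j` times the one of index `j`; the change of form
is the Leibniz rule. -/
theorem isLocalData_localForm (α : E.Connection) : E.IsLocalData α.localForm where
  smoothAt i x hi := DiffForm.SmoothAt.pullback (f := E.unitSection i)
    (α.smoothOn.smoothAt isOpen_nonzero (unitSection_mem_nonzero hi)) (contMDiffAt_unitSection hi)
  change i j x hx := by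
    have h1 : E.unitSection i =ᶠ[𝓝 x] fun y => E.smul (E.g i j y) (E.unitSection j y) := by
      filter_upwards [((E.isOpen_baseSet i).inter (E.isOpen_baseSet j)).mem_nhds hx] with y hy
      refine total_ext (i := j) rfl hy.2 ?_
      rw [fibreCoord_smul, fibreCoord_unitSection hy.2,
        fibreCoord_change (p := E.unitSection i y) hy.1 hy.2, fibreCoord_unitSection hy.1]
      rfl
    rw [localForm, DiffForm.pullback_congr _ h1, α.pullback_smul (contMDiffAt_g hx.1 hx.2)
      (contMDiffAt_unitSection hx.2) (g_ne_zero hx.1 hx.2) (unitSection_mem_nonzero hx.2), add_comm]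
    rfl

/-- The unit section is a section of the projection, so pulling `p^* F` back along it returns `F`.
-/
theorem d_localForm {α : E.Connection} {F : DiffForm (𝓡 m) M 2} (h : α.HasCurvature F) {i : E.ι}
    {x : M} (hi : x ∈ E.baseSet i) : (α.localForm i).d x = F x := by
  have hs := contMDiffAt_unitSection hi
  have h1 := DiffForm.d_pullback (f := E.unitSection i)
    (α.smoothOn.smoothAt isOpen_nonzero (unitSection_mem_nonzero hi)) hs
  refine h1.trans ?_
  rw [DiffForm.pullback_congr_form (h _ (unitSection_mem_nonzero hi)),
    ← DiffForm.pullback_comp F ((contMDiffAt_proj_total _).mdifferentiableAt (by simp))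
      (hs.mdifferentiableAt (by simp))]
  exact congrFun (DiffForm.pullback_id F) x

end Connection

/-- The 1-form on the total space with local connection forms `θ i`. -/
def totalForm (E : LineBundle.{u, w} m M) (θ : E.ι → DiffForm (𝓡 m) M 1) :
    DiffForm (totalModel m) E.Total 1 := fun p =>
  DiffForm.pullback (I := totalModel m) (TotalSpace.proj : E.Total → M) (θ (E.indexAt p.1)) p +
    DiffForm.pullback (I := totalModel m) (E.fibreCoord (E.indexAt p.1)) argForm p

namespace IsLocalData

variable {θ : E.ι → DiffForm (𝓡 m) M 1}

/-- The coordinates are related by `g i j`, whose logarithmic derivative cancels the change of `θ`.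
This replaces the preferred index, which may jump from point to point, by a fixed one, and is the
source of smoothness. -/
theorem totalForm_eq (h : E.IsLocalData θ) {i : E.ι} {p : E.Total} (hi : p.1 ∈ E.baseSet i)
    (hp : p ∈ E.nonzero) : E.totalForm θ p =
      DiffForm.pullback (I := totalModel m) (TotalSpace.proj : E.Total → M) (θ i) p +
        DiffForm.pullback (I := totalModel m) (E.fibreCoord i) argForm p := by
  have hj := E.mem_baseSet_at p.1
  have hproj := (contMDiffAt_proj_total p).mdifferentiableAt (by simp)
  have hg := (contMDiffAt_g hi hj).mdifferentiableAt (n := ∞) (by simp)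
  have h1 : E.fibreCoord (E.indexAt p.1) =ᶠ[𝓝 p]
      fun q => (E.g i (E.indexAt p.1) ∘ (TotalSpace.proj : E.Total → M)) q * E.fibreCoord i q := by
    filter_upwards [eventually_mem_baseSet hi, eventually_mem_baseSet hj] with q hq hq'
    exact fibreCoord_change hq hq'
  have h2 : θ i p.1 = (θ (E.indexAt p.1) +
      DiffForm.pullback (I := 𝓡 m) (E.g i (E.indexAt p.1)) argForm) p.1 :=
    h.change i _ p.1 ⟨hi, hj⟩
  rw [totalForm, DiffForm.pullback_congr _ h1,
    DiffForm.pullback_argForm_mul (hg.comp p hproj)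
      ((contMDiffAt_fibreCoord hi).mdifferentiableAt (by simp)) (g_ne_zero hi hj)
      ((fibreCoord_ne_zero hi).2 hp), DiffForm.pullback_comp argForm hg hproj,
    DiffForm.pullback_congr_form (f := (TotalSpace.proj : E.Total → M)) h2, DiffForm.pullback_add,
    add_assoc]

theorem eventually_totalForm_eq (h : E.IsLocalData θ) {i : E.ι} {p : E.Total}
    (hi : p.1 ∈ E.baseSet i) (hp : p ∈ E.nonzero) : ∀ᶠ q in 𝓝 p, E.totalForm θ q =
      (DiffForm.pullback (I := totalModel m) (TotalSpace.proj : E.Total → M) (θ i) +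
        DiffForm.pullback (I := totalModel m) (E.fibreCoord i) argForm) q := by
  filter_upwards [eventually_mem_baseSet hi, isOpen_nonzero.mem_nhds hp] with q hq hq'
  exact h.totalForm_eq hq hq'

theorem pullback_totalForm (h : E.IsLocalData θ) {s : N → E.Total} {x : N}
    (hs : ContMDiffAt J (totalModel m) ∞ s x) {i : E.ι} (hi : (s x).1 ∈ E.baseSet i)
    (hp : s x ∈ E.nonzero) : DiffForm.pullback (I := J) s (E.totalForm θ) x =
      DiffForm.pullback (I := J) (fun y => (s y).1) (θ i) x +
        DiffForm.pullback (I := J) (fun y => E.fibreCoord i (s y)) argForm x := by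
  have hs' := hs.mdifferentiableAt (by simp)
  rw [DiffForm.pullback_congr_form (η' :=
    DiffForm.pullback (I := totalModel m) (TotalSpace.proj : E.Total → M) (θ i) +
        DiffForm.pullback (I := totalModel m) (E.fibreCoord i) argForm) (h.totalForm_eq hi hp),
    DiffForm.pullback_add, ← DiffForm.pullback_comp (θ i)
      ((contMDiffAt_proj_total _).mdifferentiableAt (by simp)) hs',
    ← DiffForm.pullback_comp argForm ((contMDiffAt_fibreCoord hi).mdifferentiableAt (by simp)) hs']
  rfl

theorem smoothAt_totalForm (h : E.IsLocalData θ) {p : E.Total} (hp : p ∈ E.nonzero) :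
    (E.totalForm θ).SmoothAt p := by
  have hi := E.mem_baseSet_at p.1
  refine DiffForm.SmoothAt.congr (DiffForm.SmoothAt.add ?_ ?_) (h.eventually_totalForm_eq hi hp)
  · exact (h.smoothAt _ _ hi).pullback (contMDiffAt_proj_total p)
  · exact (DiffForm.argForm_smoothAt ((fibreCoord_ne_zero hi).2 hp)).pullback
      (contMDiffAt_fibreCoord hi)

theorem d_totalForm (h : E.IsLocalData θ) {i : E.ι} {p : E.Total} (hi : p.1 ∈ E.baseSet i)
    (hp : p ∈ E.nonzero) : (E.totalForm θ).d p =
      DiffForm.pullback (I := totalModel m) (TotalSpace.proj : E.Total → M) (θ i).d p := by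
  have hc := (fibreCoord_ne_zero hi).2 hp
  rw [DiffForm.d_congr (h.eventually_totalForm_eq hi hp), DiffForm.d_add
    ((h.smoothAt _ _ hi).pullback (contMDiffAt_proj_total p))
    ((DiffForm.argForm_smoothAt hc).pullback (contMDiffAt_fibreCoord hi)),
    DiffForm.d_pullback (h.smoothAt _ _ hi) (contMDiffAt_proj_total p),
    DiffForm.d_pullback (DiffForm.argForm_smoothAt hc) (contMDiffAt_fibreCoord hi)]
  have : DiffForm.pullback (I := totalModel m) (E.fibreCoord i) argForm.d p = 0 := by
    rw [DiffForm.pullback_congr_form (η' := 0) (DiffForm.argForm_d hc)]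
    rfl
  rw [this, add_zero]

/-- The connection with given local connection forms. -/
def connection (h : E.IsLocalData θ) : E.Connection where
  form := E.totalForm θ
  smoothOn := DiffForm.smoothOn_of_smoothAt fun p hp => h.smoothAt_totalForm hp
  invariant z hz p hp := by
    have hi := E.mem_baseSet_at p.1
    have hs : ContMDiffAt (totalModel m) (totalModel m) ∞ (E.smul z) p :=
      contMDiffAt_smul_comp contMDiffAt_const contMDiffAt_id
    rw [h.pullback_totalForm hs (i := E.indexAt p.1) hi (smul_mem_nonzero hz hp)]
    simp only [fibreCoord_smul]
    rw [DiffForm.pullback_argForm_mul mdifferentiableAt_const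
      ((contMDiffAt_fibreCoord hi).mdifferentiableAt (by simp)) hz
      ((fibreCoord_ne_zero hi).2 hp), DiffForm.pullback_argForm_const, zero_add]
    rfl
  vertical p hp z := by
    have hi := E.mem_baseSet_at p.1
    have hc : HasDerivAt (fun t : ℝ => Complex.exp (t * z)) z 0 := by
      have h1 : HasDerivAt (fun t : ℝ => (t : ℂ) * z) z 0 := by
        simpa using (Complex.ofRealCLM.hasDerivAt (x := (0 : ℝ))).mul_const z
      refine h1.cexp.congr_deriv ?_
      simp
    have hcs : ContMDiffAt 𝓘(ℝ, ℝ) 𝓘(ℝ, ℂ) ∞ (fun t : ℝ => Complex.exp (t * z)) 0 := by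
      have : ContDiff ℝ ∞ (fun t : ℝ => Complex.exp (t * z)) :=
        (Complex.ofRealCLM.contDiff.mul contDiff_const).cexp
      exact this.contDiffAt.contMDiffAt
    have hs : ContMDiffAt 𝓘(ℝ, ℝ) (totalModel m) ∞
        (fun t : ℝ => E.smul (Complex.exp (t * z)) p) 0 :=
      contMDiffAt_smul_comp hcs contMDiffAt_const
    have key := h.pullback_totalForm hs (i := E.indexAt p.1) hi
      (smul_mem_nonzero (Complex.exp_ne_zero _) hp)
    simp only [fibreCoord_smul] at key
    rw [DiffForm.pullback_argForm_mul (hcs.mdifferentiableAt (by simp)) mdifferentiableAt_const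
      (Complex.exp_ne_zero _) ((fibreCoord_ne_zero hi).2 hp),
      DiffForm.pullback_argForm_const, add_zero] at key
    -- The base point does not move along a fibre, so only the `argForm` term contributes.
    have hconst : DiffForm.pullback (I := 𝓘(ℝ, ℝ))
        (fun t : ℝ => (E.smul (Complex.exp (t * z)) p).1) (θ (E.indexAt p.1)) 0 = 0 := by
      refine DiffForm.one_ext (η := DiffForm.pullback (I := 𝓘(ℝ, ℝ)) (fun _ : ℝ => p.1)
        (θ (E.indexAt p.1))) (η' := 0) fun v => ?_
      have h0 : mfderiv 𝓘(ℝ, ℝ) (𝓡 m) (fun _ : ℝ => p.1) 0 v = 0 := by rw [mfderiv_const]; rfl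
      exact (θ (E.indexAt p.1) p.1).map_coord_zero (0 : Fin 1) h0
    rw [key, hconst, zero_add]
    have h1 := DiffForm.pullback_argForm (I := 𝓘(ℝ, ℝ)) (fun t : ℝ => Complex.exp (t * z)) 0 (1 : ℝ)
    have h2 : vderiv (I := 𝓘(ℝ, ℝ)) (fun t : ℝ => Complex.exp (t * z)) 0 (1 : ℝ) = z := by
      change mfderiv 𝓘(ℝ, ℝ) 𝓘(ℝ, ℂ) (fun t : ℝ => Complex.exp (t * z)) 0 (1 : ℝ) = z
      rw [mfderiv_eq_fderiv]
      exact fderiv_apply_one_eq_deriv.trans hc.deriv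
    rw [h2] at h1
    simp only [Complex.ofReal_zero, zero_mul, Complex.exp_zero, inv_one, one_mul] at h1
    refine Eq.trans ?_ h1
    exact congrArg (DiffForm.pullback (I := 𝓘(ℝ, ℝ)) (fun t : ℝ => Complex.exp (t * z)) argForm 0)
      (funext fun i => by fin_cases i; rfl)

theorem hasCurvature_connection (h : E.IsLocalData θ) {F : DiffForm (𝓡 m) M 2}
    (hF : ∀ i, ∀ x ∈ E.baseSet i, (θ i).d x = F x) : h.connection.HasCurvature F := fun p hp => by
  have hi := E.mem_baseSet_at p.1
  exact (h.d_totalForm hi hp).trans (DiffForm.pullback_congr_form (hF _ _ hi))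

/-- An `N`-th power multiplies logarithmic derivatives by `N`, and the global form `β` drops out of
the comparison of two trivializations. -/
theorem tensorPower (h : E.IsLocalData θ) (N : ℕ) {β : DiffForm (𝓡 m) M 1}
    (hβ : ∀ x, β.SmoothAt x) : (E.tensorPower N).IsLocalData fun i => (N : ℝ) • θ i + β where
  smoothAt i x hi := ((h.smoothAt i x hi).smul _).add (hβ x)
  change i j x hx := by
    have h1 : DiffForm.pullback (I := 𝓡 m) ((E.tensorPower N).g i j) argForm x = _ :=
      DiffForm.pullback_argForm_pow (f := E.g i j)
        ((contMDiffAt_g (E := E) hx.1 hx.2).mdifferentiableAt (by simp)) (g_ne_zero hx.1 hx.2) N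
    have h2 : θ i x = θ j x + DiffForm.pullback (I := 𝓡 m) (E.g i j) argForm x := h.change i j x hx
    rw [h1]
    change (N : ℝ) • θ i x + β x = (N : ℝ) • θ j x + β x + _
    rw [h2, smul_add]
    abel

end IsLocalData

/-- A line bundle with real Chern class `-[Ω]` has local connection forms of curvature `Ω`. -/
theorem HasRealChernClass.exists_localData {Ω : DiffForm (𝓡 m) M 2}
    (h : E.HasRealChernClass (-Ω)) : ∃ θ : E.ι → DiffForm (𝓡 m) M 1, E.IsLocalData θ ∧
      ∀ i, ∀ x ∈ E.baseSet i, (θ i).d x = Ω x := by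
  obtain ⟨α, F, τ, -, hF, hτ, hΩ⟩ := h
  have hτ' : ∀ x, τ.SmoothAt x := fun x => hτ.smoothAt isOpen_univ (mem_univ x)
  have hα := α.isLocalData_localForm
  -- From `-Ω = -F + dτ` one gets `F - dτ = Ω`, so `τ` has to be subtracted.
  refine ⟨fun i => α.localForm i - τ, ⟨fun i x hi => (hα.smoothAt i x hi).sub (hτ' x),
    fun i j x hx => ?_⟩, fun i x hi => ?_⟩
  · change α.localForm i x - τ x = α.localForm j x - τ x + _
    rw [hα.change i j x hx]
    abel
  · rw [DiffForm.d_sub (hα.smoothAt i x hi) (hτ' x), Connection.d_localForm hF hi]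
    have h1 : -Ω x = -F x + τ.d x := congrFun hΩ x
    rw [← neg_neg (Ω x), h1]
    abel

/-- A line bundle with local connection forms of curvature `Ω` has real Chern class `-[Ω]`. -/
theorem IsLocalData.hasRealChernClass {θ : E.ι → DiffForm (𝓡 m) M 1} (h : E.IsLocalData θ)
    {Ω : DiffForm (𝓡 m) M 2} (hΩ : Ω.Smooth) (hd : ∀ i, ∀ x ∈ E.baseSet i, (θ i).d x = Ω x) :
    E.HasRealChernClass (-Ω) := by
  refine ⟨h.connection, Ω, 0, hΩ, h.hasCurvature_connection hd, ?_, ?_⟩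
  · refine DiffForm.smoothOn_of_smoothAt fun x _ => ?_
    have h1 : (0 : DiffForm (𝓡 m) M 1).inChart x = fun _ => 0 := by
      funext a; rfl
    unfold DiffForm.SmoothAt
    rw [h1]
    exact contDiffAt_const
  · have h0 : (0 : DiffForm (𝓡 m) M 1).d = 0 := by
      have h1 : (0 : DiffForm (𝓡 m) M 1) = (0 : ℝ) • (0 : DiffForm (𝓡 m) M 1) := (zero_smul _ _).symm
      funext x
      rw [h1, DiffForm.d_smul, zero_smul]
      rfl
    rw [h0, add_zero]

end LineBundle

/-! ### The exponential character of `ℝ/ℤ`. -/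

section Phase

/-- The character `t ↦ e^{2πit}` of `ℝ/ℤ`. -/
def phaseExp (a : AddCircle (1 : ℝ)) : ℂ := AddCircle.toCircle a

theorem phaseExp_coe (t : ℝ) :
    phaseExp (t : AddCircle (1 : ℝ)) = Complex.exp (2 * Real.pi * Complex.I * t) := by
  rw [phaseExp, AddCircle.toCircle_apply_mk, Circle.coe_exp]
  congr 1
  push_cast
  ring

theorem phaseExp_add (a b : AddCircle (1 : ℝ)) : phaseExp (a + b) = phaseExp a * phaseExp b := by
  rw [phaseExp, AddCircle.toCircle_add]
  rfl

theorem phaseExp_zero : phaseExp 0 = 1 := by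
  rw [phaseExp, AddCircle.toCircle_zero]
  rfl

theorem phaseExp_ne_zero (a : AddCircle (1 : ℝ)) : phaseExp a ≠ 0 := Circle.coe_ne_zero _

theorem phaseExp_injective : Function.Injective phaseExp :=
  Subtype.val_injective.comp (AddCircle.injective_toCircle one_ne_zero)

variable {E : Type*} [NormedAddCommGroup E] [NormedSpace ℝ E]
  {H : Type*} [TopologicalSpace H] {I : ModelWithCorners ℝ E H}
  {M : Type*} [TopologicalSpace M] [ChartedSpace H M]

theorem contMDiffAt_exp_polar {μ ξ : M → ℝ} {x : M} (hμ : ContMDiffAt I 𝓘(ℝ, ℝ) ∞ μ x)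
    (hξ : ContMDiffAt I 𝓘(ℝ, ℝ) ∞ ξ x) : ContMDiffAt I 𝓘(ℝ, ℂ) ∞
      (fun y => Complex.exp (μ y + 2 * Real.pi * Complex.I * ξ y)) x := by
  have h : ContDiff ℝ ∞ (fun q : ℝ × ℝ =>
      Complex.exp (q.1 + 2 * Real.pi * Complex.I * q.2)) :=
    ((Complex.ofRealCLM.contDiff.comp contDiff_fst).add
      (contDiff_const.mul (Complex.ofRealCLM.contDiff.comp contDiff_snd))).cexp
  exact ContMDiffAt.comp x (f := fun y => (μ y, ξ y)) h.contDiffAt.contMDiffAt (hμ.prodMk_space hξ)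

theorem DiffForm.pullback_lineForm_congr {R R' : M → ℝ} {x : M} {c : ℝ}
    (h : ∀ᶠ y in 𝓝 x, R' y = R y + c) (hR : MDifferentiableAt I 𝓘(ℝ, ℝ) R x) :
    pullback (I := I) R' lineForm x = pullback (I := I) R lineForm x := by
  rw [pullback_congr (g := fun y => R y + c) lineForm h]
  refine one_ext (η := pullback (I := I) (fun y => R y + c) lineForm)
    (η' := pullback (I := I) R lineForm) fun v => ?_
  have h := (hR.hasMFDerivAt.add (hasMFDerivAt_const c x)).mfderiv
  let L : E →L[ℝ] ℝ := mfderiv I 𝓘(ℝ, ℝ) R x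
  let L' : E →L[ℝ] ℝ := mfderiv I 𝓘(ℝ, ℝ) (fun y => R y + c) x
  have h1 : L' = L + 0 := h
  exact congrArg (fun T : E →L[ℝ] ℝ => T v) (h1.trans (add_zero L))

end Phase

/-! ### Weil's construction of a line bundle from potentials. -/

section Existence

variable {m : ℕ} {M : Type u} [TopologicalSpace M] [ChartedSpace (EuclideanSpace ℝ (Fin m)) M]
  [IsManifold (𝓡 m) ∞ M]

/-- Weil's theorem: an integral closed 2-form is the curvature of a line bundle. -/
theorem exists_lineBundle_of_integral {Ω : DiffForm (𝓡 m) M 2} (hΩ : Ω.Smooth) (hd : Ω.d = 0)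
    (hint : IsIntegralForm Ω) : ∃ E : LineBundle.{u, u} m M, E.HasRealChernClass (-Ω) := by
  obtain ⟨f, hf⟩ := exists_integral_potentials hΩ hd hint
  have hpolar : ∀ i j, ∀ x ∈ chartBall (𝓡 m) i ∩ chartBall (𝓡 m) j, ∃ R : M → ℝ,
      ContMDiffAt (𝓡 m) 𝓘(ℝ, ℝ) ∞ R x ∧
      Ω.chartPrimitive i x - Ω.chartPrimitive j x =
        DiffForm.pullback (I := 𝓡 m) R lineForm x ∧
      (fun y => phaseExp (f i y - f j y)) =ᶠ[𝓝 x]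
        fun y => Complex.exp ((0 : ℝ) + 2 * Real.pi * Complex.I * R y) := by
    intro i j x hx
    obtain ⟨R, hR⟩ := hf i j x hx
    obtain ⟨t, ht⟩ := QuotientAddGroup.mk_surjective (f i x - f j x)
    have hRx := hR.self_of_nhds
    -- The primitive `R` is normalized by a constant so that its class modulo `ℤ` is `f i - f j`
    -- itself.
    refine ⟨fun y => R y + (t - R x), hRx.1.add contMDiffAt_const, ?_, ?_⟩
    · rw [hRx.2.1]
      exact (DiffForm.pullback_lineForm_congr (c := t - R x) (Filter.Eventually.of_forall
        fun y => rfl) (hRx.1.mdifferentiableAt (by simp))).symm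
    · filter_upwards [hR] with y hy
      rw [hy.2.2, ← ht]
      have : (QuotientAddGroup.mk t : AddCircle (1 : ℝ)) + ((R y - R x : ℝ) : AddCircle (1 : ℝ)) =
          ((R y + (t - R x) : ℝ) : AddCircle (1 : ℝ)) := by
        rw [show R y + (t - R x) = t + (R y - R x) by ring, AddCircle.coe_add]
      rw [this, phaseExp_coe]
      simp
  -- The cover consists of the chart balls, indexed by points. The cocycle condition is automatic,
  -- because the exponents are differences of potentials; only their differences have to be smooth.
  let E : LineBundle.{u, u} m M :=
    { ι := M
      baseSet := chartBall (𝓡 m)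
      isOpen_baseSet := isOpen_chartBall (𝓡 m)
      indexAt := id
      mem_baseSet_at := mem_chartBall_self (𝓡 m)
      g := fun i j x => phaseExp (f i x - f j x)
      contMDiffOn_g := fun i j x hx => by
        obtain ⟨R, hR, -, hg⟩ := hpolar i j x hx
        exact ((contMDiffAt_exp_polar contMDiffAt_const hR).congr_of_eventuallyEq
          hg).contMDiffWithinAt
      g_self := fun i x _ => by rw [sub_self, phaseExp_zero]
      g_comp := fun i j k x _ => by rw [← phaseExp_add]; congr 1; abel }
  have hE : E.IsLocalData Ω.chartPrimitive :=
    ⟨fun i x hx => DiffForm.smoothAt_chartPrimitive hΩ hx, fun i j x hx => by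
      obtain ⟨R, hR, hRd, hg⟩ := hpolar i j x hx
      have h1 : DiffForm.pullback (I := 𝓡 m) (E.g i j) argForm x =
          DiffForm.pullback (I := 𝓡 m) R lineForm x := by
        rw [DiffForm.pullback_congr (f := E.g i j) argForm hg]
        exact DiffForm.pullback_argForm_exp (μ := fun _ => 0) mdifferentiableAt_const
          (hR.mdifferentiableAt (by simp))
      rw [h1, ← hRd]
      abel⟩
  exact ⟨E, hE.hasRealChernClass hΩ fun i x hx => DiffForm.d_chartPrimitive hΩ hd hx⟩

end Existence

/-! ### Acyclicity of the sheaf of smooth functions. -/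

section Cech

variable {E : Type*} [NormedAddCommGroup E] [NormedSpace ℝ E] [FiniteDimensional ℝ E]
  {H : Type*} [TopologicalSpace H] {I : ModelWithCorners ℝ E H} [I.Boundaryless]
  {M : Type*} [TopologicalSpace M] [ChartedSpace H M] [IsManifold I ∞ M] [T2Space M]
  [SigmaCompactSpace M]

/-- The sheaf of smooth real functions is acyclic: a smooth Čech 1-cocycle is a coboundary. -/
theorem exists_smooth_cech_primitive {ι : Type*} {U : ι → Set M} (hU : ∀ i, IsOpen (U i))
    (hcov : ∀ x, ∃ i, x ∈ U i) {c : ι → ι → M → ℝ}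
    (hc : ∀ i j, ∀ x ∈ U i ∩ U j, ContMDiffAt I 𝓘(ℝ, ℝ) ∞ (c i j) x)
    (hcocycle : ∀ i j k, ∀ x ∈ U i ∩ U j ∩ U k, c i j x + c j k x = c i k x) :
    ∃ v : ι → M → ℝ, (∀ i, ∀ x ∈ U i, ContMDiffAt I 𝓘(ℝ, ℝ) ∞ (v i) x) ∧
      ∀ i j, ∀ x ∈ U i ∩ U j, c i j x = v i x - v j x := by
  obtain ⟨ρ, hρ⟩ := SmoothPartitionOfUnity.exists_isSubordinate I isClosed_univ U hU
    fun x _ => mem_iUnion.2 (hcov x)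
  -- The contracting homotopy given by the partition of unity. Terms with `x` outside `U k` vanish,
  -- so the cocycle identity applies to all the others.
  refine ⟨fun i x => ∑ᶠ k, ρ k x • c i k x, fun i x hx => ?_, fun i j x hx => ?_⟩
  · exact ρ.contMDiffAt_finsum fun k hk => hc i k x ⟨hx, hρ k hk⟩
  · have hfin : (Function.support fun k => ρ k x).Finite := ρ.locallyFinite.point_finite x
    have hs : ∀ i, (Function.support fun k => ρ k x • c i k x).Finite := fun i =>
      hfin.subset fun k hk h0 => hk (by simp only [h0, zero_smul])
    rw [← finsum_sub_distrib (hs i) (hs j)]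
    have h1 : ∀ k, ρ k x • c i k x - ρ k x • c j k x = ρ k x • c i j x := fun k => by
      by_cases hk : ρ k x = 0
      · simp [hk]
      · have hkU : x ∈ U k := hρ k (subset_tsupport _ hk)
        rw [← hcocycle i j k x ⟨hx, hkU⟩, smul_add, add_sub_cancel_right]
    simp only [h1, ← finsum_smul, ρ.sum_eq_one (mem_univ x), one_smul]

end Cech

/-! ### Functions with vanishing differential. -/

section LocallyConstant

variable {E : Type*} [NormedAddCommGroup E] [NormedSpace ℝ E]
  {H : Type*} [TopologicalSpace H] {I : ModelWithCorners ℝ E H} [I.Boundaryless]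
  {M : Type*} [TopologicalSpace M] [ChartedSpace H M] [IsManifold I ∞ M]

/-- In the chart the derivative vanishes on a ball, which is connected, so the function is constant
there. -/
theorem eventually_eq_of_pullback_eq_zero {R : M → ℝ} {x : M}
    (h : ∀ᶠ y in 𝓝 x, MDifferentiableAt I 𝓘(ℝ, ℝ) R y ∧
      DiffForm.pullback (I := I) R lineForm y = 0) : ∀ᶠ y in 𝓝 x, R y = R x := by
  let φ := extChartAt I x
  have hc : Filter.Tendsto φ.symm (𝓝 (φ x)) (𝓝 x) := by
    have := (continuousAt_extChartAt_symm (I := I) x).tendsto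
    rwa [(extChartAt I x).left_inv (mem_extChartAt_source x)] at this
  obtain ⟨r, hr, hball⟩ := Metric.eventually_nhds_iff_ball.1 ((hc.eventually h).and
    ((isOpen_extChartAt_target (I := I) x).mem_nhds (mem_extChartAt_target x)))
  have hφ : ∀ᶠ y in 𝓝 x, φ y ∈ Metric.ball (φ x) r :=
    (continuousAt_extChartAt x).preimage_mem_nhds (Metric.ball_mem_nhds _ hr)
  have hsymm : ∀ a ∈ Metric.ball (φ x) r, ContMDiffAt 𝓘(ℝ, E) I ∞ φ.symm a := fun a ha =>
    (contMDiffOn_extChartAt_symm x).contMDiffAt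
      ((isOpen_extChartAt_target x).mem_nhds (hball a ha).2)
  have hsm : ∀ a ∈ Metric.ball (φ x) r, DifferentiableAt ℝ (R ∘ φ.symm) a := fun a ha =>
    ((hball a ha).1.1.comp a ((hsymm a ha).mdifferentiableAt (by simp))).differentiableAt
  have hd : ∀ a ∈ Metric.ball (φ x) r, fderiv ℝ (R ∘ φ.symm) a = 0 := fun a ha => by
    ext v
    rw [← mfderiv_eq_fderiv]
    have h1 : DiffForm.pullback (I := 𝓘(ℝ, E)) (R ∘ φ.symm) lineForm a = 0 := by
      rw [DiffForm.pullback_comp lineForm (hball a ha).1.1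
        ((hsymm a ha).mdifferentiableAt (by simp)),
        DiffForm.pullback_congr_form (η' := 0) (hball a ha).1.2]
      rfl
    exact congrArg (fun y : E [⋀^Fin 1]→L[ℝ] ℝ => y fun _ => v) h1
  filter_upwards [hφ, (extChartAt_source_mem_nhds (I := I) x)] with y hy hys
  have := Metric.isOpen_ball.is_const_of_fderiv_eq_zero (convex_ball (φ x) r).isPreconnected
    (fun a ha => (hsm a ha).differentiableWithinAt) hd hy (Metric.mem_ball_self hr)
  simpa only [Function.comp, φ, (extChartAt I x).left_inv hys,
    (extChartAt I x).left_inv (mem_extChartAt_source x)] using this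

end LocallyConstant

/-! ### From real singular 1-cocycles to closed 1-forms. -/

section DeRham

variable {E : Type} [NormedAddCommGroup E] [NormedSpace ℝ E]
  {H : Type*} [TopologicalSpace H] {I : ModelWithCorners ℝ E H} [I.Boundaryless]
  {M : Type u} [TopologicalSpace M] [ChartedSpace H M]

/-- The straight segment in the chart at `x`. Such short paths test whether a function is locally
constant through the values of a cochain. -/
theorem eventually_exists_path (I : ModelWithCorners ℝ E H) [I.Boundaryless] {x : M} {W : Set M}
    (hW : W ∈ 𝓝 x) : ∀ᶠ y in 𝓝 x, ∃ s : SingularSimplex M 1, s.source = x ∧ s.target = y ∧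
      ∀ t, s t ∈ W := by
  let φ := extChartAt I x
  have hc : Filter.Tendsto φ.symm (𝓝 (φ x)) (𝓝 x) := by
    have := (continuousAt_extChartAt_symm (I := I) x).tendsto
    rwa [(extChartAt I x).left_inv (mem_extChartAt_source x)] at this
  obtain ⟨r, hr, hball⟩ := Metric.mem_nhds_iff.1 (hc hW)
  have hφ : ∀ᶠ y in 𝓝 x, φ y ∈ Metric.ball (φ x) r :=
    (continuousAt_extChartAt x).preimage_mem_nhds (Metric.ball_mem_nhds _ hr)
  filter_upwards [hφ, (isOpen_chartBall I x).mem_nhds (mem_chartBall_self I x)] with y hy hyB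
  refine ⟨chartSegment I x y, ?_, ?_, fun t => ?_⟩
  · refine (chartSegment_apply I hyB _).trans ?_
    simp
  · refine (chartSegment_apply I hyB _).trans ?_
    simpa using (extChartAt I x).left_inv hyB.1
  · have h1 := chartSegment_apply I hyB t
    have h2 := hball (homothety_mem_ball (stdSimplex_mem_Icc t 1) hy)
    exact (congrArg (· ∈ W) h1).mpr h2

/-- Every real singular 1-cocycle is represented by a closed 1-form. -/
theorem exists_closed_form_of_cocycle [FiniteDimensional ℝ E] [IsManifold I ∞ M] [T2Space M]
    [SigmaCompactSpace M] {a : SingularCochain M ℝ 1} (ha : singularCoboundary M ℝ 1 a = 0) :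
    ∃ (β : DiffForm I M 1) (w : M → ℝ), (∀ x, β.SmoothAt x) ∧ (∀ x, β.d x = 0) ∧
      ∀ x, ∃ (W : Set M) (v : M → ℝ), IsOpen W ∧ x ∈ W ∧
        (∀ y ∈ W, ContMDiffAt I 𝓘(ℝ, ℝ) ∞ v y ∧ β y = DiffForm.pullback (I := I) v lineForm y) ∧
        ∀ s : SingularSimplex M 1, (∀ t, s t ∈ W) →
          a s = (v s.target - v s.source) + (w s.target - w s.source) := by
  let B := chartBall I (M := M)
  let f : M → M → ℝ := fun i x => a (chartSegment I i x)
  have hf : ∀ i, ∀ s : SingularSimplex M 1, (∀ t, s t ∈ B i) → a s = f i s.target - f i s.source :=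
    fun i s hs => cocycle_apply_chartBall I ha hs
  -- Along a short path in both balls, `f i` and `f j` have the same increment, namely the value of
  -- `a`.
  have hconst : ∀ i j, ∀ x ∈ B i ∩ B j, ∀ᶠ y in 𝓝 x, f i y - f j y = f i x - f j x := by
    intro i j x hx
    have hW := ((isOpen_chartBall I i).inter (isOpen_chartBall I j)).mem_nhds hx
    filter_upwards [eventually_exists_path I hW] with y ⟨s, hs0, hs1, hs⟩
    have h1 := hf i s fun t => (hs t).1
    have h2 := hf j s fun t => (hs t).2
    rw [hs0, hs1] at h1 h2
    linarith
  -- The `f i` need not be smooth, but their differences are locally constant and so form a smooth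
  -- Čech cocycle. The smooth functions `v i` have the same differences, so their differentials glue
  -- to `β`.
  obtain ⟨v, hv, hvf⟩ := exists_smooth_cech_primitive (I := I) (isOpen_chartBall I)
    (fun x => ⟨x, mem_chartBall_self I x⟩) (c := fun i j x => f i x - f j x)
    (fun i j x hx => (contMDiffAt_const (c := f i x - f j x)).congr_of_eventuallyEq
      (hconst i j x hx)) (fun i j k x _ => by ring)
  have hvconst : ∀ i j, ∀ x ∈ B i ∩ B j, ∀ᶠ y in 𝓝 x, v i y = v j y + (f i x - f j x) := by
    intro i j x hx
    filter_upwards [hconst i j x hx, ((isOpen_chartBall I i).inter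
      (isOpen_chartBall I j)).mem_nhds hx] with y hy hyB
    have := hvf i j y hyB
    linarith
  let β : DiffForm I M 1 := fun x => DiffForm.pullback (I := I) (v x) lineForm x
  have hβ : ∀ i, ∀ x ∈ B i, β x = DiffForm.pullback (I := I) (v i) lineForm x := fun i x hx =>
    DiffForm.pullback_lineForm_congr (hvconst x i x ⟨mem_chartBall_self I x, hx⟩)
      ((hv i x hx).mdifferentiableAt (by simp))
  have hβe : ∀ x, ∀ᶠ y in 𝓝 x, β y = DiffForm.pullback (I := I) (v x) lineForm y := fun x => by
    filter_upwards [(isOpen_chartBall I x).mem_nhds (mem_chartBall_self I x)] with y hy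
    exact hβ x y hy
  have hvx : ∀ x, ContMDiffAt I 𝓘(ℝ, ℝ) ∞ (v x) x := fun x => hv x x (mem_chartBall_self I x)
  -- From `f i - f j = v i - v j` the functions `f i - v i` agree on overlaps and define a global
  -- function `w`, possibly discontinuous. It measures the difference between `a` and the periods of
  -- `β`.
  refine ⟨β, fun x => f x x - v x x, fun x => ?_, fun x => ?_, fun x => ⟨B x, v x,
    isOpen_chartBall I x, mem_chartBall_self I x, fun y hy => ⟨hv x y hy, hβ x y hy⟩,
    fun s hs => ?_⟩⟩
  · exact ((DiffForm.lineForm_smoothAt _).pullback (hvx x)).congr (hβe x)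
  · rw [DiffForm.d_congr (hβe x), DiffForm.d_pullback_lineForm (hvx x)]
  · have key : ∀ y ∈ B x, f y y - v y y = f x y - v x y := fun y hy => by
      have := hvf y x y ⟨mem_chartBall_self I y, hy⟩
      linarith
    have h1 := key s.target (hs _)
    have h2 := key s.source (hs _)
    rw [hf x s hs]
    linarith

end DeRham

/-! ### Winding numbers and trivial holonomy. -/

/-- The winding number of a loop in the punctured plane is an integer. -/
theorem exists_int_lineIntegral_argForm {u : ℝ → ℂ} (hu : ContDiff ℝ ∞ u) (hu0 : ∀ t, u t ≠ 0)
    (h01 : u 1 = u 0) : ∃ k : ℤ, argForm.lineIntegral u = k := by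
  let f : ℝ → ℂ := fun t => (u t)⁻¹ * deriv u t
  have hf : Continuous f :=
    (hu.continuous.inv₀ hu0).mul (hu.continuous_deriv (by exact_mod_cast le_top))
  let F : ℝ → ℂ := fun t => ∫ x in (0 : ℝ)..t, f x
  have hF : ∀ t, HasDerivAt F (f t) t := fun t =>
    intervalIntegral.integral_hasDerivAt_right (hf.intervalIntegrable _ _)
      hf.stronglyMeasurable.stronglyMeasurableAtFilter hf.continuousAt
  have hu' : ∀ t, HasDerivAt u (deriv u t) t := fun t =>
    (hu.differentiable (by simp) t).hasDerivAt
  -- With `F` the integral of `u' / u`, the function `u * exp (-F)` is constant. As `u` is a loop,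
  -- `exp (F 1) = 1`.
  have hconst : ∀ t, HasDerivAt (fun t => u t * Complex.exp (-F t)) 0 t := fun t => by
    refine ((hu' t).mul (hF t).neg.cexp).congr_deriv ?_
    have := hu0 t
    simp only [f]
    field_simp
    ring
  have h1 : u 1 * Complex.exp (-F 1) = u 0 * Complex.exp (-F 0) :=
    is_const_of_deriv_eq_zero (fun t => (hconst t).differentiableAt) (fun t => (hconst t).deriv) 1 0
  have hF0 : F 0 = 0 := intervalIntegral.integral_same
  rw [hF0, neg_zero, Complex.exp_zero, mul_one, h01] at h1
  have h2 : Complex.exp (F 1) = 1 := by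
    have h3 : Complex.exp (-F 1) = 1 := mul_left_cancel₀ (hu0 0) (h1.trans (mul_one _).symm)
    rw [Complex.exp_neg] at h3
    exact inv_eq_one.1 h3
  obtain ⟨k, hk⟩ := Complex.exp_eq_one_iff.1 h2
  refine ⟨k, ?_⟩
  have h4 : ∀ t, DiffForm.pullback (I := 𝓘(ℝ, ℝ)) u argForm t ![(1 : ℝ)] =
      (f t).im / (2 * Real.pi) := fun t => by
    have h5 : (![(1 : ℝ)] : Fin 1 → ℝ) = fun _ => 1 := by
      funext i; rw [Subsingleton.elim i 0]; rfl
    have h6 : vderiv (I := 𝓘(ℝ, ℝ)) u t (1 : ℝ) = deriv u t := by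
      exact (DFunLike.congr_fun (mfderiv_eq_fderiv (f := u) (x := t)) (1 : ℝ)).trans
        (fderiv_apply_one_eq_deriv (f := u) (x := t))
    exact (congrArg (fun v => DiffForm.pullback (I := 𝓘(ℝ, ℝ)) u argForm t v) h5).trans
      ((DiffForm.pullback_argForm (I := 𝓘(ℝ, ℝ)) u t (1 : ℝ)).trans (by rw [h6]))
  have h7 : ∫ t in (0 : ℝ)..1, (f t).im = (F 1).im :=
    Complex.imCLM.intervalIntegral_comp_comm (hf.intervalIntegrable 0 1)
  rw [DiffForm.lineIntegral]
  simp only [h4]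
  rw [intervalIntegral.integral_div, h7, hk]
  have := Real.pi_ne_zero
  simp [this]

namespace LineBundle

variable {m : ℕ} {M : Type u} [TopologicalSpace M] [ChartedSpace (EuclideanSpace ℝ (Fin m)) M]
  [IsManifold (𝓡 m) ∞ M] {E : LineBundle.{u, w} m M}

namespace Connection

/-- A loop with a parallel lift has trivial holonomy. -/
theorem hasHolonomy_zero (α : E.Connection) {γ : ℝ → M} {s : ℝ → E.Total} (hs : IsLoopLift E γ s)
    (hflat : ∀ t, DiffForm.pullback (I := 𝓘(ℝ, ℝ)) s α.form t = 0) : α.HasHolonomy γ 0 := by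
  refine ⟨⟨s, hs⟩, fun η hη => ?_⟩
  -- Any other lift is a nonvanishing loop `u` times the parallel one, so its integral is the
  -- winding number of `u`.
  let u : ℝ → ℂ := fun t => E.coord (η t) / E.coord (s t)
  have hbase : ∀ t, (η t).1 = (s t).1 := fun t => (hη.2.2.2 t).trans (hs.2.2.2 t).symm
  have hu0 : ∀ t, u t ≠ 0 := fun t => div_ne_zero (hη.2.2.1 t) (hs.2.2.1 t)
  have hηu : ∀ t, η t = E.smul (u t) (s t) := fun t => by
    refine total_ext (i := E.indexAt (η t).1) (hbase t) (E.mem_baseSet_at _) ?_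
    rw [fibreCoord_indexAt, hbase t, fibreCoord_smul, fibreCoord_indexAt]
    exact (div_mul_cancel₀ _ (hs.2.2.1 t)).symm
  have hu : ContDiff ℝ ∞ u := contDiff_iff_contDiffAt.2 fun t => by
    have hi := E.mem_baseSet_at (s t).1
    have hi' : (η t).1 ∈ E.baseSet (E.indexAt (s t).1) := (hbase t).symm ▸ hi
    have h1 := ((contMDiffAt_total hi).1 (hs.1 t)).2.contDiffAt
    have h2 := ((contMDiffAt_total hi').1 (hη.1 t)).2.contDiffAt
    refine (h2.mul (h1.inv ((fibreCoord_ne_zero hi).2 (hs.2.2.1 t)))).congr_of_eventuallyEq ?_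
    filter_upwards [(hs.1 t).continuousAt.eventually (eventually_mem_baseSet hi)] with t' ht'
    have h3 : E.fibreCoord (E.indexAt (s t).1) (η t') =
        u t' * E.fibreCoord (E.indexAt (s t).1) (s t') := by rw [hηu t', fibreCoord_smul]
    rw [h3]
    exact (mul_inv_cancel_right₀ ((fibreCoord_ne_zero ht').2 (hs.2.2.1 t')) _).symm
  have hpull : ∀ t, DiffForm.pullback (I := 𝓘(ℝ, ℝ)) η α.form t =
      DiffForm.pullback (I := 𝓘(ℝ, ℝ)) u argForm t := fun t => by
    rw [DiffForm.pullback_congr (g := fun t => E.smul (u t) (s t)) α.form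
      (Filter.Eventually.of_forall hηu), α.pullback_smul hu.contMDiff.contMDiffAt (hs.1 t) (hu0 t)
        (hs.2.2.1 t), hflat t, add_zero]
  have hper : ∀ {f : ℝ → E.Total}, Function.Periodic f 1 → f 1 = f 0 := fun {f} hf => by
    simpa using hf 0
  obtain ⟨k, hk⟩ := exists_int_lineIntegral_argForm hu hu0 (by
    simp only [u, hper hη.2.1, hper hs.2.1])
  simp only [hpull]
  change ((-argForm.lineIntegral u : ℝ) : AddCircle (1 : ℝ)) = 0
  rw [hk, AddCircle.coe_eq_zero_iff]
  exact ⟨-k, by simp⟩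

end Connection

end LineBundle

/-! ### Phases of complex numbers modulo `ℤ`. -/

/-- The argument of a complex number, as an element of `ℝ/ℤ`. -/
def phase (z : ℂ) : AddCircle (1 : ℝ) := ((z.arg / (2 * Real.pi) : ℝ) : AddCircle (1 : ℝ))

theorem norm_mul_phaseExp_phase (z : ℂ) : (‖z‖ : ℂ) * phaseExp (phase z) = z := by
  rw [phase, phaseExp_coe]
  refine Eq.trans ?_ (Complex.norm_mul_exp_arg_mul_I z)
  have := Real.pi_ne_zero
  congr 2
  push_cast
  field_simp

theorem norm_phaseExp (a : AddCircle (1 : ℝ)) : ‖phaseExp a‖ = 1 := Circle.norm_coe _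

theorem phase_ofReal_mul_phaseExp {r : ℝ} (hr : 0 < r) (a : AddCircle (1 : ℝ)) :
    phase (r * phaseExp a) = a := by
  refine phaseExp_injective (mul_left_cancel₀ (Complex.ofReal_ne_zero.2 hr.ne') ?_)
  have h := norm_mul_phaseExp_phase (r * phaseExp a)
  rwa [norm_mul, norm_phaseExp, mul_one, Complex.norm_real, Real.norm_of_nonneg hr.le] at h

theorem phase_mul {z z' : ℂ} (hz : z ≠ 0) (hz' : z' ≠ 0) :
    phase (z * z') = phase z + phase z' := by
  have h : z * z' = ((‖z‖ * ‖z'‖ : ℝ) : ℂ) * phaseExp (phase z + phase z') := by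
    rw [phaseExp_add]
    nth_rewrite 1 [← norm_mul_phaseExp_phase z, ← norm_mul_phaseExp_phase z']
    push_cast
    ring
  rw [h, phase_ofReal_mul_phaseExp (mul_pos (norm_pos_iff.2 hz) (norm_pos_iff.2 hz'))]

theorem phase_pow {z : ℂ} (hz : z ≠ 0) (N : ℕ) : phase (z ^ N) = N • phase z := by
  induction N with
  | zero => simp [phase]
  | succ N ih => rw [pow_succ, phase_mul (pow_ne_zero _ hz) hz, ih, succ_nsmul]

theorem exp_polar (μ ξ : ℝ) : Complex.exp (μ + 2 * Real.pi * Complex.I * ξ) =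
    (Real.exp μ : ℝ) * phaseExp (ξ : AddCircle (1 : ℝ)) := by
  rw [Complex.exp_add, phaseExp_coe, Complex.ofReal_exp]

theorem phase_exp_polar (μ ξ : ℝ) :
    phase (Complex.exp (μ + 2 * Real.pi * Complex.I * ξ)) = (ξ : AddCircle (1 : ℝ)) := by
  rw [exp_polar, phase_ofReal_mul_phaseExp (Real.exp_pos μ)]

section

variable {E : Type*} [NormedAddCommGroup E] [NormedSpace ℝ E]
  {H : Type*} [TopologicalSpace H] {I : ModelWithCorners ℝ E H}
  {M : Type*} [TopologicalSpace M] [ChartedSpace H M]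

theorem DiffForm.pullback_lineForm_add {f g : M → ℝ} {x : M}
    (hf : MDifferentiableAt I 𝓘(ℝ, ℝ) f x) (hg : MDifferentiableAt I 𝓘(ℝ, ℝ) g x) :
    pullback (I := I) (fun y => f y + g y) lineForm x =
      pullback (I := I) f lineForm x + pullback (I := I) g lineForm x := by
  have h := (hf.hasMFDerivAt.add hg.hasMFDerivAt).mfderiv
  refine one_ext (η := pullback (I := I) (fun y => f y + g y) lineForm)
    (η' := pullback (I := I) f lineForm + pullback (I := I) g lineForm) fun v => ?_
  exact DFunLike.congr_fun h v

theorem DiffForm.pullback_lineForm_const_mul (c : ℝ) {f : M → ℝ} {x : M}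
    (hf : MDifferentiableAt I 𝓘(ℝ, ℝ) f x) :
    pullback (I := I) (fun y => c * f y) lineForm x = c • pullback (I := I) f lineForm x := by
  have h := (hf.hasMFDerivAt.const_smul c).mfderiv
  refine one_ext (η := pullback (I := I) (fun y => c * f y) lineForm)
    (η' := c • pullback (I := I) f lineForm) fun v => ?_
  exact DFunLike.congr_fun h v

end

/-! ### Hermitian metrics and parallel sections. -/

section

variable {m : ℕ} {M : Type u} [TopologicalSpace M] [ChartedSpace (EuclideanSpace ℝ (Fin m)) M]
  [IsManifold (𝓡 m) ∞ M] [T2Space M] [SigmaCompactSpace M] {E : LineBundle.{u, w} m M}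
  {G : Type*} [NormedAddCommGroup G] [NormedSpace ℝ G]
  {H : Type*} [TopologicalSpace H] {J : ModelWithCorners ℝ G H}
  {N : Type*} [TopologicalSpace N] [ChartedSpace H N]

namespace LineBundle

/-- A line bundle has a Hermitian metric, given here by the logarithms of the norms of the unit
sections of the trivializations. -/
theorem exists_metric (E : LineBundle.{u, w} m M) : ∃ μ : E.ι → M → ℝ,
    (∀ i, ∀ x ∈ E.baseSet i, ContMDiffAt (𝓡 m) 𝓘(ℝ, ℝ) ∞ (μ i) x) ∧
      ∀ i j, ∀ x ∈ E.baseSet i ∩ E.baseSet j, ‖E.g i j x‖ = Real.exp (μ i x - μ j x) := by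
  have hsmooth : ∀ i j, ∀ x ∈ E.baseSet i ∩ E.baseSet j,
      ContMDiffAt (𝓡 m) 𝓘(ℝ, ℝ) ∞ (fun x => Real.log ‖E.g i j x‖) x := fun i j x hx => by
    have h1 := g_ne_zero hx.1 hx.2
    have h2 : ContDiffAt ℝ ∞ (fun z : ℂ => Real.log ‖z‖) (E.g i j x) :=
      (contDiffAt_norm ℝ h1).log (norm_ne_zero_iff.2 h1)
    exact h2.contMDiffAt.comp x (contMDiffAt_g hx.1 hx.2)
  have hcocycle : ∀ i j k, ∀ x ∈ E.baseSet i ∩ E.baseSet j ∩ E.baseSet k,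
      Real.log ‖E.g i j x‖ + Real.log ‖E.g j k x‖ = Real.log ‖E.g i k x‖ := fun i j k x hx => by
    have h1 := norm_ne_zero_iff.2 (g_ne_zero hx.1.1 hx.1.2)
    have h2 := norm_ne_zero_iff.2 (g_ne_zero hx.1.2 hx.2)
    rw [← E.g_comp i j k x hx, norm_mul, Real.log_mul h2 h1, add_comm]
  obtain ⟨μ, hμ, h⟩ := exists_smooth_cech_primitive (I := 𝓡 m) (U := E.baseSet) E.isOpen_baseSet
    (fun x => ⟨_, E.mem_baseSet_at x⟩) hsmooth hcocycle
  exact ⟨μ, hμ, fun i j x hx => by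
    rw [← h i j x hx, Real.exp_log (norm_pos_iff.2 (g_ne_zero hx.1 hx.2))]⟩

/-- Local primitives of the connection form that fit together modulo `ℤ` define a parallel
section. -/
theorem IsLocalData.exists_parallel_section {θ : E.ι → DiffForm (𝓡 m) M 1} (h : E.IsLocalData θ)
    {f : N → M} (hf : ContMDiff J (𝓡 m) ∞ f) (κ : N → AddCircle (1 : ℝ))
    (hκ : ∀ p, ∃ (i : E.ι) (ξ : N → ℝ), f p ∈ E.baseSet i ∧ ContMDiffAt J 𝓘(ℝ, ℝ) ∞ ξ p ∧
      (∀ᶠ y in 𝓝 p, κ y = phase (E.g i (E.indexAt (f y)) (f y)) + (ξ y : AddCircle (1 : ℝ))) ∧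
      DiffForm.pullback (I := J) f (θ i) p + DiffForm.pullback (I := J) ξ lineForm p = 0) :
    ∃ s : N → E.Total, ContMDiff J (totalModel m) ∞ s ∧ (∀ y, s y ∈ E.nonzero) ∧
      (∀ y, (s y).1 = f y) ∧
      ∀ y, DiffForm.pullback (I := J) s h.connection.form y = 0 := by
  obtain ⟨μ, hμ, hg⟩ := E.exists_metric
  -- The section of phase `κ` and of norm one for the metric. The metric makes the modulus smooth
  -- although the preferred index jumps.
  let s : N → E.Total := fun y =>
    ⟨f y, ((Real.exp (-μ (E.indexAt (f y)) (f y)) : ℝ) * phaseExp (κ y) : ℂ)⟩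
  have hcoord : ∀ i y, E.fibreCoord i (s y) = E.g (E.indexAt (f y)) i (f y) *
      ((Real.exp (-μ (E.indexAt (f y)) (f y)) : ℝ) * phaseExp (κ y)) := fun i y => rfl
  have hnz : ∀ y, s y ∈ E.nonzero := fun y =>
    mul_ne_zero (Complex.ofReal_ne_zero.2 (Real.exp_ne_zero _)) (phaseExp_ne_zero _)
  have key : ∀ p, ContMDiffAt J (totalModel m) ∞ s p ∧
      DiffForm.pullback (I := J) s h.connection.form p = 0 := fun p => by
    obtain ⟨i, ξ, hi, hξ, he, hθ⟩ := hκ p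
    -- In the fixed trivialization `i`, the modulus and the phase of the transition function absorb
    -- the jumps of `μ` and of `κ`; what remains is a smooth polar form.
    have hloc : (fun y => E.fibreCoord i (s y)) =ᶠ[𝓝 p] fun y =>
        Complex.exp (((-μ i (f y) : ℝ) : ℂ) + 2 * Real.pi * Complex.I * ξ y) := by
      filter_upwards [he, hf.continuous.continuousAt.preimage_mem_nhds
        ((E.isOpen_baseSet i).mem_nhds hi)] with y hy (hyi : f y ∈ E.baseSet i)
      have hk := E.mem_baseSet_at (f y)
      have h1 : phase (E.g (E.indexAt (f y)) i (f y)) + phase (E.g i (E.indexAt (f y)) (f y)) =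
          0 := by
        rw [← phase_mul (g_ne_zero hk hyi) (g_ne_zero hyi hk), g_mul_g hyi hk]
        simp [phase]
      have h2 := norm_mul_phaseExp_phase (E.g (E.indexAt (f y)) i (f y))
      rw [hcoord, hy, exp_polar, ← h2, hg _ _ _ ⟨hk, hyi⟩, mul_mul_mul_comm, ← phaseExp_add,
        ← Complex.ofReal_mul, ← Real.exp_add, ← add_assoc, h1, zero_add]
      congr 3
      ring
    have hμf : ContMDiffAt J 𝓘(ℝ, ℝ) ∞ (fun y => -μ i (f y)) p :=
      ((hμ i _ hi).comp p hf.contMDiffAt).neg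
    have hs : ContMDiffAt J (totalModel m) ∞ s p :=
      (contMDiffAt_total (f := s) (i := i) hi).2
        ⟨hf.contMDiffAt, (contMDiffAt_exp_polar hμf hξ).congr_of_eventuallyEq hloc⟩
    refine ⟨hs, (h.pullback_totalForm hs (i := i) hi (hnz p)).trans ?_⟩
    rw [DiffForm.pullback_congr argForm hloc, DiffForm.pullback_argForm_exp
      (hμf.mdifferentiableAt (by simp)) (hξ.mdifferentiableAt (by simp))]
    exact hθ
  exact ⟨s, fun p => (key p).1, hnz, fun _ => rfl, fun p => (key p).2⟩

/-- Pulling back a connection to a submanifold on which it has a parallel section yields trivial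
holonomy. -/
theorem Connection.hasHolonomy_zero_of_parallel_section (α : E.Connection) {f : N → M}
    {s : N → E.Total} (hs : ContMDiff J (totalModel m) ∞ s) (hnz : ∀ y, s y ∈ E.nonzero)
    (hsf : ∀ y, (s y).1 = f y) (hα : ∀ y, DiffForm.pullback (I := J) s α.form y = 0)
    {γ : ℝ → N} (hγ : ContMDiff 𝓘(ℝ, ℝ) J ∞ γ) (hper : Function.Periodic γ 1) :
    α.HasHolonomy (f ∘ γ) 0 := by
  refine α.hasHolonomy_zero (s := s ∘ γ)
    ⟨hs.comp hγ, fun t => congrArg s (hper t), fun t => hnz _, fun t => hsf _⟩ fun t => ?_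
  rw [DiffForm.pullback_comp α.form (hs.mdifferentiableAt (by simp))
    (hγ.mdifferentiableAt (by simp)), DiffForm.pullback_congr_form (η' := 0) (hα _)]
  rfl

end LineBundle

end

/-! ### Flatness over a Lagrangian and correction of the connection. -/

namespace LineBundle

section

variable {m : ℕ} {M : Type u} [TopologicalSpace M] [ChartedSpace (EuclideanSpace ℝ (Fin m)) M]
  [IsManifold (𝓡 m) ∞ M] {E : LineBundle.{u, w} m M}
  {n : ℕ} {L : Type u} [TopologicalSpace L] [ChartedSpace (EuclideanSpace ℝ (Fin n)) L]
  [IsManifold (𝓡 n) ∞ L]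

/-- The differential of the pulled back `θ i` is the pullback of `Ω`, which is zero, so the Poincaré
lemma applies. -/
theorem IsLocalData.exists_primitive {θ : E.ι → DiffForm (𝓡 m) M 1} (h : E.IsLocalData θ)
    {Ω : DiffForm (𝓡 m) M 2} (hd : ∀ i, ∀ x ∈ E.baseSet i, (θ i).d x = Ω x) {f : L → M}
    (hf : ContMDiff (𝓡 n) (𝓡 m) ∞ f) (hΩ : DiffForm.pullback (I := 𝓡 n) f Ω = 0)
    {i : E.ι} {p : L} (hi : f p ∈ E.baseSet i) : ∃ (V : Set L) (ψ : L → ℝ), IsOpen V ∧ p ∈ V ∧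
      ∀ y ∈ V, f y ∈ E.baseSet i ∧ ContMDiffAt (𝓡 n) 𝓘(ℝ, ℝ) ∞ ψ y ∧
        DiffForm.pullback (I := 𝓡 n) f (θ i) y = DiffForm.pullback (I := 𝓡 n) ψ lineForm y := by
  have hB : ∀ᶠ y in 𝓝 p, f y ∈ E.baseSet i :=
    hf.continuous.continuousAt.preimage_mem_nhds ((E.isOpen_baseSet i).mem_nhds hi)
  obtain ⟨ψ, hψ⟩ := exists_local_primitive_of_closed
    (η := DiffForm.pullback (I := 𝓡 n) f (θ i)) (x := p)
    (hB.mono fun y hy => (h.smoothAt i _ hy).pullback hf.contMDiffAt)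
    (hB.mono fun y hy => by
      rw [DiffForm.d_pullback (h.smoothAt i _ hy) hf.contMDiffAt,
        DiffForm.pullback_congr_form (hd i _ hy), hΩ]
      rfl)
  obtain ⟨V, hV, hVo, hpV⟩ := eventually_nhds_iff.1 (hB.and hψ)
  exact ⟨V, ψ, hVo, hpV, hV⟩

/-- The phases of the local parallel sections of a flat line bundle differ by locally constant
functions. -/
theorem IsLocalData.eventually_phase_sub_eq {θ : E.ι → DiffForm (𝓡 m) M 1} (h : E.IsLocalData θ)
    {f : L → M} (hf : ContMDiff (𝓡 n) (𝓡 m) ∞ f) {i j : E.ι} {ψ ψ' : L → ℝ} {p : L}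
    (hi : ∀ᶠ y in 𝓝 p, f y ∈ E.baseSet i ∧ ContMDiffAt (𝓡 n) 𝓘(ℝ, ℝ) ∞ ψ y ∧
      DiffForm.pullback (I := 𝓡 n) f (θ i) y = DiffForm.pullback (I := 𝓡 n) ψ lineForm y)
    (hj : ∀ᶠ y in 𝓝 p, f y ∈ E.baseSet j ∧ ContMDiffAt (𝓡 n) 𝓘(ℝ, ℝ) ∞ ψ' y ∧
      DiffForm.pullback (I := 𝓡 n) f (θ j) y = DiffForm.pullback (I := 𝓡 n) ψ' lineForm y) :
    ∃ c : AddCircle (1 : ℝ), ∀ᶠ y in 𝓝 p,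
      (phase (E.g i (E.indexAt (f y)) (f y)) - (ψ y : AddCircle (1 : ℝ))) -
        (phase (E.g j (E.indexAt (f y)) (f y)) - (ψ' y : AddCircle (1 : ℝ))) = c := by
  have hgf : ContMDiffAt (𝓡 n) 𝓘(ℝ, ℂ) ∞ (fun y => E.g i j (f y)) p :=
    (contMDiffAt_g hi.self_of_nhds.1 hj.self_of_nhds.1).comp p hf.contMDiffAt
  obtain ⟨μ, ξ, hμ, hξ, hpol⟩ := DiffForm.exists_local_polar hgf
    (g_ne_zero hi.self_of_nhds.1 hj.self_of_nhds.1)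
  have hmd : ∀ {g : L → ℝ}, ContMDiffAt (𝓡 n) 𝓘(ℝ, ℝ) ∞ g p →
      ∀ᶠ y in 𝓝 p, MDifferentiableAt (𝓡 n) 𝓘(ℝ, ℝ) g y := fun hg =>
    ((contMDiffAt_iff_contMDiffAt_nhds (by simp)).1
      (hg.of_le (show (1 : WithTop ℕ∞) ≤ ∞ by exact_mod_cast le_top))).mono fun y hy =>
        hy.mdifferentiableAt (by simp)
  -- With `ξ` a local phase of `g i j`, the change of connection form says exactly that `dR = 0`.
  let R : L → ℝ := fun y => ξ y + (-1 * ψ y + ψ' y)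
  have hR : ∀ᶠ y in 𝓝 p, MDifferentiableAt (𝓡 n) 𝓘(ℝ, ℝ) R y ∧
      DiffForm.pullback (I := 𝓡 n) R lineForm y = 0 := by
    filter_upwards [hi, hj, hmd hμ, hmd hξ, hpol.eventually_nhds] with y ⟨hyi, hψ, h1⟩ ⟨hyj, hψ', h2⟩
      hμy hξy hpy
    have hψ1 : ContMDiffAt (𝓡 n) 𝓘(ℝ, ℝ) ∞ (fun y => -1 * ψ y) y := contMDiffAt_const.mul hψ
    have hsum : ContMDiffAt (𝓡 n) 𝓘(ℝ, ℝ) ∞ (fun y => -1 * ψ y + ψ' y) y := hψ1.add hψ'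
    refine ⟨hξy.add (hsum.mdifferentiableAt (by simp)), ?_⟩
    have h3 : DiffForm.pullback (I := 𝓡 n) f (θ i) y = DiffForm.pullback (I := 𝓡 n) f
        (θ j + DiffForm.pullback (I := 𝓡 m) (E.g i j) argForm) y :=
      DiffForm.pullback_congr_form (h.change i j _ ⟨hyi, hyj⟩)
    rw [DiffForm.pullback_add, ← DiffForm.pullback_comp argForm
      ((contMDiffAt_g hyi hyj).mdifferentiableAt (by simp))
      (hf.mdifferentiableAt (by simp)), DiffForm.pullback_congr (f := E.g i j ∘ f) argForm hpy,
      DiffForm.pullback_argForm_exp hμy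
        hξy, h1, h2] at h3
    rw [DiffForm.pullback_lineForm_add hξy
      (hsum.mdifferentiableAt (by simp)), DiffForm.pullback_lineForm_add
      (hψ1.mdifferentiableAt (by simp)) (hψ'.mdifferentiableAt (by simp)),
      DiffForm.pullback_lineForm_const_mul _ (hψ.mdifferentiableAt (by simp)), h3]
    module
  refine ⟨(R p : AddCircle (1 : ℝ)), ?_⟩
  filter_upwards [eventually_eq_of_pullback_eq_zero hR, hi, hj, hpol] with y hRy ⟨hyi, _⟩
    ⟨hyj, _⟩ hpy
  have hk := E.mem_baseSet_at (f y)
  rw [← hRy, ← E.g_comp i j _ (f y) ⟨⟨hyi, hyj⟩, hk⟩, phase_mul (g_ne_zero hyj hk)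
    (g_ne_zero hyi hyj), hpy, phase_exp_polar]
  simp only [R, AddCircle.coe_add, neg_one_mul, AddCircle.coe_neg]
  abel

/-- The main construction: a real cocycle on `L` lifting `N` times the holonomy of the flat bundle
`E|_L` extends to `M` and is used to correct the connection on `E^{⊗N}`. -/
theorem IsLocalData.exists_parallel_section_tensorPower [T2Space M] [SigmaCompactSpace M]
    {θ : E.ι → DiffForm (𝓡 m) M 1} (h : E.IsLocalData θ) (f : C(L, M))
    (hf : ContMDiff (𝓡 n) (𝓡 m) ∞ f) (hinj : Function.Injective (singularH1Map f))
    {V : L → Set L} {ψ : L → L → ℝ} (hV : ∀ p, IsOpen (V p)) (hpV : ∀ p, p ∈ V p)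
    (hψ : ∀ p, ∀ y ∈ V p, f y ∈ E.baseSet (E.indexAt (f p)) ∧
      ContMDiffAt (𝓡 n) 𝓘(ℝ, ℝ) ∞ (ψ p) y ∧
      DiffForm.pullback (I := 𝓡 n) f (θ (E.indexAt (f p))) y =
        DiffForm.pullback (I := 𝓡 n) (ψ p) lineForm y)
    {c : SingularCochain L (AddCircle (1 : ℝ)) 1} {w : L → AddCircle (1 : ℝ)}
    (hc : ∀ p, ∃ W : Set L, IsOpen W ∧ p ∈ W ∧ ∀ s : SingularSimplex L 1, (∀ t, s t ∈ W) →
      c s = ((phase (E.g (E.indexAt (f p)) (E.indexAt (f s.target)) (f s.target)) -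
          (ψ p s.target : AddCircle (1 : ℝ))) -
        (phase (E.g (E.indexAt (f p)) (E.indexAt (f s.source)) (f s.source)) -
          (ψ p s.source : AddCircle (1 : ℝ)))) + (w s.target - w s.source))
    (N : ℕ) {a : SingularCochain L ℝ 1} (ha : singularCoboundary L ℝ 1 a = 0)
    (hac : ∀ s, ((a s : ℝ) : AddCircle (1 : ℝ)) = N • c s) :
    ∃ (β : DiffForm (𝓡 m) M 1) (hβ : ∀ x, β.SmoothAt x), (∀ x, β.d x = 0) ∧
      ∃ s : L → (E.tensorPower N).Total, ContMDiff (𝓡 n) (totalModel m) ∞ s ∧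
        (∀ y, s y ∈ (E.tensorPower N).nonzero) ∧ (∀ y, (s y).1 = f y) ∧
        ∀ y, DiffForm.pullback (I := 𝓡 n) s (h.tensorPower N hβ).connection.form y = 0 := by
  -- The only use of injectivity on `H_1`: `a` comes from `M` up to the coboundary of `w₂`.
  obtain ⟨a', w₂, ha', haa'⟩ := exists_singularCocycle_extension f hinj a ha
  obtain ⟨β, w₃, hβ, hdβ, hβa⟩ := exists_closed_form_of_cocycle (I := 𝓡 m) ha'
  refine ⟨β, hβ, hdβ, (h.tensorPower N hβ).exists_parallel_section hf
    (fun y => ((w₃ (f y) - w₂ y : ℝ) : AddCircle (1 : ℝ)) - N • w y) fun p => ?_⟩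
  obtain ⟨W, hW, hpW, hcW⟩ := hc p
  obtain ⟨W', v, hW', hpW', hv, hvs⟩ := hβa (f p)
  let i := E.indexAt (f p)
  let Φ : L → AddCircle (1 : ℝ) := fun y =>
    phase (E.g i (E.indexAt (f y)) (f y)) - (ψ p y : AddCircle (1 : ℝ))
  obtain ⟨hip, hψp, hθp⟩ := hψ p p (hpV p)
  have hvp : ContMDiffAt (𝓡 n) 𝓘(ℝ, ℝ) ∞ (fun y => v (f y)) p :=
    (hv _ hpW').1.comp p hf.contMDiffAt
  let κ : L → AddCircle (1 : ℝ) := fun y => ((w₃ (f y) - w₂ y : ℝ) : AddCircle (1 : ℝ)) - N • w y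
  -- On a short path, `a` is the increment of `v ∘ f + w₃ ∘ f - w₂`, and `c` is that of `Φ + w`.
  -- Since `a` reduces to `N • c`, the phase `κ` was chosen so that this combination has increment
  -- zero.
  have hconst : ∀ᶠ y in 𝓝 p, κ y + (v (f y) : AddCircle (1 : ℝ)) - N • Φ y =
      κ p + (v (f p) : AddCircle (1 : ℝ)) - N • Φ p := by
    have hnhds : W ∩ (f ⁻¹' W' : Set L) ∈ 𝓝 p :=
      (hW.inter (hW'.preimage f.continuous)).mem_nhds ⟨hpW, hpW'⟩
    filter_upwards [eventually_exists_path (𝓡 n) hnhds] with y ⟨s, hs0, hs1, hs⟩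
    have h1 := hcW s fun t => (hs t).1
    have h2 := hvs (f.comp s) fun t => (hs t).2
    have h3 : SingularSimplex.target (f.comp s) = f s.target := rfl
    have h4 : SingularSimplex.source (f.comp s) = f s.source := rfl
    rw [haa', h3, h4, hs0, hs1] at h2
    rw [hs0, hs1] at h1
    have h5 := hac s
    have h6 : c s = (Φ y - Φ p) + (w y - w p) := h1
    rw [h6, show a s = (v (f y) - v (f p)) + (w₃ (f y) - w₃ (f p)) - (w₂ y - w₂ p) by
      linarith] at h5
    simp only [κ, AddCircle.coe_sub, AddCircle.coe_add, smul_add, smul_sub] at h5 ⊢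
    rw [← sub_eq_zero] at h5 ⊢
    rw [← h5]
    abel
  obtain ⟨r, hr⟩ := QuotientAddGroup.mk_surjective
    (κ p + (v (f p) : AddCircle (1 : ℝ)) - N • Φ p)
  have hξ1 : ContMDiffAt (𝓡 n) 𝓘(ℝ, ℝ) ∞ (fun y => -(N : ℝ) * ψ p y) p := contMDiffAt_const.mul hψp
  have hξ2 : ContMDiffAt (𝓡 n) 𝓘(ℝ, ℝ) ∞ (fun y => -1 * v (f y)) p := contMDiffAt_const.mul hvp
  have hξ3 : ContMDiffAt (𝓡 n) 𝓘(ℝ, ℝ) ∞ (fun y => -(N : ℝ) * ψ p y + -1 * v (f y)) p :=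
    hξ1.add hξ2
  -- Solving the previous identity for `κ` gives the phase of the `N`-th power of the transition
  -- function plus this `ξ`. Its differential is minus the pullback of `N θ i + β`, so the section
  -- is parallel.
  refine ⟨i, fun y => -(N : ℝ) * ψ p y + -1 * v (f y) + r, hip, hξ3.add contMDiffAt_const, ?_, ?_⟩
  · filter_upwards [hconst, (hV p).mem_nhds (hpV p)] with y hy hyV
    have h1 : phase ((E.tensorPower N).g i ((E.tensorPower N).indexAt (f y)) (f y)) =
        N • phase (E.g i (E.indexAt (f y)) (f y)) :=
      phase_pow (g_ne_zero (hψ p y hyV).1 (E.mem_baseSet_at _)) N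
    rw [h1, AddCircle.coe_add, show ((r : ℝ) : AddCircle (1 : ℝ)) = _ from hr, ← hy]
    have h2 : ((-(N : ℝ) * ψ p y + -1 * v (f y) : ℝ) : AddCircle (1 : ℝ)) =
        -(N • (ψ p y : AddCircle (1 : ℝ))) - (v (f y) : AddCircle (1 : ℝ)) := by
      rw [← AddCircle.coe_nsmul, ← AddCircle.coe_neg, ← AddCircle.coe_sub, nsmul_eq_mul]
      congr 1
      ring
    rw [h2]
    change κ y = _
    simp only [Φ, smul_sub]
    abel
  · have h1 : DiffForm.pullback (I := 𝓡 n) f β p =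
        DiffForm.pullback (I := 𝓡 n) (fun y => v (f y)) lineForm p :=
      (DiffForm.pullback_congr_form (hv _ hpW').2).trans (DiffForm.pullback_comp lineForm
        ((hv _ hpW').1.mdifferentiableAt (by simp)) (hf.mdifferentiableAt (by simp))).symm
    have h2 : DiffForm.pullback (I := 𝓡 n) f ((N : ℝ) • θ i + β) p = _ :=
      (DiffForm.pullback_add f ((N : ℝ) • θ i) β p).trans
        (congrArg₂ (· + ·) (DiffForm.pullback_smul f (N : ℝ) (θ i) p) h1)
    refine (congrArg (· + _) h2).trans ?_
    rw [DiffForm.pullback_lineForm_congr (c := r) (Filter.Eventually.of_forall fun y => rfl)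
      (hξ3.mdifferentiableAt (by simp)), DiffForm.pullback_lineForm_add
      (hξ1.mdifferentiableAt (by simp)) (hξ2.mdifferentiableAt (by simp)),
      DiffForm.pullback_lineForm_const_mul _ (hψp.mdifferentiableAt (by simp)),
      DiffForm.pullback_lineForm_const_mul _ (hvp.mdifferentiableAt (by simp)), hθp]
    module

end

/-- Bohr-Sommerfeld pairs on tensor powers of a prequantum line bundle. -/
theorem HasRealChernClass.exists_isBohrSommerfeldPair {n : ℕ}
    {M : Type u} [TopologicalSpace M] [ChartedSpace (EuclideanSpace ℝ (Fin (2 * n))) M]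
    [IsManifold (𝓡 (2 * n)) ∞ M] [T2Space M] [SigmaCompactSpace M]
    {L : Type u} [TopologicalSpace L] [ChartedSpace (EuclideanSpace ℝ (Fin n)) L]
    [IsManifold (𝓡 n) ∞ L] [CompactSpace L]
    {Ω : DiffForm (𝓡 (2 * n)) M 2} {i : C(L, M)} (hi : IsLagrangianEmbedding Ω i)
    (hinj : Function.Injective (singularH1Map i)) {E : LineBundle.{u, w} (2 * n) M}
    (hE : E.HasRealChernClass (-Ω)) :
    (∃ N : ℕ, 0 < N ∧ ∃ α : (E.tensorPower N).Connection,
      IsBohrSommerfeldPair Ω i (E.tensorPower N) α N) ∧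
    (Module.Free ℤ (SingularH2 L ℤ) →
      ∃ α : (E.tensorPower 1).Connection, IsBohrSommerfeldPair Ω i (E.tensorPower 1) α 1) := by
  -- `L` inherits separation from `M`; the shrinking of covers in `exists_fg_cocycle_of_flat` uses
  -- it.
  have : T2Space L := hi.embedding.isEmbedding.t2Space
  have hf : ContMDiff (𝓡 n) (𝓡 (2 * n)) ∞ i := hi.embedding.contMDiff
  obtain ⟨θ, hθ, hd⟩ := hE.exists_localData
  choose V ψ hV hpV hψ using fun p => hθ.exists_primitive hd hf hi.isotropic
    (E.mem_baseSet_at (i p))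
  have hψn : ∀ p q, p ∈ V q → ∀ᶠ y in 𝓝 p, i y ∈ E.baseSet (E.indexAt (i q)) ∧
      ContMDiffAt (𝓡 n) 𝓘(ℝ, ℝ) ∞ (ψ q) y ∧
      DiffForm.pullback (I := 𝓡 n) i (θ (E.indexAt (i q))) y =
        DiffForm.pullback (I := 𝓡 n) (ψ q) lineForm y := fun p q hpq => by
    filter_upwards [(hV q).mem_nhds hpq] with y hy using hψ q y hy
  -- The cocycle `c` encodes the holonomy of the flat bundle over `L`: its local data are the phases
  -- of local parallel sections, up to sign.
  obtain ⟨c, hc, ⟨G, hG, hcG⟩, w, hw⟩ := exists_fg_cocycle_of_flat V hV hpV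
    (fun p y => phase (E.g (E.indexAt (i p)) (E.indexAt (i y)) (i y)) -
      (ψ p y : AddCircle (1 : ℝ))) fun p q hpq => by
    obtain ⟨r, hr⟩ := hθ.eventually_phase_sub_eq hf (hψn p p (hpV p)) (hψn p q hpq)
    filter_upwards [hr] with y hy
    exact hy.trans hr.self_of_nhds.symm
  have key : ∀ N : ℕ, 0 < N → ∀ a : SingularCochain L ℝ 1, singularCoboundary L ℝ 1 a = 0 →
      (∀ s, ((a s : ℝ) : AddCircle (1 : ℝ)) = N • c s) →
      ∃ α : (E.tensorPower N).Connection,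
        IsBohrSommerfeldPair Ω i (E.tensorPower N) α N := fun N hN a ha hac => by
    obtain ⟨β, hβ, hdβ, s, hs, hnz, hsi, hflat⟩ :=
      hθ.exists_parallel_section_tensorPower i hf hinj hV hpV hψ hw N ha hac
    -- Since `β` is closed, `d(N θ j + β) = N Ω`; the holonomy is the element `0` of the allowed
    -- set.
    refine ⟨(hθ.tensorPower N hβ).connection, hN, IsLocalData.hasCurvature_connection _
      fun j x hx => ?_, fun γ hγ hper => ⟨0, by simp,
        Connection.hasHolonomy_zero_of_parallel_section _ hs hnz hsi hflat hγ hper⟩⟩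
    rw [DiffForm.d_add ((hθ.smoothAt j x hx).smul _) (hβ x), DiffForm.d_smul, hd j x hx, hdβ x,
      add_zero]
    rfl
  obtain ⟨⟨N, hN, a, ha, hac⟩, hfree⟩ := exists_real_cocycle_lift c hc G hG hcG
  refine ⟨⟨N, hN, key N hN a ha hac⟩, fun hL => ?_⟩
  obtain ⟨a, ha, hac⟩ := hfree hL
  exact key 1 one_pos a ha fun s => by rw [hac s, one_nsmul]

end LineBundle

end

theorem mainTheorem9 {n : ℕ}
    {M : Type u} [TopologicalSpace M] [ChartedSpace (EuclideanSpace ℝ (Fin (2 * n))) M]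
    [IsManifold (𝓡 (2 * n)) ∞ M] [T2Space M] [CompactSpace M]
    {L : Type u} [TopologicalSpace L] [ChartedSpace (EuclideanSpace ℝ (Fin n)) L]
    [IsManifold (𝓡 n) ∞ L] [CompactSpace L]
    (Ω : DiffForm (𝓡 (2 * n)) M 2) (hΩ : IsSymplectic Ω) (hint : IsIntegralForm Ω)
    (i : C(L, M)) (hi : IsLagrangianEmbedding Ω i)
    (hinj : Function.Injective (singularH1Map i)) :
    (∃ E : LineBundle.{u, u} (2 * n) M, E.HasRealChernClass (-Ω)) ∧
    ∀ E : LineBundle.{u, w} (2 * n) M, E.HasRealChernClass (-Ω) →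
      (∃ N : ℕ, 0 < N ∧ ∃ α : (E.tensorPower N).Connection,
        IsBohrSommerfeldPair Ω i (E.tensorPower N) α N) ∧
      (Module.Free ℤ (SingularH2 L ℤ) →
        ∃ α : (E.tensorPower 1).Connection,
          IsBohrSommerfeldPair Ω i (E.tensorPower 1) α 1) := by
  exact ⟨exists_lineBundle_of_integral hΩ.smooth hΩ.closed hint,
    fun _ hE => hE.exists_isBohrSommerfeldPair hi hinj⟩
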